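/- Let $p\ge 1$ and let $x_1,x_2,\dots\in\mathbb R^p$ be fixed covariate vectors (for instance with first coordinate $1$). For $n\ge1$ let $X=X_n$ be the $n\times p$ matrix with rows $x_1^T,\dots,x_n^T$, and for $S\subseteq\{1,\dots,n\}$ let $X_S$ and $y_S$ consist of the rows of $X$ and entries of $y$ with index in $S$. Assume that $n^{-1}X_n^TX_n\to V^{-1}$ for a positive definite matrix $V$, and that there is $c>0$ such that, for all large $n$ and all $S\subseteq\{1,\dots,n\}$ with $|S|\ge n/2$, the matrix $|S|^{-1}X_S^TX_S-cI$ is positive semidefinite. Let $y_i=x_i^T\beta+\varepsilon_i$ with $\beta\in\mathbb R^p$ and independent, identically distributed errors $\varepsilon_i$. For a training set $S\subsetneq\{1,\dots,n\}$ with $X_S^TX_S$ invertible let $\hat\beta_S=(X_S^TX_S)^{-1}X_S^Ty_S$ be the least squares estimator, and let $$\hat\mu_S=\frac1{n-|S|}\sum_{i\notin S}\bigl(x_i^T\hat\beta_S-y_i\bigr)^2$$ be the average test set error under squared error loss. * Random cross validation: $S$ is uniformly distributed on the subsets of $\{1,\dots,n\}$ of size $n_1$ and independent of the errors, and $n_1^{\rm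 opt}=\arg\min\{\operatorname{Var}(\hat\mu_S): n/2\le n_1\le n-1\}$. * $k$-fold cross validation ($k\ge2$, $k\mid n$): $(T_1,\dots,T_k)$ is a uniformly distributed ordered partition of $\{1,\dots,n\}$ into $k$ sets of size $n/k$, independent of the errors, $\hat\mu_{k\text{-fold}}=\frac1k\sum_{j=1}^k\hat\mu_{T_j^c}$, and $k^{\rm opt}=\arg\min\{\operatorname{Var}(\hat\mu_{k\text{-fold}}): k\ge2,\ k\mid n\}$. Then: (a) If the errors are normal, $\varepsilon_i\sim N(0,\sigma^2)$ with $\sigma^2>0$, then for all sufficiently large $n$ the minimizers are unique and (i) $n_1^{\rm opt}=\lceil n/2\rceil$; (ii) $k^{\rm opt}=n$ (leave-one-out cross validation). (b) If $E(\varepsilon_i)=0$, $E|\varepsilon_i|^{4+\epsilon}<\infty$ for some $\epsilon>0$, and $\operatorname{Var}(\varepsilon_i^2)>0$, then for all sufficiently large $n$ the minimizer in random cross validation is unique and $n_1^{\rm opt}=\lceil n/2\rceil$. -/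

import Mathlib

open MeasureTheory ProbabilityTheory Filter Topology
open scoped NNReal Matrix

noncomputable section

namespace RegressionCV

/-- The design matrix of the first `n` observations; its `i`-th row is the covariate vector `x i`. -/
def design {p : ℕ} (x : ℕ → Fin p → ℝ) (n : ℕ) : Matrix (Fin n) (Fin p) ℝ :=
  Matrix.of fun i => x i

/-- The responses `y = X β + ε` of the first `n` observations, for the error sequence `e`. -/
def response {p : ℕ} (x : ℕ → Fin p → ℝ) (β : Fin p → ℝ) (n : ℕ) (e : ℕ → ℝ) : Fin n → ℝ :=
  fun i => x i ⬝ᵥ β + e i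

/-- The matrix `X_S` formed by the rows of `X` with index in `S`. -/
def rowsOf {n p : ℕ} (X : Matrix (Fin n) (Fin p) ℝ) (S : Finset (Fin n)) :
    Matrix S (Fin p) ℝ :=
  X.submatrix (fun i : S => (i : Fin n)) id

/-- The ordinary least squares estimator computed from the training set `S`:
`(X_Sᵀ X_S)⁻¹ X_Sᵀ y_S`. -/
def ols {n p : ℕ} (X : Matrix (Fin n) (Fin p) ℝ) (y : Fin n → ℝ) (S : Finset (Fin n)) :
    Fin p → ℝ :=
  ((rowsOf X S)ᵀ * rowsOf X S)⁻¹ *ᵥ ((rowsOf X S)ᵀ *ᵥ fun i : S => y i)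

/-- The average test set error under squared error loss: the rule is trained on `S` and
tested on the complement of `S`. -/
def testSetError {n p : ℕ} (X : Matrix (Fin n) (Fin p) ℝ) (y : Fin n → ℝ)
    (S : Finset (Fin n)) : ℝ :=
  (1 / (Sᶜ.card : ℝ)) * ∑ i ∈ Sᶜ, (X i ⬝ᵥ ols X y S - y i) ^ 2

/-- The training sets of size `n₁`. -/
def trainingSets (n n₁ : ℕ) : Set (Finset (Fin n)) := {S | S.card = n₁}

/-- The ordered partitions of the `n` indices into `k` folds of equal size `n / k`:
`g i` is the fold that contains the index `i`. -/
def foldings (n k : ℕ) : Set (Fin n → Fin k) :=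
  {g | ∀ j, (Finset.univ.filter fun i => g i = j).card = n / k}

/-- The `k`-fold cross validation estimator for the folding `g`: each fold serves once as the
test set, the rule being trained on the other folds. -/
def kFoldEstimator {n p : ℕ} (X : Matrix (Fin n) (Fin p) ℝ) (y : Fin n → ℝ) {k : ℕ}
    (g : Fin n → Fin k) : ℝ :=
  (1 / (k : ℝ)) * ∑ j, testSetError X y (Finset.univ.filter fun i => g i ≠ j)

/-- The variance of the average test set error in random cross validation. The training set is
uniformly distributed on the sets of size `n₁` and independent of the errors. -/
def randomCVVariance {Ω : Type*} [MeasurableSpace Ω] (P : Measure Ω) {p : ℕ}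
    (x : ℕ → Fin p → ℝ) (β : Fin p → ℝ) (ε : ℕ → Ω → ℝ) (n n₁ : ℕ) : ℝ :=
  variance
    (fun q : Ω × Finset (Fin n) =>
      testSetError (design x n) (response x β n fun i => ε i q.1) q.2)
    (P.prod (uniformOn (trainingSets n n₁)))

/-- The variance of the `k`-fold cross validation estimator. The folding is uniformly distributed
on the equal-size foldings and independent of the errors. -/
def kFoldVariance {Ω : Type*} [MeasurableSpace Ω] (P : Measure Ω) {p : ℕ}
    (x : ℕ → Fin p → ℝ) (β : Fin p → ℝ) (ε : ℕ → Ω → ℝ) (n k : ℕ) : ℝ :=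
  variance
    (fun q : Ω × (Fin n → Fin k) =>
      kFoldEstimator (design x n) (response x β n fun i => ε i q.1) q.2)
    (P.prod (uniformOn (foldings n k)))

/-- The set of minimizers of `f` over `s`. -/
def argMin (s : Set ℕ) (f : ℕ → ℝ) : Set ℕ := {a | a ∈ s ∧ ∀ b ∈ s, f a ≤ f b}

/-- The optimal training set sizes: the minimizers over `n / 2 ≤ n₁ < n` of the variance of the
average test set error. -/
def optTrainingSizes {Ω : Type*} [MeasurableSpace Ω] (P : Measure Ω) {p : ℕ}
    (x : ℕ → Fin p → ℝ) (β : Fin p → ℝ) (ε : ℕ → Ω → ℝ) (n : ℕ) : Set ℕ :=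
  argMin {n₁ | (n : ℝ) / 2 ≤ n₁ ∧ n₁ < n} (randomCVVariance P x β ε n)

/-- The optimal numbers of folds: the minimizers, over the divisors `k ≥ 2` of `n`, of the
variance of the `k`-fold estimator. -/
def optFoldNumbers {Ω : Type*} [MeasurableSpace Ω] (P : Measure Ω) {p : ℕ}
    (x : ℕ → Fin p → ℝ) (β : Fin p → ℝ) (ε : ℕ → Ω → ℝ) (n : ℕ) : Set ℕ :=
  argMin {k | 2 ≤ k ∧ k ∣ n} (kFoldVariance P x β ε n)

/-- The assumption on the fixed design: the normalized moment matrices `n⁻¹ XᵀX` converge to a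
finite positive definite matrix `V⁻¹`, and the moment matrices `|S|⁻¹ X_Sᵀ X_S` of the training
sets (those that contain at least half of the sample) are bounded away from singularity. -/
structure RegularDesign {p : ℕ} (x : ℕ → Fin p → ℝ) (V : Matrix (Fin p) (Fin p) ℝ) : Prop where
  posDef : V.PosDef
  tendsto : Tendsto (fun n : ℕ => (n : ℝ)⁻¹ • ((design x n)ᵀ * design x n)) atTop (𝓝 V⁻¹)
  nonsingular : ∃ c : ℝ, 0 < c ∧ ∀ᶠ n : ℕ in atTop, ∀ S : Finset (Fin n), n ≤ 2 * S.card →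
    ∀ u : Fin p → ℝ, c * S.card * (u ⬝ᵥ u) ≤
      u ⬝ᵥ (((rowsOf (design x n) S)ᵀ * rowsOf (design x n) S) *ᵥ u)

end RegressionCV

end

/-! Given the split, `β` cancels from the prediction errors, so each estimator is a quadratic form
`eᵀ A e` in the errors. With `s = E ε²` and `κ = E ε⁴ - 3 s²` its variance is `κ ∑ Aᵢᵢ² + 2 s² ‖A‖²`
in the Frobenius norm (`variance_quadForm`). By the law of total variance
(`variance_prod_uniformOn`) the random split adds the variance of the conditional mean `s · tr A`.

Random cross validation. With a test set of size `n₂` and a training set of size `n₁`, the variance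
is `v / n₂` plus bounded corrections divided by `n₂²`, where `v = κ + 2 s² = Var(ε²) > 0`. The
leading term favours the largest test set, but one more test point gains only order `1 / n₂²`. The
corrections must therefore be known up to a small fraction of `v`. They are governed by `excess`,
`excessSq` and `excessDiag`. The last is negligible because the leverages tend to zero uniformly.
The first two are close to `θ p` and `θ² p` with `θ = n₂ / n₁`: from below by convexity, with no
error on average and for every `n₁ ≥ n / 2` (`excess_ge`, `excessSq_ge`); from above because the
moment matrix of a random subset is close to that of the sample (`expect_devNorm_sq_le`). The
remaining terms `4 s² p / (n₁ n₂)` and `2 s² p / n₁²` do not reverse the order (`leading_terms_lt`).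

`k`-fold cross validation. Let `Q` be the hat matrix, `B` its block diagonal part for the folding,
and `P = 1 - Q`. The held-out residuals solve `(1 - B) r = P e`, so the error matrix is `N = P (1 -
B)⁻² P`. For normal errors `κ = 0`, and it suffices that `‖N‖²` averaged over foldings exceeds its
leave-one-out value; the conditional mean is constant for leave-one-out. Linearizing at the
leave-one-out matrix `M` gives a gain of `2 ‖O‖²`, where `O` is the off-diagonal part of `B`
(`frobSq_foldErrorMatrix_ge`). The other terms carry a weight of operator norm of order `η`, the
largest leverage. One of them is linear in `O` and is controlled only on average: its mean and that
of `‖O‖²` both carry the probability that two indices share a fold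
(`frobSq_looErrorMatrix_lt_expect`). -/

noncomputable section

namespace RegressionCV

/-! ### Moments of quadratic forms in independent errors -/

section Moments

set_option linter.unusedSectionVars false

variable {Ω : Type*} [MeasurableSpace Ω] {P : Measure Ω} [IsProbabilityMeasure P] {ε : ℕ → Ω → ℝ}

lemma integrable_error_pow_four (hident : ∀ i, IdentDistrib (ε i) (ε 0) P P)
    (h4 : Integrable (fun ω => ε 0 ω ^ 4) P) (i : ℕ) : Integrable (fun ω => ε i ω ^ 4) P :=
  (((hident i).comp (u := fun y : ℝ => y ^ 4) (by fun_prop)).integrable_iff).2 h4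

lemma integrable_mul_four (hmeas : ∀ i, Measurable (ε i))
    (hident : ∀ i, IdentDistrib (ε i) (ε 0) P P)
    (h4 : Integrable (fun ω => ε 0 ω ^ 4) P) (i j k l : ℕ) :
    Integrable (fun ω => ε i ω * ε j ω * ε k ω * ε l ω) P := by
  have h := integrable_error_pow_four hident h4
  have hi := hmeas i
  have hj := hmeas j
  have hk := hmeas k
  have hl := hmeas l
  refine (((h i).add (h j)).add ((h k).add (h l))).mono' (by fun_prop) (Eventually.of_forall ?_)
  intro ω
  simp only [Pi.add_apply, Real.norm_eq_abs]
  generalize ε i ω = a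
  generalize ε j ω = b
  generalize ε k ω = c
  generalize ε l ω = d
  rw [abs_le]
  constructor <;>
  nlinarith [sq_nonneg (a * b - c * d), sq_nonneg (a * b + c * d), sq_nonneg (a ^ 2 - b ^ 2),
    sq_nonneg (c ^ 2 - d ^ 2), sq_nonneg (a ^ 2), sq_nonneg (b ^ 2), sq_nonneg (c ^ 2),
    sq_nonneg (d ^ 2)]

lemma integrable_mul_two (hmeas : ∀ i, Measurable (ε i))
    (hident : ∀ i, IdentDistrib (ε i) (ε 0) P P)
    (h4 : Integrable (fun ω => ε 0 ω ^ 4) P) (i j : ℕ) :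
    Integrable (fun ω => ε i ω * ε j ω) P := by
  have h := integrable_mul_four hmeas hident h4 i j i j
  have hi := hmeas i
  have hj := hmeas j
  refine (h.add (integrable_const (1 : ℝ))).mono' (by fun_prop) (Eventually.of_forall ?_)
  intro ω
  simp only [Pi.add_apply, Real.norm_eq_abs]
  rw [abs_le]
  constructor <;> nlinarith [sq_nonneg (ε i ω * ε j ω + 1), sq_nonneg (ε i ω * ε j ω - 1)]

lemma integral_mul_eq_zero_of_isolated (hmeas : ∀ i, Measurable (ε i)) (hindep : iIndepFun ε P)
    (hident : ∀ i, IdentDistrib (ε i) (ε 0) P P) (h0 : ∫ ω, ε 0 ω ∂P = 0)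
    {i j k l : ℕ} (hj : i ≠ j) (hk : i ≠ k) (hl : i ≠ l) :
    ∫ ω, ε i ω * (ε j ω * ε k ω * ε l ω) ∂P = 0 := by
  have hd : Disjoint ({i} : Finset ℕ) {j, k, l} := by simp [hj, hk, hl]
  have h := hindep.indepFun_finset _ _ hd hmeas
  have hφ : Measurable fun v : (({i} : Finset ℕ) → ℝ) => v ⟨i, by simp⟩ := measurable_pi_apply _
  have hψ : Measurable fun v : (({j, k, l} : Finset ℕ) → ℝ) =>
      v ⟨j, by simp⟩ * v ⟨k, by simp⟩ * v ⟨l, by simp⟩ :=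
    by fun_prop
  have h2 := h.comp hφ hψ
  have hmi := hmeas i
  have hmj := hmeas j
  have hmk := hmeas k
  have hml := hmeas l
  have h3 := h2.integral_mul_eq_mul_integral
    (by simp only [Function.comp_def]; fun_prop) (by simp only [Function.comp_def]; fun_prop)
  have h4 : ∫ ω, ε i ω ∂P = 0 := by rw [(hident i).integral_eq, h0]
  simpa [Function.comp_def, h4] using h3

lemma integral_sq_mul_sq (hindep : iIndepFun ε P) (hmeas : ∀ i, Measurable (ε i))
    (hident : ∀ i, IdentDistrib (ε i) (ε 0) P P) {i j : ℕ} (hij : i ≠ j) :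
    ∫ ω, ε i ω ^ 2 * ε j ω ^ 2 ∂P = (∫ ω, ε 0 ω ^ 2 ∂P) ^ 2 := by
  have h2 := (hindep.indepFun hij).comp (φ := fun y : ℝ => y ^ 2) (ψ := fun y : ℝ => y ^ 2)
    (by fun_prop) (by fun_prop)
  have hmi := hmeas i
  have hmj := hmeas j
  have h3 := h2.integral_mul_eq_mul_integral
    (by simp only [Function.comp_def]; fun_prop) (by simp only [Function.comp_def]; fun_prop)
  have h4 : ∀ i, ∫ ω, ε i ω ^ 2 ∂P = ∫ ω, ε 0 ω ^ 2 ∂P := fun i =>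
    ((hident i).comp (u := fun y : ℝ => y ^ 2) (by fun_prop)).integral_eq
  simp only [Function.comp_def, Pi.mul_apply, h4] at h3
  rw [h3, sq]

lemma integral_mul_two (hmeas : ∀ i, Measurable (ε i)) (hindep : iIndepFun ε P)
    (hident : ∀ i, IdentDistrib (ε i) (ε 0) P P) (h0 : ∫ ω, ε 0 ω ∂P = 0) (i j : ℕ) :
    ∫ ω, ε i ω * ε j ω ∂P = if i = j then ∫ ω, ε 0 ω ^ 2 ∂P else 0 := by
  split_ifs with h
  · subst h
    have := ((hident i).comp (u := fun y : ℝ => y ^ 2) (by fun_prop)).integral_eq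
    simpa [Function.comp_def, sq] using this
  · rw [(hindep.indepFun h).integral_fun_mul_eq_mul_integral (by have := hmeas i; fun_prop)
      (by have := hmeas j; fun_prop), (hident i).integral_eq, h0, zero_mul]

/-- The mixed fourth moments of independent, identically distributed centered variables. -/
lemma integral_mul_four (hmeas : ∀ i, Measurable (ε i)) (hindep : iIndepFun ε P)
    (hident : ∀ i, IdentDistrib (ε i) (ε 0) P P) (h0 : ∫ ω, ε 0 ω ∂P = 0) (i j k l : ℕ) :
    ∫ ω, ε i ω * ε j ω * ε k ω * ε l ω ∂P =
      ((∫ ω, ε 0 ω ^ 4 ∂P) - 3 * (∫ ω, ε 0 ω ^ 2 ∂P) ^ 2) *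
        ((if i = j then 1 else 0) * (if i = k then 1 else 0) * (if i = l then 1 else 0)) +
      (∫ ω, ε 0 ω ^ 2 ∂P) ^ 2 *
        ((if i = j then 1 else 0) * (if k = l then 1 else 0) +
          (if i = k then 1 else 0) * (if j = l then 1 else 0) +
          (if i = l then 1 else 0) * (if j = k then 1 else 0)) := by
  -- An index that differs from the three others makes the moment vanish, so only the pattern with
  -- all indices equal and the three pairings survive.
  have iso := fun {a b c d : ℕ} => integral_mul_eq_zero_of_isolated (i := a) (j := b) (k := c)
    (l := d) hmeas hindep hident h0
  have prs := fun {a b : ℕ} => integral_sq_mul_sq (i := a) (j := b) hindep hmeas hident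
  have m4 : ∀ i, ∫ ω, ε i ω ^ 4 ∂P = ∫ ω, ε 0 ω ^ 4 ∂P := fun i =>
    ((hident i).comp (u := fun y : ℝ => y ^ 4) (by fun_prop)).integral_eq
  have key : ∀ {f g : Ω → ℝ} {z : ℝ}, (∀ ω, f ω = g ω) → ∫ ω, g ω ∂P = z → ∫ ω, f ω ∂P = z := by
    intro f g z hfg h
    rw [← h]
    exact integral_congr_ae (Eventually.of_forall hfg)
  by_cases hij : i = j
  · subst hij
    by_cases hik : i = k
    · subst hik
      by_cases hil : i = l
      · subst hil
        simp only [if_true]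
        refine (key (g := fun ω => ε i ω ^ 4) (fun ω => by ring) (m4 i)).trans (by ring)
      · simp only [hil, if_true, if_false]
        refine (key (fun ω => ?_) (iso (Ne.symm hil) (Ne.symm hil) (Ne.symm hil))).trans (by ring)
        ring
    · by_cases hkl : k = l
      · subst hkl
        simp only [hik, if_true, if_false]
        refine (key (fun ω => ?_) (prs hik)).trans (by ring)
        ring
      · simp only [hik, hkl, if_true, if_false]
        refine (key (fun ω => ?_) (iso (Ne.symm hik) (Ne.symm hik) hkl)).trans (by ring)
        ring
  · by_cases hik : i = k
    · subst hik
      by_cases hjl : j = l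
      · subst hjl
        simp only [hij, if_true, if_false]
        refine (key (fun ω => ?_) (prs hij)).trans (by ring)
        ring
      · simp only [hij, hjl, Ne.symm hij, if_true, if_false]
        refine (key (fun ω => ?_) (iso (Ne.symm hij) (Ne.symm hij) hjl)).trans (by ring)
        ring
    · by_cases hil : i = l
      · subst hil
        by_cases hjk : j = k
        · subst hjk
          simp only [hij, if_true, if_false]
          refine (key (fun ω => ?_) (prs hij)).trans (by ring)
          ring
        · simp only [hij, hik, hjk, if_true, if_false]
          refine (key (fun ω => ?_) (iso (Ne.symm hij) hjk (Ne.symm hij))).trans (by ring)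
          ring
      · simp only [hij, hik, hil, if_false]
        refine (key (fun ω => ?_) (iso hij hik hil)).trans (by ring)
        ring

/-- The quadratic form `eᵀ M e` in the first `n` errors. -/
def quadForm {n : ℕ} (M : Matrix (Fin n) (Fin n) ℝ) (e : ℕ → ℝ) : ℝ :=
  ∑ i, ∑ j, M i j * (e i * e j)

lemma integral_quadForm (hmeas : ∀ i, Measurable (ε i)) (hindep : iIndepFun ε P)
    (hident : ∀ i, IdentDistrib (ε i) (ε 0) P P) (h0 : ∫ ω, ε 0 ω ∂P = 0)
    (h4 : Integrable (fun ω => ε 0 ω ^ 4) P) {n : ℕ} (M : Matrix (Fin n) (Fin n) ℝ) :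
    ∫ ω, quadForm M (fun i => ε i ω) ∂P = (∫ ω, ε 0 ω ^ 2 ∂P) * M.trace := by
  have hI := integrable_mul_two hmeas hident h4
  simp only [quadForm]
  have hJ : ∀ i : Fin n, Integrable (fun ω => ∑ j : Fin n, M i j * (ε i ω * ε j ω)) P :=
    fun i => integrable_finsetSum _ fun j _ => (hI i j).const_mul _
  rw [integral_finsetSum _ fun i _ => hJ i]
  have : ∀ i : Fin n, ∫ ω, ∑ j, M i j * (ε i ω * ε j ω) ∂P = M i i * ∫ ω, ε 0 ω ^ 2 ∂P := by
    intro i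
    have hK : ∀ j : Fin n, Integrable (fun ω => M i j * (ε i ω * ε j ω)) P :=
      fun j => (hI i j).const_mul _
    rw [integral_finsetSum _ fun j _ => hK j]
    simp only [integral_const_mul, integral_mul_two hmeas hindep hident h0, Fin.val_inj]
    simp
  simp only [this, Matrix.trace, Matrix.diag, Finset.mul_sum]
  exact Finset.sum_congr rfl fun i _ => mul_comm _ _

lemma quadForm_sq {n : ℕ} (M : Matrix (Fin n) (Fin n) ℝ) (e : ℕ → ℝ) :
    quadForm M e ^ 2 =
      ∑ i, ∑ j, ∑ k, ∑ l, M i j * M k l * (e i * e j * e k * e l) := by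
  simp only [quadForm, sq, Finset.sum_mul, Finset.mul_sum]
  refine Finset.sum_congr rfl fun i _ => Finset.sum_congr rfl fun j _ =>
    Finset.sum_congr rfl fun k _ => Finset.sum_congr rfl fun l _ => by ring

lemma memLp_quadForm (hmeas : ∀ i, Measurable (ε i))
    (hident : ∀ i, IdentDistrib (ε i) (ε 0) P P)
    (h4 : Integrable (fun ω => ε 0 ω ^ 4) P) {n : ℕ} (M : Matrix (Fin n) (Fin n) ℝ) :
    MemLp (fun ω => quadForm M (fun i => ε i ω)) 2 P := by
  have hI := integrable_mul_four hmeas hident h4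
  rw [memLp_two_iff_integrable_sq]
  · simp only [quadForm_sq]
    exact integrable_finsetSum _ fun i _ => integrable_finsetSum _ fun j _ =>
      integrable_finsetSum _ fun k _ => integrable_finsetSum _ fun l _ => (hI i j k l).const_mul _
  · unfold quadForm
    have : Measurable fun ω => ∑ i : Fin n, ∑ j : Fin n, M i j * (ε i ω * ε j ω) :=
      Finset.measurable_sum _ fun i _ => Finset.measurable_sum _ fun j _ =>
        ((hmeas i).mul (hmeas j)).const_mul _
    exact this.aestronglyMeasurable

lemma integral_quadForm_sq (hmeas : ∀ i, Measurable (ε i)) (hindep : iIndepFun ε P)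
    (hident : ∀ i, IdentDistrib (ε i) (ε 0) P P) (h0 : ∫ ω, ε 0 ω ∂P = 0)
    (h4 : Integrable (fun ω => ε 0 ω ^ 4) P) {n : ℕ} (M : Matrix (Fin n) (Fin n) ℝ)
    (hM : M.IsSymm) :
    ∫ ω, quadForm M (fun i => ε i ω) ^ 2 ∂P =
      ((∫ ω, ε 0 ω ^ 4 ∂P) - 3 * (∫ ω, ε 0 ω ^ 2 ∂P) ^ 2) * ∑ i, M i i ^ 2 +
        (∫ ω, ε 0 ω ^ 2 ∂P) ^ 2 * (M.trace ^ 2 + 2 * ∑ i, ∑ j, M i j ^ 2) := by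
  have hI := integrable_mul_four hmeas hident h4
  simp only [quadForm_sq]
  have e1 : ∀ i j k : Fin n, Integrable (fun ω => ∑ l : Fin n,
      M i j * M k l * (ε i ω * ε j ω * ε k ω * ε l ω)) P := fun i j k =>
    integrable_finsetSum _ fun l _ => (hI i j k l).const_mul _
  have e2 : ∀ i j : Fin n, Integrable (fun ω => ∑ k : Fin n, ∑ l : Fin n,
      M i j * M k l * (ε i ω * ε j ω * ε k ω * ε l ω)) P := fun i j =>
    integrable_finsetSum _ fun k _ => e1 i j k
  have e0 : ∀ i j k : Fin n, ∫ ω, ∑ l : Fin n,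
      M i j * M k l * (ε i ω * ε j ω * ε k ω * ε l ω) ∂P =
      ∑ l : Fin n, ∫ ω, M i j * M k l * (ε i ω * ε j ω * ε k ω * ε l ω) ∂P := fun i j k =>
    integral_finsetSum _ fun l _ => (hI i j k l).const_mul _
  rw [integral_finsetSum _ fun i _ => integrable_finsetSum _ fun j _ => e2 i j]
  simp only [integral_finsetSum _ fun j _ => e2 _ j, integral_finsetSum _ fun k _ => e1 _ _ k,
    e0, integral_const_mul,
    integral_mul_four hmeas hindep hident h0, Fin.val_inj]
  generalize (∫ ω, ε 0 ω ^ 4 ∂P) - 3 * (∫ ω, ε 0 ω ^ 2 ∂P) ^ 2 = κ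
  generalize (∫ ω, ε 0 ω ^ 2 ∂P) ^ 2 = s
  -- The Kronecker factors are nested so that the innermost summation index is tested first; each
  -- sum then collapses.
  have split : ∀ i j k l : Fin n, M i j * M k l *
      (κ * ((if i = j then 1 else 0) * (if i = k then 1 else 0) * (if i = l then 1 else 0)) +
      s * ((if i = j then 1 else 0) * (if k = l then 1 else 0) +
          (if i = k then 1 else 0) * (if j = l then 1 else 0) +
          (if i = l then 1 else 0) * (if j = k then 1 else 0))) =
      (if i = l then (if i = k then (if i = j then κ * (M i j * M k l) else 0) else 0) else 0) +
      ((if k = l then (if i = j then s * (M i j * M k l) else 0) else 0) +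
       (if j = l then (if i = k then s * (M i j * M k l) else 0) else 0) +
       (if i = l then (if j = k then s * (M i j * M k l) else 0) else 0)) := by
    intro i j k l
    split_ifs <;> ring
  simp only [split, Finset.sum_add_distrib, Finset.sum_ite_eq, Finset.mem_univ, if_true]
  have s2 : ∑ i, ∑ j, ∑ k, (if i = j then s * (M i j * M k k) else 0) = s * M.trace ^ 2 := by
    rw [sq, Matrix.trace, Finset.sum_mul_sum, Finset.mul_sum]
    refine Finset.sum_congr rfl fun i _ => ?_
    rw [Finset.sum_comm, Finset.mul_sum]
    refine Finset.sum_congr rfl fun k _ => ?_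
    simp
  simp only [s2, hM.apply _ _, mul_add, two_mul, ← sq, Finset.mul_sum]
  simp only [Finset.sum_add_distrib]
  ring

/-- The variance of a quadratic form in independent, identically distributed centered errors. -/
lemma variance_quadForm (hmeas : ∀ i, Measurable (ε i)) (hindep : iIndepFun ε P)
    (hident : ∀ i, IdentDistrib (ε i) (ε 0) P P) (h0 : ∫ ω, ε 0 ω ∂P = 0)
    (h4 : Integrable (fun ω => ε 0 ω ^ 4) P) {n : ℕ} (M : Matrix (Fin n) (Fin n) ℝ)
    (hM : M.IsSymm) :
    variance (fun ω => quadForm M (fun i => ε i ω)) P =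
      ((∫ ω, ε 0 ω ^ 4 ∂P) - 3 * (∫ ω, ε 0 ω ^ 2 ∂P) ^ 2) * ∑ i, M i i ^ 2 +
        2 * (∫ ω, ε 0 ω ^ 2 ∂P) ^ 2 * ∑ i, ∑ j, M i j ^ 2 := by
  rw [variance_eq_sub (memLp_quadForm hmeas hident h4 M)]
  simp only [Pi.pow_apply]
  rw [integral_quadForm_sq hmeas hindep hident h0 h4 M hM,
    integral_quadForm hmeas hindep hident h0 h4 M]
  ring

end Moments

/-! ### Total variance over a uniformly distributed split -/

lemma integral_uniformOn {Θ : Type*} [Finite Θ] [MeasurableSpace Θ] [MeasurableSingletonClass Θ]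
    (F : Finset Θ) (φ : Θ → ℝ) : ∫ s, φ s ∂uniformOn (F : Set Θ) = F.expect φ := by
  classical
  have := Fintype.ofFinite Θ
  have hr : ∀ s, (uniformOn (F : Set Θ)).real {s} = if s ∈ F then (F.card : ℝ)⁻¹ else 0 := by
    intro s
    have := uniformOn_apply_finset (s := F) (t := {s})
    rw [Finset.coe_singleton] at this
    rw [measureReal_def, this]
    split_ifs with h
    · rw [Finset.inter_singleton_of_mem h]
      simp
    · rw [Finset.inter_singleton_of_notMem h]
      simp
  rw [integral_fintype (Integrable.of_finite), Finset.expect_eq_sum_div_card]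
  simp only [hr, smul_eq_mul, ite_mul, zero_mul, Finset.sum_ite_mem, Finset.univ_inter]
  rw [← Finset.mul_sum, div_eq_inv_mul]

/-- Law of total variance for a parameter that is uniformly distributed on a finite set and
independent of the remaining randomness. -/
lemma variance_prod_uniformOn {Ω : Type*} [MeasurableSpace Ω] {P : Measure Ω}
    [IsProbabilityMeasure P] {Θ : Type*} [Finite Θ] [MeasurableSpace Θ]
    [MeasurableSingletonClass Θ] (F : Finset Θ) (hF : F.Nonempty) (f : Ω × Θ → ℝ)
    (hf : ∀ s ∈ F, MemLp (fun ω => f (ω, s)) 2 P)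
    (hm : ∀ s ∈ F, Measurable fun ω => f (ω, s)) :
    variance f (P.prod (uniformOn (F : Set Θ))) =
      F.expect (fun s => variance (fun ω => f (ω, s)) P) +
        (F.expect (fun s => (∫ ω, f (ω, s) ∂P) ^ 2) - (F.expect fun s => ∫ ω, f (ω, s) ∂P) ^ 2) := by
  classical
  have : IsProbabilityMeasure (uniformOn (F : Set Θ)) :=
    isProbabilityMeasure_uniformOn F.finite_toSet hF
  -- Measurability and square integrability are assumed only for sections over `F`. Extension by
  -- zero off `F` changes `f` on a null set only.
  set g : Ω × Θ → ℝ := fun q => if q.2 ∈ F then f q else 0 with hg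
  have hsupp : ∀ᵐ s ∂uniformOn (F : Set Θ), s ∈ F :=
    ae_cond_of_forall_mem F.finite_toSet.measurableSet fun s hs => hs
  have hfg : f =ᵐ[P.prod (uniformOn (F : Set Θ))] g := by
    have := Measure.quasiMeasurePreserving_snd (μ := P) (ν := uniformOn (F : Set Θ)) |>.ae hsupp
    filter_upwards [this] with q hq
    simp [hg, hq]
  have hgm : Measurable g := by
    refine measurable_from_prod_countable_left fun s => ?_
    by_cases hs : s ∈ F
    · simpa [hg, hs] using hm s hs
    · simp [hg, hs]
  have hgs : ∀ s, MemLp (fun ω => g (ω, s)) 2 P := by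
    intro s
    by_cases hs : s ∈ F
    · simpa [hg, hs] using hf s hs
    · simp [hg, hs]
  have hg2 : Integrable (fun q => g q ^ 2) (P.prod (uniformOn (F : Set Θ))) := by
    rw [integrable_prod_iff' (hgm.pow_const 2).aestronglyMeasurable]
    exact ⟨Eventually.of_forall fun s => (hgs s).integrable_sq, Integrable.of_finite⟩
  have hgL : MemLp g 2 (P.prod (uniformOn (F : Set Θ))) :=
    (memLp_two_iff_integrable_sq hgm.aestronglyMeasurable).2 hg2
  rw [variance_congr hfg, variance_eq_sub hgL]
  simp only [Pi.pow_apply]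
  rw [integral_prod_symm _ hg2, integral_prod_symm _ (hgL.integrable (by norm_num)),
    integral_uniformOn, integral_uniformOn, ← add_sub_assoc, ← Finset.expect_add_distrib]
  congr 1
  · refine Finset.expect_congr rfl fun s hs => ?_
    rw [variance_eq_sub (hf s hs)]
    simp [hg, hs]
  · congr 1
    refine Finset.expect_congr rfl fun s hs => ?_
    simp [hg, hs]

/-! ### Second and fourth moments of the normal law -/

section Gaussian

lemma integral_sq_gaussianReal (v : ℝ≥0) : ∫ y, y ^ 2 ∂gaussianReal 0 v = v := by
  have h := variance_id_gaussianReal (μ := 0) (v := v)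
  rw [variance_eq_sub (memLp_id_gaussianReal 2)] at h
  simpa [integral_id_gaussianReal] using h

/-- The fourth moment is the fourth derivative at zero of the moment generating function `exp (v t²
/ 2)`. -/
lemma integral_pow_four_gaussianReal (v : ℝ≥0) :
    ∫ y, y ^ 4 ∂gaussianReal 0 v = 3 * (v : ℝ) ^ 2 := by
  have h0 : (0 : ℝ) ∈ interior (integrableExpSet id (gaussianReal 0 v)) := by
    simp [integrableExpSet_id_gaussianReal]
  have h := iteratedDeriv_mgf_zero h0 4
  simp only [mgf_id_gaussianReal] at h
  simp only [Pi.pow_apply, id_eq, zero_mul, zero_add] at h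
  rw [← h]
  set E : ℝ → ℝ := fun t => Real.exp (v * t ^ 2 / 2) with hE
  have hder : ∀ t, HasDerivAt E (v * t * E t) t := by
    intro t
    have h1 : HasDerivAt (fun t : ℝ => (v : ℝ) * t ^ 2 / 2) (v * t) t :=
      (((hasDerivAt_pow 2 t).const_mul (v : ℝ)).div_const 2).congr_deriv (by norm_num; ring)
    convert h1.exp using 1
    simp only [hE]
    ring
  have d1 : deriv E = fun t => v * t * E t := funext fun t => (hder t).deriv
  have d2 : deriv (fun t => v * t * E t) = fun t => (v + v ^ 2 * t ^ 2) * E t := by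
    funext t
    have := (((hasDerivAt_id t).const_mul (v : ℝ)).mul (hder t)).deriv
    simp only [id_eq, mul_one] at this
    refine Eq.trans (Eq.trans ?_ this) (by ring)
    rfl
  have d3 : deriv (fun t => ((v : ℝ) + v ^ 2 * t ^ 2) * E t) =
      fun t => (3 * v ^ 2 * t + v ^ 3 * t ^ 3) * E t := by
    funext t
    have := (((((hasDerivAt_id t).pow 2).const_mul ((v : ℝ) ^ 2)).const_add (v : ℝ)).mul
      (hder t)).deriv
    simp only [id_eq, mul_one] at this
    refine Eq.trans (Eq.trans ?_ this) (by simp; ring)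
    rfl
  have d4 : deriv (fun t => (3 * (v : ℝ) ^ 2 * t + v ^ 3 * t ^ 3) * E t) 0 = 3 * (v : ℝ) ^ 2 := by
    have := ((((hasDerivAt_id (0 : ℝ)).const_mul (3 * (v : ℝ) ^ 2)).add
      (((hasDerivAt_id (0 : ℝ)).pow 3).const_mul ((v : ℝ) ^ 3))).mul (hder 0)).deriv
    simp only [id_eq, mul_one] at this
    refine Eq.trans (Eq.trans ?_ this) (by simp [hE])
    rfl
  rw [iteratedDeriv_succ, iteratedDeriv_succ, iteratedDeriv_succ, iteratedDeriv_one, d1, d2, d3, d4]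

end Gaussian

/-! ### Exchangeability of random subsets and random foldings -/

section Symmetry

/-- A function of pairs that is invariant under all permutations takes one value on the diagonal
and one value off the diagonal. -/
lemma exists_diag_offDiag_of_perm_invariant {α : Type*} [DecidableEq α] (f : α → α → ℝ)
    (hf : ∀ (π : Equiv.Perm α) i l, f (π i) (π l) = f i l) :
    ∃ d c, ∀ i l, f i l = if i = l then d else c := by
  have hdiag : ∀ a b, f a a = f b b := fun a b => by
    simpa using (hf (Equiv.swap a b) a a).symm
  have hoff : ∀ i l a b, i ≠ l → a ≠ b → f i l = f a b := by
    intro i l a b hil hab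
    have hne : Equiv.swap i a l ≠ a := by
      intro h
      apply hil
      have := congrArg (Equiv.swap i a) h
      simpa using this.symm
    -- The first swap sends `i` to `a`; the second sends the image of `l` to `b` and fixes `a`.
    have h := hf (Equiv.swap (Equiv.swap i a l) b * Equiv.swap i a) i l
    simp only [Equiv.Perm.mul_apply, Equiv.swap_apply_left] at h
    rw [Equiv.swap_apply_of_ne_of_ne hne.symm hab] at h
    exact h.symm
  by_cases hα : ∃ i l : α, i ≠ l
  · obtain ⟨i, l, hil⟩ := hα
    refine ⟨f i i, f i l, fun a b => ?_⟩
    split_ifs with h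
    · subst h; exact hdiag _ _
    · exact hoff _ _ _ _ h hil
  · push Not at hα
    by_cases hn : Nonempty α
    · obtain ⟨i⟩ := hn
      refine ⟨f i i, 0, fun a b => ?_⟩
      rw [if_pos (hα a b), hα b a]
      exact hdiag _ _
    · exact ⟨0, 0, fun a => (hn ⟨a⟩).elim⟩

variable {n : ℕ}

/-- Exchangeability replaces counting: there is one diagonal and one off-diagonal value, and they
are determined by `∑ᵢ 1[i ∈ S] = n₁` and its square. -/
lemma expect_mem_mem (n₁ : ℕ) (hn : 2 ≤ n) (h1 : n₁ ≤ n) (i l : Fin n) :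
    (Finset.powersetCard n₁ (Finset.univ : Finset (Fin n))).expect
      (fun S => (if i ∈ S then (1 : ℝ) else 0) * (if l ∈ S then 1 else 0)) =
    if i = l then (n₁ : ℝ) / n else (n₁ : ℝ) * (n₁ - 1) / (n * (n - 1)) := by
  set F := Finset.powersetCard n₁ (Finset.univ : Finset (Fin n)) with hF
  have hFne : F.Nonempty := by
    rw [hF, Finset.powersetCard_nonempty]; simpa using h1
  set f : Fin n → Fin n → ℝ := fun i l =>
    F.expect (fun S => (if i ∈ S then (1 : ℝ) else 0) * (if l ∈ S then 1 else 0)) with hf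
  have hinv : ∀ (π : Equiv.Perm (Fin n)) i l, f (π i) (π l) = f i l := by
    intro π i l
    refine (Finset.expect_nbij' (fun S => S.map π.toEmbedding)
      (fun S => S.map π.symm.toEmbedding) ?_ ?_ ?_ ?_ ?_).symm
    · intro S hS; simpa [hF, Finset.mem_powersetCard] using hS
    · intro S hS; simpa [hF, Finset.mem_powersetCard] using hS
    · intro S _; ext; simp
    · intro S _; ext; simp
    · intro S _; simp
  obtain ⟨d, c, hdc⟩ := exists_diag_offDiag_of_perm_invariant f hinv
  have hn0 : (n : ℝ) ≠ 0 := by positivity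
  have hn1 : (n : ℝ) - 1 ≠ 0 := by
    have : (2 : ℝ) ≤ n := by exact_mod_cast hn
    linarith
  have hsum1 : ∑ i, f i i = n₁ := by
    simp only [hf]
    rw [← Finset.expect_sum_comm]
    refine (Finset.expect_congr rfl (g := fun _ => (n₁ : ℝ)) fun S hS => ?_).trans
      (Finset.expect_const hFne _)
    rw [hF, Finset.mem_powersetCard] at hS
    simp [hS.2]
  have hsum2 : ∑ i, ∑ l, f i l = (n₁ : ℝ) ^ 2 := by
    simp only [hf]
    simp only [← Finset.expect_sum_comm]
    refine (Finset.expect_congr rfl (g := fun _ => (n₁ : ℝ) ^ 2) fun S hS => ?_).trans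
      (Finset.expect_const hFne _)
    rw [hF, Finset.mem_powersetCard] at hS
    rw [← Finset.sum_mul_sum]
    simp [hS.2, sq]
  have hd : d = (n₁ : ℝ) / n := by
    simp only [hdc, if_true, Finset.sum_const, Finset.card_univ, Fintype.card_fin,
      nsmul_eq_mul] at hsum1
    field_simp
    linarith
  have hsplit : ∀ i : Fin n, ∑ l, f i l = d + (n - 1) * c := by
    intro i
    have : ∀ l, f i l = (if i = l then d - c else 0) + c := by
      intro l; rw [hdc]; split_ifs <;> ring
    simp only [this, Finset.sum_add_distrib, Finset.sum_ite_eq, Finset.mem_univ, if_true,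
      Finset.sum_const, Finset.card_univ, Fintype.card_fin, nsmul_eq_mul]
    ring
  have hc : c = (n₁ : ℝ) * (n₁ - 1) / (n * (n - 1)) := by
    simp only [hsplit, Finset.sum_const, Finset.card_univ, Fintype.card_fin,
      nsmul_eq_mul, hd] at hsum2
    field_simp at hsum2 ⊢
    linarith
  rw [← hd, ← hc]
  exact hdc i l

lemma expect_sum_mem {n₁ : ℕ} (hn : 2 ≤ n) (h1 : n₁ ≤ n) (w : Fin n → ℝ) :
    (Finset.powersetCard n₁ (Finset.univ : Finset (Fin n))).expect (fun S => ∑ i ∈ S, w i) =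
      (n₁ : ℝ) / n * ∑ i, w i := by
  have : (Finset.powersetCard n₁ (Finset.univ : Finset (Fin n))).expect (fun S => ∑ i ∈ S, w i) =
      (Finset.powersetCard n₁ (Finset.univ : Finset (Fin n))).expect (fun S =>
        ∑ i, w i * ((if i ∈ S then (1 : ℝ) else 0) * (if i ∈ S then 1 else 0))) :=
    Finset.expect_congr rfl fun S _ => by simp
  rw [this]
  simp only [Finset.expect_sum_comm, ← Finset.mul_expect, expect_mem_mem n₁ hn h1, if_true,
    Finset.mul_sum]
  exact Finset.sum_congr rfl fun i _ => mul_comm _ _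

/-- The variance of the sum over a random subset of a finite population. -/
lemma expect_sum_mem_sub_sq_le {n₁ : ℕ} (hn : 2 ≤ n) (h1 : n₁ ≤ n) (w : Fin n → ℝ) :
    (Finset.powersetCard n₁ (Finset.univ : Finset (Fin n))).expect
      (fun S => (∑ i ∈ S, w i - (n₁ : ℝ) / n * ∑ i, w i) ^ 2) ≤ (n₁ : ℝ) / n * ∑ i, w i ^ 2 := by
  have hFne : (Finset.powersetCard n₁ (Finset.univ : Finset (Fin n))).Nonempty := by
    rw [Finset.powersetCard_nonempty]; simpa using h1
  have hsq : (Finset.powersetCard n₁ (Finset.univ : Finset (Fin n))).expect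
      (fun S => (∑ i ∈ S, w i) ^ 2) =
      ∑ i, ∑ l, w i * w l *
        if i = l then (n₁ : ℝ) / n else (n₁ : ℝ) * (n₁ - 1) / (n * (n - 1)) := by
    have : ∀ S : Finset (Fin n), (∑ i ∈ S, w i) ^ 2 = ∑ i, ∑ l, w i * w l *
        ((if i ∈ S then (1 : ℝ) else 0) * (if l ∈ S then 1 else 0)) := by
      intro S
      have e : ∑ i ∈ S, w i = ∑ i, w i * (if i ∈ S then (1 : ℝ) else 0) := by simp
      rw [e, sq, Finset.sum_mul_sum]
      exact Finset.sum_congr rfl fun i _ => Finset.sum_congr rfl fun l _ => by ring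
    simp only [this, Finset.expect_sum_comm, ← Finset.mul_expect, expect_mem_mem n₁ hn h1]
  set q : ℝ := (n₁ : ℝ) * (n₁ - 1) / (n * (n - 1)) with hq
  set s : ℝ := (n₁ : ℝ) / n with hs
  have hsq2 : ∑ i, ∑ l, w i * w l * (if i = l then s else q) =
      (s - q) * ∑ i, w i ^ 2 + q * (∑ i, w i) ^ 2 := by
    have : ∀ i l : Fin n, w i * w l * (if i = l then s else q) =
        (if i = l then (s - q) * (w i * w l) else 0) + q * (w i * w l) := by
      intro i l; split_ifs <;> ring
    rw [sq (∑ i, w i), Finset.sum_mul_sum]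
    simp only [this, Finset.sum_add_distrib, Finset.sum_ite_eq, Finset.mem_univ, if_true, sq,
      Finset.mul_sum]
  have hexp : (Finset.powersetCard n₁ (Finset.univ : Finset (Fin n))).expect
      (fun S => (∑ i ∈ S, w i - s * ∑ i, w i) ^ 2) =
      (s - q) * ∑ i, w i ^ 2 + (q - s ^ 2) * (∑ i, w i) ^ 2 := by
    have : ∀ S : Finset (Fin n), (∑ i ∈ S, w i - s * ∑ i, w i) ^ 2 =
        (∑ i ∈ S, w i) ^ 2 - 2 * (s * ∑ i, w i) * (∑ i ∈ S, w i) + (s * ∑ i, w i) ^ 2 := by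
      intro S; ring
    simp only [this, Finset.expect_add_distrib, Finset.expect_sub_distrib, ← Finset.mul_expect,
      hsq, hsq2, expect_sum_mem hn h1, Finset.expect_const hFne]
    simp only [← hs]
    ring
  rw [hexp]
  have hn2 : (2 : ℝ) ≤ n := by exact_mod_cast hn
  have h1' : (n₁ : ℝ) ≤ n := by exact_mod_cast h1
  have hpos : (0 : ℝ) ≤ n₁ := by positivity
  have hq0 : 0 ≤ q := by
    -- For `n₁ = 0` the factor `n₁ - 1` is negative, but the product is zero.
    rcases Nat.eq_zero_or_pos n₁ with h | h
    · simp [hq, h]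
    · have : (1 : ℝ) ≤ n₁ := by exact_mod_cast h
      exact div_nonneg (mul_nonneg hpos (by linarith)) (by nlinarith)
  -- Inclusions of distinct indices are negatively correlated, so the term in `(∑ w)²` can be
  -- dropped.
  have hqs : q ≤ s ^ 2 := by
    rw [hq, hs, div_pow, div_le_div_iff₀ (by nlinarith) (by positivity)]
    nlinarith [mul_nonneg hpos (sub_nonneg.2 h1'), mul_nonneg (mul_nonneg hpos (sub_nonneg.2 h1'))
      (by linarith : (0 : ℝ) ≤ n)]
  have hw : 0 ≤ ∑ i, w i ^ 2 := Finset.sum_nonneg fun i _ => sq_nonneg _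
  nlinarith [mul_nonneg hq0 hw, mul_nonneg (sub_nonneg.2 hqs) (sq_nonneg (∑ i, w i))]

/-- The equal-size foldings as a finite set. -/
def foldingsFinset (n k : ℕ) : Finset (Fin n → Fin k) := (Set.toFinite (foldings n k)).toFinset

lemma coe_foldingsFinset (n k : ℕ) : (foldingsFinset n k : Set (Fin n → Fin k)) = foldings n k :=
  Set.Finite.coe_toFinset _

lemma mem_foldingsFinset {k : ℕ} {g : Fin n → Fin k} :
    g ∈ foldingsFinset n k ↔ ∀ j, (Finset.univ.filter fun i => g i = j).card = n / k := by
  simp [foldingsFinset, foldings]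

lemma foldingsFinset_nonempty {k : ℕ} (hk : k ∣ n) : (foldingsFinset n k).Nonempty := by
  obtain ⟨m, rfl⟩ := hk
  refine ⟨fun i => (finProdFinEquiv.symm i).1, mem_foldingsFinset.2 fun j => ?_⟩
  have hk : 0 < k := j.pos
  rw [Nat.mul_div_cancel_left _ hk]
  have : (Finset.univ.filter fun i : Fin (k * m) => (finProdFinEquiv.symm i).1 = j) =
      (Finset.univ : Finset (Fin m)).map
        ⟨fun a => finProdFinEquiv (j, a), fun a b h => by simpa using h⟩ := by
    ext i
    simp only [Finset.mem_filter, Finset.mem_univ, true_and, Finset.mem_map]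
    constructor
    · intro h
      exact ⟨(finProdFinEquiv.symm i).2, by rw [← h]; exact finProdFinEquiv.apply_symm_apply i⟩
    · rintro ⟨a, rfl⟩
      exact congrArg Prod.fst (finProdFinEquiv.symm_apply_apply (j, a))
  rw [this]
  simp

lemma sum_same_fold {k : ℕ} {g : Fin n → Fin k} (hg : g ∈ foldingsFinset n k) (i : Fin n) :
    ∑ l, (if g i = g l then (1 : ℝ) else 0) = (n / k : ℕ) := by
  rw [Finset.sum_boole]
  norm_cast
  rw [← mem_foldingsFinset.1 hg (g i)]
  congr 1
  ext l
  simp [eq_comm]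

/-- By exchangeability the row sum, which is the fold size `n / k` for every folding, determines the
off-diagonal value. -/
lemma expect_same_fold {k : ℕ} (hn : 2 ≤ n) (hk : k ∣ n) (i l : Fin n) :
    (foldingsFinset n k).expect (fun g => if g i = g l then (1 : ℝ) else 0) =
      if i = l then 1 else (((n / k : ℕ) : ℝ) - 1) / (n - 1) := by
  have hFne := foldingsFinset_nonempty hk
  set f : Fin n → Fin n → ℝ := fun i l =>
    (foldingsFinset n k).expect (fun g => if g i = g l then (1 : ℝ) else 0) with hf
  have hinv : ∀ (π : Equiv.Perm (Fin n)) i l, f (π i) (π l) = f i l := by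
    intro π i l
    have hmem : ∀ (π : Equiv.Perm (Fin n)) (g : Fin n → Fin k), g ∈ foldingsFinset n k →
        g ∘ π ∈ foldingsFinset n k := by
      intro π g hg
      rw [mem_foldingsFinset] at hg ⊢
      intro j
      rw [← hg j]
      refine Finset.card_bij' (fun i _ => π i) (fun i _ => π.symm i) ?_ ?_ ?_ ?_ <;> simp
    refine (Finset.expect_nbij' (fun g => g ∘ π) (fun g => g ∘ π.symm) ?_ ?_ ?_ ?_ ?_)
    · intro g hg; exact hmem π g hg
    · intro g hg; exact hmem π.symm g hg
    · intro g _; ext; simp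
    · intro g _; ext; simp
    · intro g _; simp
  obtain ⟨d, c, hdc⟩ := exists_diag_offDiag_of_perm_invariant f hinv
  have hn0 : (n : ℝ) ≠ 0 := by positivity
  have hn1 : (n : ℝ) - 1 ≠ 0 := by
    have : (2 : ℝ) ≤ n := by exact_mod_cast hn
    linarith
  have hd : d = 1 := by
    have := hdc i i
    simpa [hf, Finset.expect_const hFne] using this.symm
  have hsum : ∑ l, f i l = (n / k : ℕ) := by
    simp only [hf]
    rw [← Finset.expect_sum_comm]
    exact (Finset.expect_congr rfl fun g hg => sum_same_fold hg i).trans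
      (Finset.expect_const hFne _)
  have hsplit : ∑ l, f i l = d + (n - 1) * c := by
    have : ∀ l, f i l = (if i = l then d - c else 0) + c := by
      intro l; rw [hdc]; split_ifs <;> ring
    simp only [this, Finset.sum_add_distrib, Finset.sum_ite_eq, Finset.mem_univ, if_true,
      Finset.sum_const, Finset.card_univ, Fintype.card_fin, nsmul_eq_mul]
    ring
  have hc : c = (((n / k : ℕ) : ℝ) - 1) / (n - 1) := by
    rw [eq_div_iff hn1]
    linarith
  rw [← hc]
  rw [hd] at hdc
  exact hdc i l

end Symmetry

/-! ### Moment matrices and the kernel `X (X_Sᵀ X_S)⁻¹ Xᵀ` -/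

section Gram

variable {n p : ℕ} (X : Matrix (Fin n) (Fin p) ℝ) (S : Finset (Fin n))

/-- The moment matrix `X_Sᵀ X_S`. -/
def gram : Matrix (Fin p) (Fin p) ℝ := (rowsOf X S)ᵀ * rowsOf X S

lemma gram_apply (j k : Fin p) : gram X S j k = ∑ i ∈ S, X i j * X i k := by
  simp only [gram, rowsOf, Matrix.mul_apply, Matrix.transpose_apply, Matrix.submatrix_apply, id_eq]
  exact Finset.sum_coe_sort S (fun i => X i j * X i k)

lemma gram_isSymm : (gram X S).IsSymm := by
  rw [Matrix.IsSymm, gram, Matrix.transpose_mul, Matrix.transpose_transpose]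

lemma gram_compl : gram X Sᶜ = gram X Finset.univ - gram X S := by
  ext j k
  simp only [gram_apply, Matrix.sub_apply]
  rw [← Finset.sum_add_sum_compl S]
  ring

lemma gram_mulVec (u : Fin p → ℝ) : gram X S *ᵥ u = ∑ i ∈ S, (X i ⬝ᵥ u) • X i := by
  ext j
  simp only [Matrix.mulVec, dotProduct, gram_apply, Finset.sum_apply, Pi.smul_apply, smul_eq_mul,
    Finset.sum_mul]
  rw [Finset.sum_comm]
  exact Finset.sum_congr rfl fun i _ => Finset.sum_congr rfl fun k _ => by ring

lemma dotProduct_gram_mulVec (u : Fin p → ℝ) :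
    u ⬝ᵥ (gram X S *ᵥ u) = ∑ i ∈ S, (X i ⬝ᵥ u) ^ 2 := by
  rw [gram_mulVec, dotProduct_sum]
  exact Finset.sum_congr rfl fun i _ => by rw [dotProduct_smul, dotProduct_comm u, smul_eq_mul, sq]

variable {X S} {a : ℝ}

lemma isUnit_gram (ha : 0 < a) (hA : ∀ u, a * (u ⬝ᵥ u) ≤ u ⬝ᵥ (gram X S *ᵥ u)) :
    IsUnit (gram X S).det := by
  rw [isUnit_iff_ne_zero]
  intro h
  obtain ⟨v, hv, hv0⟩ := Matrix.exists_mulVec_eq_zero_iff.2 h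
  have := hA v
  rw [hv0, dotProduct_zero] at this
  have hpos : 0 < v ⬝ᵥ v := by
    have h0 : 0 ≤ v ⬝ᵥ v := Finset.sum_nonneg fun i _ => mul_self_nonneg _
    exact lt_of_le_of_ne h0 fun h => hv (dotProduct_self_eq_zero.1 h.symm)
  nlinarith

lemma gram_inv_isSymm : ((gram X S)⁻¹).IsSymm := by
  rw [Matrix.IsSymm, Matrix.transpose_nonsing_inv, (gram_isSymm X S).eq]

/-- With `w` the image of `u` under the inverse, expand `|u - a w|² ≥ 0` and use `a |w|² ≤ u ⬝ᵥ w`.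
-/
lemma gram_inv_le (ha : 0 < a) (hA : ∀ u, a * (u ⬝ᵥ u) ≤ u ⬝ᵥ (gram X S *ᵥ u)) (u : Fin p → ℝ) :
    u ⬝ᵥ ((gram X S)⁻¹ *ᵥ u) ≤ (u ⬝ᵥ u) / a := by
  set w := (gram X S)⁻¹ *ᵥ u with hw
  have h1 := hA w
  have hu : gram X S *ᵥ w = u := by
    rw [hw, Matrix.mulVec_mulVec, Matrix.mul_nonsing_inv _ (isUnit_gram ha hA), Matrix.one_mulVec]
  rw [hu] at h1
  have h2 : 0 ≤ (u - a • w) ⬝ᵥ (u - a • w) := Finset.sum_nonneg fun i _ => mul_self_nonneg _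
  simp only [sub_dotProduct, dotProduct_sub, smul_dotProduct, dotProduct_smul, smul_eq_mul,
    dotProduct_comm w u] at h1 h2
  rw [le_div_iff₀ ha]
  nlinarith

lemma gram_inv_nonneg (ha : 0 < a) (hA : ∀ u, a * (u ⬝ᵥ u) ≤ u ⬝ᵥ (gram X S *ᵥ u))
    (u : Fin p → ℝ) : 0 ≤ u ⬝ᵥ ((gram X S)⁻¹ *ᵥ u) := by
  set w := (gram X S)⁻¹ *ᵥ u with hw
  have h1 := hA w
  have hu : gram X S *ᵥ w = u := by
    rw [hw, Matrix.mulVec_mulVec, Matrix.mul_nonsing_inv _ (isUnit_gram ha hA), Matrix.one_mulVec]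
  rw [hu, dotProduct_comm w u] at h1
  exact le_trans (mul_nonneg ha.le (Finset.sum_nonneg fun i _ => mul_self_nonneg _)) h1

/-- Polarization: nonnegativity at the vectors `eⱼ ± eₖ` bounds an entry by the mean of two diagonal
entries. -/
lemma abs_gram_inv_apply_le (ha : 0 < a) (hA : ∀ u, a * (u ⬝ᵥ u) ≤ u ⬝ᵥ (gram X S *ᵥ u))
    (j k : Fin p) : |(gram X S)⁻¹ j k| ≤ 1 / a := by
  set W := (gram X S)⁻¹ with hW
  have hsymm : W k j = W j k := gram_inv_isSymm.apply j k
  have key : ∀ s : ℝ, (Pi.single j 1 + s • Pi.single k 1 : Fin p → ℝ) ⬝ᵥ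
      (W *ᵥ (Pi.single j 1 + s • Pi.single k 1)) = W j j + 2 * s * W j k + s ^ 2 * W k k := by
    intro s
    simp only [Matrix.mulVec_add, Matrix.mulVec_smul, add_dotProduct, dotProduct_add,
      smul_dotProduct, dotProduct_smul, smul_eq_mul, Matrix.mulVec_single_one,
      single_one_dotProduct, Matrix.col_apply, hsymm]
    ring
  have hdiag : ∀ j, W j j ≤ 1 / a := by
    intro j
    have := gram_inv_le ha hA (Pi.single j 1)
    simpa using this
  have h1 := gram_inv_nonneg ha hA (Pi.single j 1 + (1 : ℝ) • Pi.single k 1)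
  have h2 := gram_inv_nonneg ha hA (Pi.single j 1 + (-1 : ℝ) • Pi.single k 1)
  rw [key] at h1 h2
  have := hdiag j
  have := hdiag k
  rw [abs_le]
  constructor <;> linarith

variable (X S) in
/-- The matrix `X (X_Sᵀ X_S)⁻¹ Xᵀ`. -/
def kernel : Matrix (Fin n) (Fin n) ℝ := X * (gram X S)⁻¹ * Xᵀ

variable (X S) in
lemma kernel_apply (t i : Fin n) : kernel X S t i = X t ⬝ᵥ ((gram X S)⁻¹ *ᵥ X i) := by
  simp only [kernel, Matrix.mul_assoc]
  rw [Matrix.mul_apply]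
  rfl

variable (X S) in
lemma kernel_isSymm : (kernel X S).IsSymm := by
  rw [Matrix.IsSymm, kernel, Matrix.transpose_mul, Matrix.transpose_mul, Matrix.transpose_transpose,
    gram_inv_isSymm.eq, Matrix.mul_assoc]

/-- Summing `xᵢ xᵢᵀ` over `S` gives the moment matrix, which cancels the inverse inside `kernel X
S`. The case `R = S` makes the kernel positive semidefinite; the case of a different `R` links
training sets to the hat matrix. -/
lemma sum_kernel_mul_kernel_mem {R : Finset (Fin n)} (hS : IsUnit (gram X S).det) (t s : Fin n) :
    ∑ i ∈ S, kernel X R t i * kernel X S i s = kernel X R t s := by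
  simp only [kernel_apply X R]
  have h : gram X S *ᵥ ((gram X S)⁻¹ *ᵥ X s) = X s := by
    rw [Matrix.mulVec_mulVec, Matrix.mul_nonsing_inv _ hS, Matrix.one_mulVec]
  conv_rhs => rw [← h, gram_mulVec]
  rw [Matrix.mulVec_sum, dotProduct_sum]
  refine Finset.sum_congr rfl fun i _ => ?_
  rw [Matrix.mulVec_smul, dotProduct_smul, smul_eq_mul, kernel_apply, mul_comm]

variable (X S) in
lemma sum_dotProduct_mulVec (Y : Matrix (Fin p) (Fin p) ℝ) :
    ∑ t ∈ S, X t ⬝ᵥ (Y *ᵥ X t) = (Y * gram X S).trace := by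
  simp only [Matrix.trace, Matrix.diag, Matrix.mul_apply, gram_apply, dotProduct,
    Matrix.mulVec, Finset.mul_sum]
  rw [Finset.sum_comm]
  refine Eq.trans ?_ (Finset.sum_congr rfl fun j _ => Finset.sum_comm)
  refine Finset.sum_congr rfl fun j _ => Finset.sum_congr rfl fun i _ =>
    Finset.sum_congr rfl fun k _ => ?_
  ring

lemma sum_kernel_diag (hS : IsUnit (gram X S).det) : ∑ i ∈ S, kernel X S i i = p := by
  simp only [kernel_apply]
  rw [sum_dotProduct_mulVec, Matrix.nonsing_inv_mul _ hS, Matrix.trace_one, Fintype.card_fin]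

lemma kernel_diag_nonneg (hS : IsUnit (gram X S).det) (t : Fin n) : 0 ≤ kernel X S t t := by
  rw [← sum_kernel_mul_kernel_mem hS]
  exact Finset.sum_nonneg fun i _ => by
    rw [(kernel_isSymm X S).apply i t]; exact mul_self_nonneg _

lemma kernel_diag_eq_sum_sq (hS : IsUnit (gram X S).det) (t : Fin n) :
    kernel X S t t = ∑ i ∈ S, kernel X S t i ^ 2 := by
  rw [← sum_kernel_mul_kernel_mem hS]
  exact Finset.sum_congr rfl fun i _ => by rw [(kernel_isSymm X S).apply t i, sq]

/-- Cauchy–Schwarz for the factorization of the kernel through the training set. -/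
lemma kernel_sq_le (hS : IsUnit (gram X S).det) (t s : Fin n) :
    kernel X S t s ^ 2 ≤ kernel X S t t * kernel X S s s := by
  rw [← sum_kernel_mul_kernel_mem hS, kernel_diag_eq_sum_sq hS t, kernel_diag_eq_sum_sq hS s]
  refine (Finset.sum_mul_sq_le_sq_mul_sq S (fun i => kernel X S t i)
    (fun i => kernel X S i s)).trans (le_of_eq ?_)
  congr 1
  exact Finset.sum_congr rfl fun i _ => by rw [(kernel_isSymm X S).apply s i]

lemma kernel_diag_le (ha : 0 < a) (hA : ∀ u, a * (u ⬝ᵥ u) ≤ u ⬝ᵥ (gram X S *ᵥ u)) (t : Fin n) :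
    kernel X S t t ≤ (X t ⬝ᵥ X t) / a := by
  rw [kernel_apply]
  exact gram_inv_le ha hA _

end Gram

/-! ### Prediction errors as linear functions of the errors -/

section Residual

variable {n p : ℕ} {S : Finset (Fin n)}

lemma residual_eq {x : ℕ → Fin p → ℝ} (hS : IsUnit (gram (design x n) S).det) (β : Fin p → ℝ)
    (e : ℕ → ℝ) (t : Fin n) :
    design x n t ⬝ᵥ ols (design x n) (response x β n e) S - response x β n e t =
      ∑ i ∈ S, kernel (design x n) S t i * e i - e t := by
  have hy : (rowsOf (design x n) S)ᵀ *ᵥ (fun i : S => response x β n e i) =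
      gram (design x n) S *ᵥ β + ∑ i ∈ S, e i • design x n i := by
    ext j
    rw [gram_mulVec]
    simp only [Matrix.mulVec, dotProduct, Matrix.transpose_apply, rowsOf, Matrix.submatrix_apply,
      id_eq, Pi.add_apply, Finset.sum_apply, Pi.smul_apply, smul_eq_mul]
    rw [Finset.sum_coe_sort S (fun i => design x n i j * response x β n e i),
      ← Finset.sum_add_distrib]
    refine Finset.sum_congr rfl fun i _ => ?_
    simp only [response, design, Matrix.of_apply, dotProduct]
    ring
  have hols : ols (design x n) (response x β n e) S =
      β + ∑ i ∈ S, e i • ((gram (design x n) S)⁻¹ *ᵥ design x n i) := by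
    unfold ols
    rw [hy]
    change (gram (design x n) S)⁻¹ *ᵥ _ = _
    rw [Matrix.mulVec_add, Matrix.mulVec_mulVec, Matrix.nonsing_inv_mul _ hS, Matrix.one_mulVec,
      Matrix.mulVec_sum]
    congr 1
    exact Finset.sum_congr rfl fun i _ => by rw [Matrix.mulVec_smul]
  rw [hols, dotProduct_add, dotProduct_sum]
  simp only [dotProduct_smul, smul_eq_mul, ← kernel_apply]
  have : response x β n e t = design x n t ⬝ᵥ β + e t := rfl
  rw [this]
  have h2 : ∑ i ∈ S, e i * kernel (design x n) S t i = ∑ i ∈ S, kernel (design x n) S t i * e i :=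
    Finset.sum_congr rfl fun i _ => mul_comm _ _
  rw [h2]
  ring

end Residual

/-! ### The quadratic form of the test set error -/

section TestError

variable {n p : ℕ} (X : Matrix (Fin n) (Fin p) ℝ) (S : Finset (Fin n))

/-- The matrix that maps the errors to the negative prediction errors of the rule trained
on `S`. -/
def predMatrix : Matrix (Fin n) (Fin n) ℝ :=
  fun t i => (if t = i then 1 else 0) - if i ∈ S then kernel X S t i else 0

/-- The matrix of the quadratic form given by the total test set error. -/
def errorMatrix : Matrix (Fin n) (Fin n) ℝ :=
  fun i j => ∑ t ∈ Sᶜ, predMatrix X S t i * predMatrix X S t j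

/-- The excess of the expected total test set error. -/
def excess : ℝ := ∑ t ∈ Sᶜ, kernel X S t t

/-- The sum of the squared kernel values on the test set. -/
def excessSq : ℝ := ∑ t ∈ Sᶜ, ∑ s ∈ Sᶜ, kernel X S t s ^ 2

/-- The contribution of the training set to the squared diagonal of the error matrix. -/
def excessDiag : ℝ := ∑ i ∈ S, (∑ t ∈ Sᶜ, kernel X S t i ^ 2) ^ 2

lemma errorMatrix_isSymm : (errorMatrix X S).IsSymm := by
  ext i j
  simp only [Matrix.transpose_apply, errorMatrix]
  exact Finset.sum_congr rfl fun t _ => mul_comm _ _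

lemma testSetError_eq_quadForm {x : ℕ → Fin p → ℝ} {S : Finset (Fin n)}
    (hS : IsUnit (gram (design x n) S).det) (β : Fin p → ℝ) (e : ℕ → ℝ) :
    testSetError (design x n) (response x β n e) S =
      (1 / (Sᶜ.card : ℝ)) * quadForm (errorMatrix (design x n) S) e := by
  unfold testSetError
  congr 1
  simp only [residual_eq hS, quadForm, errorMatrix, Finset.sum_mul]
  have h : ∀ t : Fin n, (∑ i ∈ S, kernel (design x n) S t i * e i - e t) ^ 2 =
      ∑ i, ∑ j, predMatrix (design x n) S t i * predMatrix (design x n) S t j * (e i * e j) := by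
    intro t
    have : ∑ i ∈ S, kernel (design x n) S t i * e i - e t =
        -∑ i, predMatrix (design x n) S t i * e i := by
      simp [predMatrix, sub_mul, Finset.sum_sub_distrib]
    rw [this, neg_sq, sq, Finset.sum_mul_sum]
    exact Finset.sum_congr rfl fun i _ => Finset.sum_congr rfl fun j _ => by ring
  simp only [h]
  rw [Finset.sum_comm]
  exact Finset.sum_congr rfl fun i _ => Finset.sum_comm

variable {X S}

/-- On test rows the identity part and the kernel part have disjoint supports, so the cross terms
vanish; the kernel part reproduces itself. -/
lemma sum_predMatrix_mul (hS : IsUnit (gram X S).det) {t s : Fin n} (ht : t ∈ Sᶜ) (hs : s ∈ Sᶜ) :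
    ∑ i, predMatrix X S t i * predMatrix X S s i = (if t = s then 1 else 0) + kernel X S t s := by
  rw [Finset.mem_compl] at ht hs
  have h : ∀ i, predMatrix X S t i * predMatrix X S s i =
      (if t = i then (if s = i then 1 else 0) else 0) +
        if i ∈ S then kernel X S t i * kernel X S i s else 0 := by
    intro i
    have hti : i ∈ S → t ≠ i := fun h h' => ht (h' ▸ h)
    have hsi : i ∈ S → s ≠ i := fun h h' => hs (h' ▸ h)
    rw [(kernel_isSymm X S).apply s i]
    unfold predMatrix
    by_cases hi : i ∈ S
    · simp [hi, hti hi, hsi hi]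
    · simp only [hi, if_false, sub_zero, add_zero]
      split_ifs <;> simp
  simp only [h, Finset.sum_add_distrib, Finset.sum_ite_eq, Finset.mem_univ, if_true,
    Finset.sum_ite_mem, Finset.univ_inter, sum_kernel_mul_kernel_mem hS]
  congr 1
  simp [eq_comm]

lemma trace_errorMatrix (hS : IsUnit (gram X S).det) :
    (errorMatrix X S).trace = Sᶜ.card + excess X S := by
  simp only [Matrix.trace, Matrix.diag, errorMatrix]
  rw [Finset.sum_comm, excess, Finset.sum_congr rfl fun t ht => sum_predMatrix_mul hS ht ht]
  simp [Finset.sum_add_distrib]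

/-- With `R` the test rows of `predMatrix`, `RᵀR` and `RRᵀ` have the same Frobenius norm, and `RRᵀ`
is the identity plus the kernel on the test set. -/
lemma sum_sq_errorMatrix (hS : IsUnit (gram X S).det) :
    ∑ i, ∑ j, errorMatrix X S i j ^ 2 = Sᶜ.card + 2 * excess X S + excessSq X S := by
  have h1 : ∑ i, ∑ j, errorMatrix X S i j ^ 2 = ∑ t ∈ Sᶜ, ∑ s ∈ Sᶜ,
      (∑ i, predMatrix X S t i * predMatrix X S s i) ^ 2 := by
    simp only [errorMatrix, sq, Finset.sum_mul_sum]
    calc _ = ∑ i, ∑ t ∈ Sᶜ, ∑ j, ∑ s ∈ Sᶜ, predMatrix X S t i * predMatrix X S t j *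
          (predMatrix X S s i * predMatrix X S s j) :=
          Finset.sum_congr rfl fun i _ => Finset.sum_comm
      _ = ∑ t ∈ Sᶜ, ∑ i, ∑ j, ∑ s ∈ Sᶜ, predMatrix X S t i * predMatrix X S t j *
          (predMatrix X S s i * predMatrix X S s j) := Finset.sum_comm
      _ = ∑ t ∈ Sᶜ, ∑ i, ∑ s ∈ Sᶜ, ∑ j, predMatrix X S t i * predMatrix X S t j *
          (predMatrix X S s i * predMatrix X S s j) :=
          Finset.sum_congr rfl fun t _ => Finset.sum_congr rfl fun i _ => Finset.sum_comm
      _ = ∑ t ∈ Sᶜ, ∑ s ∈ Sᶜ, ∑ i, ∑ j, predMatrix X S t i * predMatrix X S t j *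
          (predMatrix X S s i * predMatrix X S s j) :=
          Finset.sum_congr rfl fun t _ => Finset.sum_comm
      _ = _ := Finset.sum_congr rfl fun t _ => Finset.sum_congr rfl fun s _ =>
          Finset.sum_congr rfl fun i _ => Finset.sum_congr rfl fun j _ => by ring
  rw [h1]
  have h2 : ∀ t ∈ Sᶜ, ∑ s ∈ Sᶜ, (∑ i, predMatrix X S t i * predMatrix X S s i) ^ 2 =
      1 + 2 * kernel X S t t + ∑ s ∈ Sᶜ, kernel X S t s ^ 2 := by
    intro t ht
    have : ∀ s ∈ Sᶜ, (∑ i, predMatrix X S t i * predMatrix X S s i) ^ 2 =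
        (if t = s then 1 + 2 * kernel X S t s else 0) + kernel X S t s ^ 2 := by
      intro s hs
      rw [sum_predMatrix_mul hS ht hs]
      split_ifs <;> ring
    rw [Finset.sum_congr rfl this, Finset.sum_add_distrib, Finset.sum_ite_eq, if_pos ht]
  rw [Finset.sum_congr rfl h2]
  simp only [Finset.sum_add_distrib, excess, excessSq, Finset.mul_sum]
  simp

lemma sum_sq_diag_errorMatrix :
    ∑ i, errorMatrix X S i i ^ 2 = Sᶜ.card + excessDiag X S := by
  rw [← Finset.sum_add_sum_compl S, add_comm]
  congr 1
  · have : ∀ i ∈ Sᶜ, errorMatrix X S i i ^ 2 = 1 := by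
      intro i hi
      have hi' := Finset.mem_compl.1 hi
      have : errorMatrix X S i i = 1 := by
        simp only [errorMatrix, predMatrix, if_neg hi', sub_zero]
        rw [Finset.sum_eq_single i]
        · simp
        · intro t _ ht; simp [ht]
        · intro h; exact absurd hi h
      rw [this, one_pow]
    rw [Finset.sum_congr rfl this]
    simp
  · refine Finset.sum_congr rfl fun i hi => ?_
    congr 1
    refine Finset.sum_congr rfl fun t ht => ?_
    have hti : t ≠ i := fun h => Finset.mem_compl.1 ht (h ▸ hi)
    simp only [predMatrix, if_neg hti, if_pos hi]
    ring

lemma excess_nonneg (hS : IsUnit (gram X S).det) : 0 ≤ excess X S :=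
  Finset.sum_nonneg fun t _ => kernel_diag_nonneg hS t

lemma excessDiag_nonneg : 0 ≤ excessDiag X S := Finset.sum_nonneg fun _ _ => sq_nonneg _

lemma sum_kernel_sq_train_test (hS : IsUnit (gram X S).det) :
    ∑ i ∈ S, ∑ t ∈ Sᶜ, kernel X S t i ^ 2 = excess X S := by
  rw [Finset.sum_comm]
  exact Finset.sum_congr rfl fun t _ => (kernel_diag_eq_sum_sq hS t).symm

/-- One factor of each square is at most `excess X S * b` by Cauchy–Schwarz, and the other factors
sum to the excess. The contribution is thus negligible when the leverages are small. -/
lemma excessDiag_le (hS : IsUnit (gram X S).det) {b : ℝ}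
    (hb : ∀ i, kernel X S i i ≤ b) : excessDiag X S ≤ excess X S * b * excess X S := by
  rw [excessDiag]
  calc ∑ i ∈ S, (∑ t ∈ Sᶜ, kernel X S t i ^ 2) ^ 2
      ≤ ∑ i ∈ S, (excess X S * b) * ∑ t ∈ Sᶜ, kernel X S t i ^ 2 := by
        refine Finset.sum_le_sum fun i _ => ?_
        rw [sq]
        refine mul_le_mul_of_nonneg_right ?_ (Finset.sum_nonneg fun _ _ => sq_nonneg _)
        rw [excess, Finset.sum_mul]
        exact Finset.sum_le_sum fun t _ => (kernel_sq_le hS t i).trans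
          (mul_le_mul_of_nonneg_left (hb i) (kernel_diag_nonneg hS t))
    _ = excess X S * b * excess X S := by
        rw [← Finset.mul_sum, sum_kernel_sq_train_test hS]

lemma excess_le {a : ℝ} (ha : 0 < a) (hA : ∀ u, a * (u ⬝ᵥ u) ≤ u ⬝ᵥ (gram X S *ᵥ u)) :
    excess X S ≤ (∑ i, X i ⬝ᵥ X i) / a := by
  have h0 : ∀ i, 0 ≤ X i ⬝ᵥ X i := fun i => Finset.sum_nonneg fun _ _ => mul_self_nonneg _
  rw [excess, Finset.sum_div]
  refine (Finset.sum_le_sum fun t _ => kernel_diag_le ha hA t).trans ?_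
  exact Finset.sum_le_sum_of_subset_of_nonneg (Finset.subset_univ _)
    fun i _ _ => div_nonneg (h0 i) ha.le

lemma excess_eq_sum_univ_sub (hS : IsUnit (gram X S).det) :
    excess X S = ∑ t, kernel X S t t - p := by
  rw [← sum_kernel_diag hS, ← Finset.sum_add_sum_compl S, excess]
  ring

/-- The convexity bound for the trace of the inverse moment matrix of the training set. -/
lemma excess_ge (hS : IsUnit (gram X S).det) (hU : IsUnit (gram X Finset.univ).det) (r : ℝ) :
    2 * r * p - r ^ 2 * ∑ i ∈ S, kernel X Finset.univ i i - p ≤ excess X S := by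
  -- A trace form of the tangent inequality `1 / y ≥ 2 r - r² y`: the squares sum to `excess + p`,
  -- the cross terms to `p`, both by the reproducing identity.
  have h : 0 ≤ ∑ i ∈ S, ∑ t, (kernel X S i t - r * kernel X Finset.univ t i) ^ 2 :=
    Finset.sum_nonneg fun _ _ => Finset.sum_nonneg fun _ _ => sq_nonneg _
  have e : ∀ i ∈ S, ∑ t, (kernel X S i t - r * kernel X Finset.univ t i) ^ 2 =
      ∑ t, kernel X S t i ^ 2 - 2 * r * kernel X S i i + r ^ 2 * kernel X Finset.univ i i := by
    intro i _
    rw [kernel_diag_eq_sum_sq hU i, ← sum_kernel_mul_kernel_mem hU i i, Finset.mul_sum,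
      Finset.mul_sum, ← Finset.sum_sub_distrib, ← Finset.sum_add_distrib]
    refine Finset.sum_congr rfl fun t _ => ?_
    rw [(kernel_isSymm X S).apply t i, (kernel_isSymm X Finset.univ).apply t i]
    ring
  rw [Finset.sum_congr rfl e, Finset.sum_add_distrib, Finset.sum_sub_distrib, ← Finset.mul_sum,
    ← Finset.mul_sum, sum_kernel_diag hS, Finset.sum_comm,
    Finset.sum_congr rfl fun t _ => (kernel_diag_eq_sum_sq hS t).symm] at h
  rw [excess_eq_sum_univ_sub hS]
  linarith

/-- The entrywise square of the kernel is positive semidefinite (a Schur product, shown by an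
explicit Gram representation). Testing it with the weight `-θ` on `S` and `1` off `S` gives the
bound. -/
lemma excessSq_ge (hS : IsUnit (gram X S).det) (θ : ℝ) :
    2 * θ * excess X S - θ ^ 2 * p ≤ excessSq X S := by
  set K := kernel X S with hK
  have hsym : ∀ i j, K i j = K j i := fun i j => (kernel_isSymm X S).apply j i
  have gen : ∀ ω : Fin n → ℝ, 0 ≤ ∑ t, ∑ s, ω t * ω s * K t s ^ 2 := by
    intro ω
    have : ∑ t, ∑ s, ω t * ω s * K t s ^ 2 =
        ∑ l ∈ S, ∑ m ∈ S, (∑ t, ω t * (K l t * K t m)) ^ 2 := by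
      have e : ∀ t s, ω t * ω s * K t s ^ 2 = ∑ l ∈ S, ∑ m ∈ S,
          (ω t * (K l t * K t m)) * (ω s * (K l s * K s m)) := by
        intro t s
        have h1 : K t s = ∑ l ∈ S, K l t * K l s := by
          rw [hK, ← sum_kernel_mul_kernel_mem hS t s]
          exact Finset.sum_congr rfl fun l _ => by rw [(kernel_isSymm X S).apply l t]
        rw [sq]
        nth_rewrite 1 [h1]
        rw [h1, Finset.sum_mul_sum, Finset.mul_sum]
        refine Finset.sum_congr rfl fun l _ => ?_
        rw [Finset.mul_sum]
        refine Finset.sum_congr rfl fun m _ => ?_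
        rw [hsym t m, hsym s m]
        ring
      simp only [e]
      simp only [sq, Finset.sum_mul_sum]
      calc _ = ∑ t, ∑ l ∈ S, ∑ s, ∑ m ∈ S,
          (ω t * (K l t * K t m)) * (ω s * (K l s * K s m)) :=
            Finset.sum_congr rfl fun t _ => Finset.sum_comm
        _ = ∑ l ∈ S, ∑ t, ∑ s, ∑ m ∈ S,
          (ω t * (K l t * K t m)) * (ω s * (K l s * K s m)) := Finset.sum_comm
        _ = ∑ l ∈ S, ∑ t, ∑ m ∈ S, ∑ s,
          (ω t * (K l t * K t m)) * (ω s * (K l s * K s m)) :=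
            Finset.sum_congr rfl fun l _ => Finset.sum_congr rfl fun t _ => Finset.sum_comm
        _ = _ := Finset.sum_congr rfl fun l _ => Finset.sum_comm
    rw [this]
    exact Finset.sum_nonneg fun _ _ => Finset.sum_nonneg fun _ _ => sq_nonneg _
  have h := gen fun t => if t ∈ S then -θ else 1
  have hin : ∀ t, ∑ s, (if t ∈ S then -θ else 1) * (if s ∈ S then -θ else 1) * K t s ^ 2 =
      (if t ∈ S then -θ else 1) * (-θ * K t t + ∑ s ∈ Sᶜ, K t s ^ 2) := by
    intro t
    have hd : K t t = ∑ i ∈ S, K t i ^ 2 := kernel_diag_eq_sum_sq hS t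
    rw [← Finset.sum_add_sum_compl S, mul_add, hd, Finset.mul_sum,
      Finset.mul_sum, Finset.mul_sum]
    congr 1
    · exact Finset.sum_congr rfl fun s hs => by rw [if_pos hs]; ring
    · exact Finset.sum_congr rfl fun s hs => by rw [if_neg (Finset.mem_compl.1 hs)]; ring
  simp only [hin] at h
  rw [← Finset.sum_add_sum_compl S] at h
  have a1 : ∑ t ∈ S, (if t ∈ S then -θ else 1) * (-θ * K t t + ∑ s ∈ Sᶜ, K t s ^ 2) =
      θ ^ 2 * p - θ * excess X S := by
    rw [← sum_kernel_diag hS, ← sum_kernel_sq_train_test hS, Finset.mul_sum, Finset.mul_sum,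
      ← Finset.sum_sub_distrib]
    refine Finset.sum_congr rfl fun t ht => ?_
    rw [if_pos ht]
    simp only [hsym t]
    ring
  have a2 : ∑ t ∈ Sᶜ, (if t ∈ S then -θ else 1) * (-θ * K t t + ∑ s ∈ Sᶜ, K t s ^ 2) =
      -θ * excess X S + excessSq X S := by
    rw [excess, excessSq, Finset.mul_sum, ← Finset.sum_add_distrib]
    refine Finset.sum_congr rfl fun t ht => ?_
    rw [if_neg (Finset.mem_compl.1 ht), one_mul]
  rw [a1, a2] at h
  linarith

end TestError

/-! ### Deviation of subsample moment matrices from the full sample -/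

section Deviation

variable {n p : ℕ} (X : Matrix (Fin n) (Fin p) ℝ) (S : Finset (Fin n))

/-- The difference between the normalized moment matrices of the training set and of the full
sample. -/
def devMatrix : Matrix (Fin p) (Fin p) ℝ :=
  (S.card : ℝ)⁻¹ • gram X S - (n : ℝ)⁻¹ • gram X Finset.univ

/-- The entrywise `ℓ¹` norm of the deviation matrix. -/
def devNorm : ℝ := ∑ j, ∑ k, |devMatrix X S j k|

lemma devNorm_nonneg : 0 ≤ devNorm X S :=
  Finset.sum_nonneg fun _ _ => Finset.sum_nonneg fun _ _ => abs_nonneg _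

lemma excess_eq_trace : excess X S = ((gram X S)⁻¹ * gram X Sᶜ).trace := by
  rw [← sum_dotProduct_mulVec, excess]
  exact Finset.sum_congr rfl fun t _ => kernel_apply X S t t

lemma excessSq_eq_trace :
    excessSq X S = ((gram X S)⁻¹ * gram X Sᶜ * ((gram X S)⁻¹ * gram X Sᶜ)).trace := by
  rw [← Matrix.mul_assoc, ← sum_dotProduct_mulVec, excessSq]
  refine Finset.sum_congr rfl fun t _ => ?_
  have h : ∀ s, kernel X S t s = X s ⬝ᵥ ((gram X S)⁻¹ *ᵥ X t) := fun s => by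
    rw [← (kernel_isSymm X S).apply t s, kernel_apply]
  simp only [h]
  rw [← dotProduct_gram_mulVec, ← Matrix.mulVec_mulVec, ← Matrix.mulVec_mulVec,
    Matrix.dotProduct_mulVec (X t), ← Matrix.mulVec_transpose, gram_inv_isSymm.eq]

variable {X S} {a C : ℝ}

/-- Since the moment matrix of the complement is the full one minus that of `S`, the matrix behind
both excess terms is a multiple of the identity up to the deviation. Its traces are then `θ p` and
`θ² p` up to errors in `devNorm`. -/
lemma inv_gram_mul_gram_compl (hS : IsUnit (gram X S).det) (hS0 : S.Nonempty) :
    (gram X S)⁻¹ * gram X Sᶜ =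
      ((n : ℝ) / S.card - 1) • (1 : Matrix (Fin p) (Fin p) ℝ) -
        (n : ℝ) • ((gram X S)⁻¹ * devMatrix X S) := by
  have hc : (S.card : ℝ) ≠ 0 := by exact_mod_cast (Finset.card_pos.2 hS0).ne'
  have hn : (n : ℝ) ≠ 0 := by
    have : 0 < n := (hS0.choose).pos
    positivity
  rw [gram_compl, devMatrix, Matrix.mul_sub, Matrix.mul_sub, Matrix.mul_smul, Matrix.mul_smul,
    Matrix.nonsing_inv_mul _ hS, smul_sub, smul_smul, smul_smul, mul_inv_cancel₀ hn, one_smul,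
    sub_smul, one_smul, div_eq_mul_inv]
  abel

lemma abs_trace_inv_gram_mul_le (ha : 0 < a)
    (hA : ∀ u, a * (u ⬝ᵥ u) ≤ u ⬝ᵥ (gram X S *ᵥ u)) (E : Matrix (Fin p) (Fin p) ℝ) :
    |((gram X S)⁻¹ * E).trace| ≤ 1 / a * ∑ j, ∑ k, |E j k| := by
  simp only [Matrix.trace, Matrix.diag, Matrix.mul_apply]
  refine (Finset.abs_sum_le_sum_abs _ _).trans ?_
  rw [Finset.sum_comm (f := fun j k => |E j k|), Finset.mul_sum]
  refine Finset.sum_le_sum fun j _ => (Finset.abs_sum_le_sum_abs _ _).trans ?_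
  rw [Finset.mul_sum]
  refine Finset.sum_le_sum fun k _ => ?_
  rw [abs_mul]
  exact mul_le_mul_of_nonneg_right (abs_gram_inv_apply_le ha hA _ _) (abs_nonneg _)

/-- The bound is entrywise, since the product of the inverse with `E` need not be symmetric. -/
lemma trace_sq_inv_gram_mul_le (ha : 0 < a)
    (hA : ∀ u, a * (u ⬝ᵥ u) ≤ u ⬝ᵥ (gram X S *ᵥ u)) (E : Matrix (Fin p) (Fin p) ℝ) :
    ((gram X S)⁻¹ * E * ((gram X S)⁻¹ * E)).trace ≤ (1 / a * ∑ j, ∑ k, |E j k|) ^ 2 := by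
  have hent : ∀ j k, |((gram X S)⁻¹ * E) j k| ≤ 1 / a * ∑ l, |E l k| := by
    intro j k
    rw [Matrix.mul_apply]
    refine (Finset.abs_sum_le_sum_abs _ _).trans ?_
    rw [Finset.mul_sum]
    refine Finset.sum_le_sum fun l _ => ?_
    rw [abs_mul]
    exact mul_le_mul_of_nonneg_right (abs_gram_inv_apply_le ha hA _ _) (abs_nonneg _)
  have hpos : ∀ k, 0 ≤ 1 / a * ∑ l, |E l k| := fun k =>
    mul_nonneg (by positivity) (Finset.sum_nonneg fun _ _ => abs_nonneg _)
  rw [Finset.sum_comm (f := fun j k => |E j k|), Finset.mul_sum, sq, Finset.sum_mul_sum]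
  simp only [Matrix.trace, Matrix.diag, Matrix.mul_apply (M := (gram X S)⁻¹ * E)]
  refine Finset.sum_le_sum fun j _ => Finset.sum_le_sum fun k _ => ?_
  refine (le_abs_self _).trans ?_
  rw [abs_mul, mul_comm]
  exact mul_le_mul (hent k j) (hent j k) (abs_nonneg _) (hpos j)

lemma abs_excess_sub_le (ha : 0 < a) (hA : ∀ u, a * (u ⬝ᵥ u) ≤ u ⬝ᵥ (gram X S *ᵥ u))
    (hS0 : S.Nonempty) (hC : (n : ℝ) / a ≤ C) :
    |excess X S - ((n : ℝ) / S.card - 1) * p| ≤ C * devNorm X S := by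
  have h := abs_trace_inv_gram_mul_le ha hA (devMatrix X S)
  rw [excess_eq_trace, inv_gram_mul_gram_compl (isUnit_gram ha hA) hS0, Matrix.trace_sub,
    Matrix.trace_smul, Matrix.trace_smul, Matrix.trace_one, Fintype.card_fin, smul_eq_mul,
    smul_eq_mul, sub_sub_cancel_left, abs_neg, abs_mul, abs_of_nonneg (Nat.cast_nonneg n)]
  calc (n : ℝ) * |((gram X S)⁻¹ * devMatrix X S).trace|
      ≤ n * (1 / a * devNorm X S) := mul_le_mul_of_nonneg_left h (Nat.cast_nonneg n)
    _ = n / a * devNorm X S := by ring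
    _ ≤ C * devNorm X S := mul_le_mul_of_nonneg_right hC (devNorm_nonneg X S)

lemma excessSq_le (ha : 0 < a) (hA : ∀ u, a * (u ⬝ᵥ u) ≤ u ⬝ᵥ (gram X S *ᵥ u))
    (hS0 : S.Nonempty) (hC : (n : ℝ) / a ≤ C) {θ : ℝ} (hθ : θ = (n : ℝ) / S.card - 1)
    (hθ0 : 0 ≤ θ) :
    excessSq X S ≤ θ ^ 2 * p + 2 * θ * (C * devNorm X S) + (C * devNorm X S) ^ 2 := by
  have h1 := abs_trace_inv_gram_mul_le ha hA (devMatrix X S)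
  have h2 := trace_sq_inv_gram_mul_le ha hA (devMatrix X S)
  rw [excessSq_eq_trace, inv_gram_mul_gram_compl (isUnit_gram ha hA) hS0, ← hθ]
  set Z := (gram X S)⁻¹ * devMatrix X S with hZ
  have e : (θ • (1 : Matrix (Fin p) (Fin p) ℝ) - (n : ℝ) • Z) * (θ • 1 - (n : ℝ) • Z) =
      θ ^ 2 • 1 - (2 * θ * n) • Z + ((n : ℝ) ^ 2) • (Z * Z) := by
    simp only [Matrix.mul_sub, Matrix.sub_mul, Matrix.smul_mul, Matrix.mul_smul, Matrix.one_mul,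
      Matrix.mul_one]
    module
  rw [e, Matrix.trace_add, Matrix.trace_sub, Matrix.trace_smul, Matrix.trace_smul,
    Matrix.trace_smul, Matrix.trace_one, Fintype.card_fin]
  simp only [smul_eq_mul]
  have hd : (n : ℝ) * (1 / a * devNorm X S) ≤ C * devNorm X S := by
    calc (n : ℝ) * (1 / a * devNorm X S) = n / a * devNorm X S := by ring
      _ ≤ C * devNorm X S := mul_le_mul_of_nonneg_right hC (devNorm_nonneg X S)
  have hd0 : 0 ≤ (n : ℝ) * (1 / a * devNorm X S) :=
    mul_nonneg (Nat.cast_nonneg n) (mul_nonneg (by positivity) (devNorm_nonneg X S))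
  have b1 : -(2 * θ * n * Z.trace) ≤ 2 * θ * (C * devNorm X S) := by
    have : -Z.trace ≤ 1 / a * devNorm X S := (neg_le_abs _).trans h1
    calc -(2 * θ * n * Z.trace) = 2 * θ * (n * -Z.trace) := by ring
      _ ≤ 2 * θ * (n * (1 / a * devNorm X S)) := by gcongr
      _ ≤ _ := by gcongr
  have b2 : (n : ℝ) ^ 2 * (Z * Z).trace ≤ (C * devNorm X S) ^ 2 := by
    calc (n : ℝ) ^ 2 * (Z * Z).trace ≤ (n : ℝ) ^ 2 * (1 / a * devNorm X S) ^ 2 := by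
          gcongr; exact h2
      _ = (n * (1 / a * devNorm X S)) ^ 2 := by ring
      _ ≤ _ := by gcongr
  linarith

lemma devMatrix_apply {n₁ : ℕ} (hc : S.card = n₁) (h0 : 0 < n₁) (j k : Fin p) :
    devMatrix X S j k = (n₁ : ℝ)⁻¹ *
      (∑ i ∈ S, X i j * X i k - (n₁ : ℝ) / n * ∑ i, X i j * X i k) := by
  have : (n₁ : ℝ) ≠ 0 := by positivity
  simp only [devMatrix, Matrix.sub_apply, Matrix.smul_apply, gram_apply, smul_eq_mul, hc]
  field_simp

variable (X) in
-- Each entry of the deviation is a centred sum over a random subset, so its second moment is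
-- controlled by sampling without replacement; the factor `p ^ 2` passes from the `ℓ¹` to the `ℓ²`
-- norm of the entries.
lemma expect_devNorm_sq_le {n₁ : ℕ} (hn : 2 ≤ n) (h1 : n₁ ≤ n) (h0 : 0 < n₁) :
    (Finset.powersetCard n₁ (Finset.univ : Finset (Fin n))).expect (fun S => devNorm X S ^ 2) ≤
      (p : ℝ) ^ 2 / (n * n₁) * ∑ i, (X i ⬝ᵥ X i) ^ 2 := by
  have hpt : ∀ S : Finset (Fin n),
      devNorm X S ^ 2 ≤ (p : ℝ) ^ 2 * ∑ j, ∑ k, devMatrix X S j k ^ 2 := by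
    intro S
    have h := sq_sum_le_card_mul_sum_sq (s := (Finset.univ : Finset (Fin p × Fin p)))
      (f := fun q => |devMatrix X S q.1 q.2|)
    simp only [Fintype.sum_prod_type, sq_abs, Finset.card_univ, Fintype.card_prod,
      Fintype.card_fin, Nat.cast_mul] at h
    rw [sq (p : ℝ)]
    exact h
  refine (Finset.expect_le_expect fun S _ => hpt S).trans ?_
  rw [← Finset.mul_expect, div_mul_eq_mul_div, mul_div_assoc]
  refine mul_le_mul_of_nonneg_left ?_ (by positivity)
  simp only [Finset.expect_sum_comm]
  have hn0 : (0 : ℝ) < n := by positivity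
  have hn1 : (0 : ℝ) < n₁ := by positivity
  have hjk : ∀ j k : Fin p, (Finset.powersetCard n₁ (Finset.univ : Finset (Fin n))).expect
      (fun S => devMatrix X S j k ^ 2) ≤ (∑ i, (X i j * X i k) ^ 2) / (n * n₁) := by
    intro j k
    have h := expect_sum_mem_sub_sq_le hn h1 (fun i => X i j * X i k)
    have e : (Finset.powersetCard n₁ (Finset.univ : Finset (Fin n))).expect
        (fun S => devMatrix X S j k ^ 2) = ((n₁ : ℝ)⁻¹) ^ 2 *
        (Finset.powersetCard n₁ (Finset.univ : Finset (Fin n))).expect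
        (fun S => (∑ i ∈ S, X i j * X i k - (n₁ : ℝ) / n * ∑ i, X i j * X i k) ^ 2) := by
      rw [Finset.mul_expect]
      refine Finset.expect_congr rfl fun S hS => ?_
      rw [devMatrix_apply (Finset.mem_powersetCard.1 hS).2 h0, mul_pow]
    rw [e]
    refine (mul_le_mul_of_nonneg_left h (by positivity)).trans (le_of_eq ?_)
    field_simp
  refine (Finset.sum_le_sum fun j _ => Finset.sum_le_sum fun k _ => hjk j k).trans (le_of_eq ?_)
  simp only [← Finset.sum_div]
  congr 1
  have : ∀ i, (X i ⬝ᵥ X i) ^ 2 = ∑ j, ∑ k, (X i j * X i k) ^ 2 := by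
    intro i
    rw [sq, dotProduct, Finset.sum_mul_sum]
    exact Finset.sum_congr rfl fun j _ => Finset.sum_congr rfl fun k _ => by ring
  simp only [this]
  rw [Finset.sum_comm (s := (Finset.univ : Finset (Fin n)))]
  exact Finset.sum_congr rfl fun j _ => Finset.sum_comm

end Deviation

/-! ### Growth of the covariates -/

section Asymptotics

variable {p : ℕ} {x : ℕ → Fin p → ℝ} {V : Matrix (Fin p) (Fin p) ℝ}

lemma tendsto_sum_dotProduct_div (hx : RegularDesign x V) :
    Tendsto (fun n : ℕ => (n : ℝ)⁻¹ * ∑ i ∈ Finset.range n, x i ⬝ᵥ x i) atTop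
      (𝓝 (V⁻¹).trace) := by
  have h := (continuous_id.matrix_trace.tendsto (V⁻¹)).comp hx.tendsto
  refine h.congr fun n => ?_
  simp only [Function.comp_apply, id_eq, Matrix.trace_smul, smul_eq_mul]
  congr 1
  simp only [Matrix.trace, Matrix.diag, Matrix.mul_apply, Matrix.transpose_apply, design,
    Matrix.of_apply]
  rw [Finset.sum_comm, ← Fin.sum_univ_eq_sum_range (fun i => x i ⬝ᵥ x i)]
  rfl

lemma exists_sum_dotProduct_le (hx : RegularDesign x V) :
    ∃ C : ℝ, 0 < C ∧ ∀ᶠ n : ℕ in atTop, ∑ i, design x n i ⬝ᵥ design x n i ≤ C * n := by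
  have h := tendsto_sum_dotProduct_div hx
  refine ⟨|(V⁻¹).trace| + 1, by positivity, ?_⟩
  filter_upwards [h.eventually_lt_const (u := |(V⁻¹).trace| + 1)
    (by linarith [le_abs_self (V⁻¹).trace]), eventually_gt_atTop 0] with n hn hn0
  have : (0 : ℝ) < n := by exact_mod_cast hn0
  rw [inv_mul_lt_iff₀ this] at hn
  have e : ∑ i, design x n i ⬝ᵥ design x n i = ∑ i ∈ Finset.range n, x i ⬝ᵥ x i :=
    Fin.sum_univ_eq_sum_range (fun i => x i ⬝ᵥ x i) n
  rw [e]
  linarith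

/-- The covariate vectors are negligible compared to the sample size, uniformly. -/
lemma eventually_dotProduct_le (hx : RegularDesign x V) {l : ℝ} (hl : 0 < l) :
    ∀ᶠ n : ℕ in atTop, ∀ i : Fin n, design x n i ⬝ᵥ design x n i ≤ l * n := by
  set s : ℕ → ℝ := fun n => ∑ i ∈ Finset.range n, x i ⬝ᵥ x i with hs
  have h : Tendsto (fun n : ℕ => (n : ℝ)⁻¹ * s n) atTop (𝓝 (V⁻¹).trace) :=
    tendsto_sum_dotProduct_div hx
  have h1 : Tendsto (fun n : ℕ => ((n + 1 : ℕ) : ℝ)⁻¹ * s (n + 1)) atTop (𝓝 (V⁻¹).trace) :=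
    h.comp (tendsto_add_atTop_nat 1)
  have h2 : Tendsto (fun n : ℕ => (n : ℝ) / ((n : ℝ) + 1)) atTop (𝓝 1) :=
    tendsto_natCast_div_add_atTop 1
  -- The averages of `|xᵢ|²` converge, so their increment, essentially `|xₙ|² / n`, tends to zero.
  have h3 : Tendsto (fun n : ℕ => ((n + 1 : ℕ) : ℝ)⁻¹ * s (n + 1) -
      (n : ℝ) / ((n : ℝ) + 1) * ((n : ℝ)⁻¹ * s n)) atTop (𝓝 0) := by
    have := h1.sub (h2.mul h)
    simpa using this
  have h4 : ∀ᶠ n : ℕ in atTop, x n ⬝ᵥ x n ≤ l * (n + 1) := by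
    filter_upwards [h3.eventually_lt_const hl, eventually_gt_atTop 0] with n hn hn0
    have hpos : (0 : ℝ) < n := by exact_mod_cast hn0
    have e : ((n + 1 : ℕ) : ℝ)⁻¹ * s (n + 1) - (n : ℝ) / ((n : ℝ) + 1) * ((n : ℝ)⁻¹ * s n) =
        (x n ⬝ᵥ x n) / (n + 1) := by
      have : s (n + 1) = s n + x n ⬝ᵥ x n := Finset.sum_range_succ _ _
      rw [this]
      push_cast
      field_simp
      ring
    rw [e, div_lt_iff₀ (by positivity)] at hn
    exact hn.le
  obtain ⟨N, hN⟩ := eventually_atTop.1 h4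
  -- The finitely many covariates before `N` are bounded by the fixed number `s N`.
  have h5 : ∀ᶠ n : ℕ in atTop, s N ≤ l * n :=
    (tendsto_natCast_atTop_atTop.const_mul_atTop hl).eventually_ge_atTop _
  filter_upwards [h5] with n hn i
  change x i ⬝ᵥ x i ≤ l * n
  have hnn : ∀ i, 0 ≤ x i ⬝ᵥ x i := fun i => Finset.sum_nonneg fun _ _ => mul_self_nonneg _
  by_cases hi : N ≤ (i : ℕ)
  · refine (hN i hi).trans (mul_le_mul_of_nonneg_left ?_ hl.le)
    exact_mod_cast i.2
  · refine le_trans ?_ hn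
    exact Finset.single_le_sum (f := fun i => x i ⬝ᵥ x i) (fun i _ => hnn i)
      (Finset.mem_range.2 (not_le.1 hi))

end Asymptotics

/-! ### Variance bounds for random cross validation -/

section RandomCV

variable {Ω : Type*} [MeasurableSpace Ω] {P : Measure Ω} [IsProbabilityMeasure P] {ε : ℕ → Ω → ℝ}
  {p n : ℕ} {x : ℕ → Fin p → ℝ} {c C l : ℝ}

lemma coe_powersetCard (n n₁ : ℕ) :
    ((Finset.powersetCard n₁ (Finset.univ : Finset (Fin n)) : Finset (Finset (Fin n))) :
      Set (Finset (Fin n))) = trainingSets n n₁ := by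
  ext S
  simp [trainingSets]

lemma measurable_quadForm (hmeas : ∀ i, Measurable (ε i)) (M : Matrix (Fin n) (Fin n) ℝ) :
    Measurable fun ω => quadForm M (fun i => ε i ω) :=
  Finset.measurable_sum _ fun i _ => Finset.measurable_sum _ fun j _ =>
    ((hmeas i).mul (hmeas j)).const_mul _

/-- The variance of the test set error decomposed into the contributions of the errors and of the
choice of the training set. -/
lemma randomCVVariance_eq (hmeas : ∀ i, Measurable (ε i)) (hindep : iIndepFun ε P)
    (hident : ∀ i, IdentDistrib (ε i) (ε 0) P P) (h0 : ∫ ω, ε 0 ω ∂P = 0)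
    (h4 : Integrable (fun ω => ε 0 ω ^ 4) P) (β : Fin p → ℝ) {n₁ n₂ : ℕ} (hn : n₁ + n₂ = n)
    (hS : ∀ S : Finset (Fin n), S.card = n₁ → IsUnit (gram (design x n) S).det) {κ s : ℝ}
    (hκ : κ = (∫ ω, ε 0 ω ^ 4 ∂P) - 3 * (∫ ω, ε 0 ω ^ 2 ∂P) ^ 2)
    (hs : s = ∫ ω, ε 0 ω ^ 2 ∂P) :
    randomCVVariance P x β ε n n₁ =
      (Finset.powersetCard n₁ (Finset.univ : Finset (Fin n))).expect (fun S =>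
        (1 / (n₂ : ℝ)) ^ 2 * (κ * (n₂ + excessDiag (design x n) S) + 2 * s ^ 2 *
          (n₂ + 2 * excess (design x n) S + excessSq (design x n) S))) +
      ((Finset.powersetCard n₁ (Finset.univ : Finset (Fin n))).expect (fun S =>
        (1 / (n₂ : ℝ) * (s * (n₂ + excess (design x n) S))) ^ 2) -
      ((Finset.powersetCard n₁ (Finset.univ : Finset (Fin n))).expect (fun S =>
        1 / (n₂ : ℝ) * (s * (n₂ + excess (design x n) S)))) ^ 2) := by
  have hne : (Finset.powersetCard n₁ (Finset.univ : Finset (Fin n))).Nonempty := by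
    rw [Finset.powersetCard_nonempty]; simp; omega
  have hcard : ∀ S ∈ Finset.powersetCard n₁ (Finset.univ : Finset (Fin n)),
      S.card = n₁ ∧ ((Sᶜ.card : ℕ) : ℝ) = n₂ := by
    intro S hS
    have h := (Finset.mem_powersetCard.1 hS).2
    refine ⟨h, ?_⟩
    rw [Finset.card_compl, h, Fintype.card_fin]
    congr 1
    omega
  have hform : ∀ S ∈ Finset.powersetCard n₁ (Finset.univ : Finset (Fin n)),
      (fun ω => testSetError (design x n) (response x β n fun i => ε i ω) S) =
      fun ω => 1 / (n₂ : ℝ) * quadForm (errorMatrix (design x n) S) (fun i => ε i ω) := by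
    intro S hSm
    funext ω
    rw [testSetError_eq_quadForm (hS S (hcard S hSm).1), (hcard S hSm).2]
  unfold randomCVVariance
  rw [← coe_powersetCard, variance_prod_uniformOn _ hne]
  · congr 1
    · refine Finset.expect_congr rfl fun S hSm => ?_
      have hu := hS S (hcard S hSm).1
      simp only [hform S hSm]
      rw [variance_const_mul, variance_quadForm hmeas hindep hident h0 h4 _ (errorMatrix_isSymm _ _),
        sum_sq_diag_errorMatrix, sum_sq_errorMatrix hu, (hcard S hSm).2, ← hκ, ← hs]
    · have hmean : ∀ S ∈ Finset.powersetCard n₁ (Finset.univ : Finset (Fin n)),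
          ∫ ω, testSetError (design x n) (response x β n fun i => ε i ω) S ∂P =
          1 / (n₂ : ℝ) * (s * (n₂ + excess (design x n) S)) := by
        intro S hSm
        have hu := hS S (hcard S hSm).1
        simp only [congrFun (hform S hSm)]
        rw [integral_const_mul, integral_quadForm hmeas hindep hident h0 h4, trace_errorMatrix hu,
          (hcard S hSm).2, ← hs]
      congr 1
      · exact Finset.expect_congr rfl fun S hSm => by rw [← hmean S hSm]
      · congr 1
        exact Finset.expect_congr rfl fun S hSm => by rw [← hmean S hSm]
  · intro S hSm
    simp only [hform S hSm]
    exact (memLp_quadForm hmeas hident h4 _).const_mul _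
  · intro S hSm
    simp only [hform S hSm]
    exact (measurable_quadForm hmeas _).const_mul _

/-- The mean square deviation is least about the mean, so any convenient centre `m` gives an upper
bound. -/
lemma sq_expect_le_expect_sq {α : Type*} (F : Finset α) (hF : F.Nonempty) (f : α → ℝ) (m : ℝ) :
    F.expect (fun s => f s ^ 2) - (F.expect f) ^ 2 ≤ F.expect (fun s => (f s - m) ^ 2) := by
  have h : F.expect (fun s => (f s - m) ^ 2) =
      F.expect (fun s => f s ^ 2) - 2 * m * F.expect f + m ^ 2 := by
    have : ∀ s, (f s - m) ^ 2 = f s ^ 2 - 2 * m * f s + m ^ 2 := fun s => by ring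
    simp only [this, Finset.expect_add_distrib, Finset.expect_sub_distrib, ← Finset.mul_expect,
      Finset.expect_const hF]
  rw [h]
  nlinarith [sq_nonneg (F.expect f - m)]

lemma expect_sq_sub_sq_nonneg {α : Type*} (F : Finset α) (hF : F.Nonempty) (f : α → ℝ) :
    0 ≤ F.expect (fun s => f s ^ 2) - (F.expect f) ^ 2 := by
  have h : F.expect (fun s => (f s - F.expect f) ^ 2) =
      F.expect (fun s => f s ^ 2) - (F.expect f) ^ 2 := by
    have : ∀ s, (f s - F.expect f) ^ 2 = f s ^ 2 - 2 * F.expect f * f s + F.expect f ^ 2 :=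
      fun s => by ring
    simp only [this, Finset.expect_add_distrib, Finset.expect_sub_distrib, ← Finset.mul_expect,
      Finset.expect_const hF]
    ring
  rw [← h]
  exact Finset.expect_nonneg fun s _ => sq_nonneg _

/-- Bounds on the design of the first `n` observations. -/
structure DesignBounds (x : ℕ → Fin p → ℝ) (n : ℕ) (c C l : ℝ) : Prop where
  two_le : 2 ≤ n
  c_pos : 0 < c
  C_nonneg : 0 ≤ C
  l_nonneg : 0 ≤ l
  gram_ge : ∀ S : Finset (Fin n), n ≤ 2 * S.card → ∀ u : Fin p → ℝ,
    c * S.card * (u ⬝ᵥ u) ≤ u ⬝ᵥ (gram (design x n) S *ᵥ u)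
  sum_le : ∑ i, design x n i ⬝ᵥ design x n i ≤ C * n
  row_le : ∀ i : Fin n, design x n i ⬝ᵥ design x n i ≤ l * n

lemma exists_designBounds {V : Matrix (Fin p) (Fin p) ℝ} (hx : RegularDesign x V) :
    ∃ c C : ℝ, 0 < c ∧ 0 < C ∧ ∀ l : ℝ, 0 < l → ∀ᶠ n : ℕ in atTop, DesignBounds x n c C l := by
  obtain ⟨c, hc, hreg⟩ := hx.nonsingular
  obtain ⟨C, hC, hsum⟩ := exists_sum_dotProduct_le hx
  refine ⟨c, C, hc, hC, fun l hl => ?_⟩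
  filter_upwards [hreg, hsum, eventually_dotProduct_le hx hl, eventually_ge_atTop 2]
    with n h1 h2 h3 h4
  exact ⟨h4, hc, hC.le, hl.le, h1, h2, h3⟩

namespace DesignBounds

variable {S : Finset (Fin n)}

lemma card_pos (h : DesignBounds x n c C l) (hS : n ≤ 2 * S.card) : (0 : ℝ) < c * S.card := by
  have := h.two_le
  have : 0 < S.card := by omega
  have hc := h.c_pos
  positivity

lemma isUnit (h : DesignBounds x n c C l) (hS : n ≤ 2 * S.card) :
    IsUnit (gram (design x n) S).det :=
  isUnit_gram (h.card_pos hS) (h.gram_ge S hS)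

lemma div_le (h : DesignBounds x n c C l) (hS : n ≤ 2 * S.card) :
    (n : ℝ) / (c * S.card) ≤ 2 / c := by
  have hc := h.c_pos
  have : (n : ℝ) ≤ 2 * S.card := by exact_mod_cast hS
  rw [div_le_div_iff₀ (h.card_pos hS) hc]
  nlinarith

lemma excess_le (h : DesignBounds x n c C l) (hS : n ≤ 2 * S.card) :
    excess (design x n) S ≤ 2 * C / c := by
  refine (RegressionCV.excess_le (h.card_pos hS) (h.gram_ge S hS)).trans ?_
  calc (∑ i, design x n i ⬝ᵥ design x n i) / (c * S.card) ≤ C * n / (c * S.card) :=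
        div_le_div_of_nonneg_right h.sum_le (h.card_pos hS).le
    _ = C * (n / (c * S.card)) := by ring
    _ ≤ C * (2 / c) := mul_le_mul_of_nonneg_left (h.div_le hS) h.C_nonneg
    _ = 2 * C / c := by ring

lemma kernel_le (h : DesignBounds x n c C l) (hS : n ≤ 2 * S.card) (i : Fin n) :
    kernel (design x n) S i i ≤ 2 * l / c := by
  refine (kernel_diag_le (h.card_pos hS) (h.gram_ge S hS) i).trans ?_
  calc (design x n i ⬝ᵥ design x n i) / (c * S.card) ≤ l * n / (c * S.card) :=
        div_le_div_of_nonneg_right (h.row_le i) (h.card_pos hS).le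
    _ = l * (n / (c * S.card)) := by ring
    _ ≤ l * (2 / c) := mul_le_mul_of_nonneg_left (h.div_le hS) h.l_nonneg
    _ = 2 * l / c := by ring

lemma excessDiag_le (h : DesignBounds x n c C l) (hS : n ≤ 2 * S.card) :
    excessDiag (design x n) S ≤ (2 * C / c) * (2 * l / c) * (2 * C / c) := by
  have h0 := excess_nonneg (h.isUnit hS)
  have h1 := h.excess_le hS
  have hc := h.c_pos
  have hC := h.C_nonneg
  have hl := h.l_nonneg
  refine (RegressionCV.excessDiag_le (h.isUnit hS) (h.kernel_le hS)).trans ?_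
  gcongr

end DesignBounds

/-- The average over `S` of the leverages in `S` is `n₁ p / n`, so the tangent bound `excess_ge` is
best at `r = n / n₁`. -/
lemma expect_excess_ge (h : DesignBounds x n c C l) {n₁ : ℕ} (h1 : n ≤ 2 * n₁) (h2 : n₁ ≤ n) :
    ((n : ℝ) / n₁ - 1) * p ≤ (Finset.powersetCard n₁ (Finset.univ : Finset (Fin n))).expect
      (fun S => excess (design x n) S) := by
  have hn := h.two_le
  have hne : (Finset.powersetCard n₁ (Finset.univ : Finset (Fin n))).Nonempty := by
    rw [Finset.powersetCard_nonempty]; simpa using h2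
  have hU : IsUnit (gram (design x n) Finset.univ).det := h.isUnit (by simp; omega)
  have hn0 : (n : ℝ) ≠ 0 := by positivity
  have hn1 : (n₁ : ℝ) ≠ 0 := by
    have : 0 < n₁ := by omega
    positivity
  set r : ℝ := n / n₁ with hr
  have hle := Finset.expect_le_expect (s := Finset.powersetCard n₁ (Finset.univ : Finset (Fin n)))
    (f := fun S => 2 * r * p - r ^ 2 * ∑ i ∈ S, kernel (design x n) Finset.univ i i - p)
    (g := fun S => excess (design x n) S) fun S hS => by
      have hc := (Finset.mem_powersetCard.1 hS).2
      exact excess_ge (h.isUnit (by omega)) hU r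
  refine le_trans (le_of_eq ?_) hle
  rw [Finset.expect_sub_distrib, Finset.expect_sub_distrib, Finset.expect_const hne,
    Finset.expect_const hne, ← Finset.mul_expect, expect_sum_mem hn h2, sum_kernel_diag hU, hr]
  field_simp
  ring

/-- This bound has to hold down to `n₂ = 1`. Only inequalities without sampling error enter: the
variance of the conditional mean is dropped and both excess terms are bounded by convexity. The
leverage term is the only loss. -/
lemma randomCVVariance_ge (hmeas : ∀ i, Measurable (ε i)) (hindep : iIndepFun ε P)
    (hident : ∀ i, IdentDistrib (ε i) (ε 0) P P) (h0 : ∫ ω, ε 0 ω ∂P = 0)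
    (h4 : Integrable (fun ω => ε 0 ω ^ 4) P) (β : Fin p → ℝ) {n₁ n₂ : ℕ} (hn : n₁ + n₂ = n)
    (h : DesignBounds x n c C l) (h1 : n₂ ≤ n₁) (hn₂ : 0 < n₂) {κ s : ℝ}
    (hκ : κ = (∫ ω, ε 0 ω ^ 4 ∂P) - 3 * (∫ ω, ε 0 ω ^ 2 ∂P) ^ 2)
    (hs : s = ∫ ω, ε 0 ω ^ 2 ∂P) :
    ((κ + 2 * s ^ 2) * n₂ - |κ| * ((2 * C / c) * (2 * l / c) * (2 * C / c)) +
      4 * s ^ 2 * ((n₂ : ℝ) / n₁ * p) + 2 * s ^ 2 * ((n₂ / n₁) ^ 2 * p)) / (n₂ : ℝ) ^ 2 ≤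
    randomCVVariance P x β ε n n₁ := by
  have hne : (Finset.powersetCard n₁ (Finset.univ : Finset (Fin n))).Nonempty := by
    rw [Finset.powersetCard_nonempty]; simp; omega
  have hunit : ∀ S : Finset (Fin n), S.card = n₁ → IsUnit (gram (design x n) S).det :=
    fun S hS => h.isUnit (by omega)
  have hn0 : (0 : ℝ) < n₂ := by positivity
  have hn1 : (0 : ℝ) < n₁ := by
    have : 0 < n₁ := by omega
    positivity
  rw [randomCVVariance_eq hmeas hindep hident h0 h4 β hn hunit hκ hs]
  refine le_add_of_le_of_nonneg ?_ (expect_sq_sub_sq_nonneg _ hne _)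
  have hτ := expect_excess_ge h (n₁ := n₁) (by omega) (by omega)
  set F := Finset.powersetCard n₁ (Finset.univ : Finset (Fin n)) with hF
  set θ : ℝ := (n₂ : ℝ) / n₁ with hθ
  have hθn : (n : ℝ) / n₁ - 1 = θ := by
    rw [hθ, ← hn]
    push_cast
    field_simp
    ring
  rw [hθn] at hτ
  set D : ℝ := (2 * C / c) * (2 * l / c) * (2 * C / c) with hD
  have hθ0 : 0 ≤ θ := by positivity
  -- Linearizing `excessSq` at `θ` leaves an expression affine in the excess, to which the bound on
  -- its average applies.
  have hpt : ∀ S ∈ F, (1 / (n₂ : ℝ)) ^ 2 * ((κ + 2 * s ^ 2) * n₂ - |κ| * D - 2 * s ^ 2 * (θ ^ 2 * p) +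
      (4 * s ^ 2 + 4 * s ^ 2 * θ) * excess (design x n) S) ≤
      (1 / (n₂ : ℝ)) ^ 2 * (κ * (n₂ + excessDiag (design x n) S) + 2 * s ^ 2 *
          (n₂ + 2 * excess (design x n) S + excessSq (design x n) S)) := by
    intro S hSm
    have hc := (Finset.mem_powersetCard.1 hSm).2
    refine mul_le_mul_of_nonneg_left ?_ (by positivity)
    have e1 := h.excessDiag_le (S := S) (by omega)
    have e2 := excessSq_ge (hunit S hc) θ
    have e3 : -(|κ| * D) ≤ κ * excessDiag (design x n) S := by
      have d0 := excessDiag_nonneg (X := design x n) (S := S)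
      calc -(|κ| * D) ≤ -(|κ| * excessDiag (design x n) S) :=
            neg_le_neg (mul_le_mul_of_nonneg_left e1 (abs_nonneg _))
        _ ≤ κ * excessDiag (design x n) S := by nlinarith [neg_abs_le κ]
    have e4 := mul_le_mul_of_nonneg_left e2 (by positivity : 0 ≤ 2 * s ^ 2)
    linarith
  refine le_trans ?_ (Finset.expect_le_expect hpt)
  rw [← Finset.mul_expect, Finset.expect_add_distrib, ← Finset.mul_expect, Finset.expect_const hne,
    div_eq_mul_one_div, mul_comm, one_div_pow]
  refine mul_le_mul_of_nonneg_left ?_ (by positivity)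
  have := mul_le_mul_of_nonneg_left hτ (by positivity : 0 ≤ 4 * s ^ 2 + 4 * s ^ 2 * θ)
  linarith

/-- It is needed only for the claimed optimum. The number `d` bounds the root mean square of
`devNorm` and becomes small with `l`. -/
lemma randomCVVariance_le (hmeas : ∀ i, Measurable (ε i)) (hindep : iIndepFun ε P)
    (hident : ∀ i, IdentDistrib (ε i) (ε 0) P P) (h0 : ∫ ω, ε 0 ω ∂P = 0)
    (h4 : Integrable (fun ω => ε 0 ω ^ 4) P) (β : Fin p → ℝ) {n₁ n₂ : ℕ} (hn : n₁ + n₂ = n)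
    (h : DesignBounds x n c C l) (h1 : n₂ ≤ n₁) (hn₂ : 0 < n₂) {κ s : ℝ}
    (hκ : κ = (∫ ω, ε 0 ω ^ 4 ∂P) - 3 * (∫ ω, ε 0 ω ^ 2 ∂P) ^ 2)
    (hs : s = ∫ ω, ε 0 ω ^ 2 ∂P) {d : ℝ} (hd : 0 < d) (hl : 2 * (p : ℝ) ^ 2 * l * C ≤ d ^ 2) :
    randomCVVariance P x β ε n n₁ ≤
    ((κ + 2 * s ^ 2) * n₂ + |κ| * ((2 * C / c) * (2 * l / c) * (2 * C / c)) +
      4 * s ^ 2 * ((n₂ : ℝ) / n₁ * p) + 2 * s ^ 2 * ((n₂ / n₁) ^ 2 * p) +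
      (8 * s ^ 2 * (2 / c * d) + 3 * s ^ 2 * (2 / c * d) ^ 2)) / (n₂ : ℝ) ^ 2 := by
  have hne : (Finset.powersetCard n₁ (Finset.univ : Finset (Fin n))).Nonempty := by
    rw [Finset.powersetCard_nonempty]; simp; omega
  have hunit : ∀ S : Finset (Fin n), S.card = n₁ → IsUnit (gram (design x n) S).det :=
    fun S hS => h.isUnit (by omega)
  have hn0 : (0 : ℝ) < n₂ := by positivity
  have hn1 : (0 : ℝ) < n₁ := by
    have : 0 < n₁ := by omega
    positivity
  have hnpos : (0 : ℝ) < n := by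
    have := h.two_le
    positivity
  have hc0 := h.c_pos
  have hdev := expect_devNorm_sq_le (design x n) (n₁ := n₁) h.two_le (by omega) (by omega)
  rw [randomCVVariance_eq hmeas hindep hident h0 h4 β hn hunit hκ hs]
  set F := Finset.powersetCard n₁ (Finset.univ : Finset (Fin n)) with hF
  set θ : ℝ := (n₂ : ℝ) / n₁ with hθ
  set K : ℝ := 2 / c with hK
  set D : ℝ := (2 * C / c) * (2 * l / c) * (2 * C / c) with hD
  have hK0 : 0 ≤ K := by positivity
  have hθn : (n : ℝ) / n₁ - 1 = θ := by
    rw [hθ, ← hn]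
    push_cast
    field_simp
    ring
  have hθ0 : 0 ≤ θ := by positivity
  have hθ1 : θ ≤ 1 := by
    rw [hθ, div_le_one hn1]
    exact_mod_cast h1
  have hdev2 : F.expect (fun S => devNorm (design x n) S ^ 2) ≤ d ^ 2 := by
    refine hdev.trans (le_trans ?_ hl)
    have hsq : ∑ i, (design x n i ⬝ᵥ design x n i) ^ 2 ≤ l * n * (C * n) := by
      have hnn : ∀ i, 0 ≤ design x n i ⬝ᵥ design x n i :=
        fun i => Finset.sum_nonneg fun _ _ => mul_self_nonneg _
      calc ∑ i, (design x n i ⬝ᵥ design x n i) ^ 2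
          ≤ ∑ i, l * n * (design x n i ⬝ᵥ design x n i) := Finset.sum_le_sum fun i _ => by
            rw [sq]; exact mul_le_mul_of_nonneg_right (h.row_le i) (hnn i)
        _ = l * n * ∑ i, design x n i ⬝ᵥ design x n i := by rw [Finset.mul_sum]
        _ ≤ _ := mul_le_mul_of_nonneg_left h.sum_le (mul_nonneg h.l_nonneg hnpos.le)
    have hnn1 : (n : ℝ) ≤ 2 * n₁ := by
      have : n ≤ 2 * n₁ := by omega
      exact_mod_cast this
    calc (p : ℝ) ^ 2 / (n * n₁) * ∑ i, (design x n i ⬝ᵥ design x n i) ^ 2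
        ≤ (p : ℝ) ^ 2 / (n * n₁) * (l * n * (C * n)) := by gcongr
      _ = (p : ℝ) ^ 2 * l * C * (n / n₁) := by field_simp
      _ ≤ (p : ℝ) ^ 2 * l * C * 2 := by
          have : (n : ℝ) / n₁ ≤ 2 := by rw [div_le_iff₀ hn1]; exact hnn1
          exact mul_le_mul_of_nonneg_left this
            (mul_nonneg (mul_nonneg (by positivity) h.l_nonneg) h.C_nonneg)
      _ = _ := by ring
  have hdev1 : F.expect (fun S => devNorm (design x n) S) ≤ d := by
    -- The arithmetic-geometric mean inequality with parameter `d` passes from the second moment to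
    -- the first.
    have hpt : ∀ S ∈ F, devNorm (design x n) S ≤ d / 2 + 1 / (2 * d) * devNorm (design x n) S ^ 2 := by
      intro S _
      have : d / 2 + 1 / (2 * d) * devNorm (design x n) S ^ 2 - devNorm (design x n) S =
          1 / (2 * d) * (devNorm (design x n) S - d) ^ 2 := by
        field_simp
        ring
      have h2 : 0 ≤ 1 / (2 * d) * (devNorm (design x n) S - d) ^ 2 := by positivity
      linarith
    refine (Finset.expect_le_expect hpt).trans ?_
    rw [Finset.expect_add_distrib, Finset.expect_const hne, ← Finset.mul_expect]
    calc d / 2 + 1 / (2 * d) * F.expect (fun S => devNorm (design x n) S ^ 2)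
        ≤ d / 2 + 1 / (2 * d) * d ^ 2 := by gcongr
      _ = d := by field_simp; ring
  have hexc : ∀ S ∈ F, |excess (design x n) S - θ * p| ≤ K * devNorm (design x n) S := by
    intro S hSm
    have hc := (Finset.mem_powersetCard.1 hSm).2
    have hS2 : n ≤ 2 * S.card := by omega
    have := abs_excess_sub_le (h.card_pos hS2) (h.gram_ge S hS2)
      (Finset.card_pos.1 (by omega)) (h.div_le hS2)
    rwa [hc, hθn] at this
  have hvar : F.expect (fun S => (1 / (n₂ : ℝ) * (s * (n₂ + excess (design x n) S))) ^ 2) -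
      (F.expect (fun S => 1 / (n₂ : ℝ) * (s * (n₂ + excess (design x n) S)))) ^ 2 ≤
      (1 / (n₂ : ℝ)) ^ 2 * (s ^ 2 * (K * d) ^ 2) := by
    refine (sq_expect_le_expect_sq F hne _ (1 / (n₂ : ℝ) * (s * (n₂ + θ * p)))).trans ?_
    have hpt : ∀ S ∈ F, (1 / (n₂ : ℝ) * (s * (n₂ + excess (design x n) S)) -
        1 / (n₂ : ℝ) * (s * (n₂ + θ * p))) ^ 2 ≤
        (1 / (n₂ : ℝ)) ^ 2 * (s ^ 2 * K ^ 2) * devNorm (design x n) S ^ 2 := by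
      intro S hSm
      have h2 := hexc S hSm
      have h3 : (excess (design x n) S - θ * p) ^ 2 ≤ (K * devNorm (design x n) S) ^ 2 := by
        rw [← sq_abs]
        gcongr
      calc _ = (1 / (n₂ : ℝ)) ^ 2 * s ^ 2 * (excess (design x n) S - θ * p) ^ 2 := by ring
        _ ≤ (1 / (n₂ : ℝ)) ^ 2 * s ^ 2 * (K * devNorm (design x n) S) ^ 2 := by gcongr
        _ = _ := by ring
    refine (Finset.expect_le_expect hpt).trans ?_
    rw [← Finset.mul_expect]
    calc _ ≤ (1 / (n₂ : ℝ)) ^ 2 * (s ^ 2 * K ^ 2) * d ^ 2 := by gcongr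
      _ = _ := by ring
  have hpt : ∀ S ∈ F, (1 / (n₂ : ℝ)) ^ 2 * (κ * (n₂ + excessDiag (design x n) S) + 2 * s ^ 2 *
          (n₂ + 2 * excess (design x n) S + excessSq (design x n) S)) ≤
      (1 / (n₂ : ℝ)) ^ 2 * ((κ + 2 * s ^ 2) * n₂ + |κ| * D + 4 * s ^ 2 * (θ * p) +
        2 * s ^ 2 * (θ ^ 2 * p) + 8 * s ^ 2 * K * devNorm (design x n) S +
        2 * s ^ 2 * K ^ 2 * devNorm (design x n) S ^ 2) := by
    intro S hSm
    have hc := (Finset.mem_powersetCard.1 hSm).2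
    have hS2 : n ≤ 2 * S.card := by omega
    refine mul_le_mul_of_nonneg_left ?_ (by positivity)
    have e1 := h.excessDiag_le hS2
    have e2 := excessSq_le (h.card_pos hS2) (h.gram_ge S hS2) (Finset.card_pos.1 (by omega))
      (h.div_le hS2) (θ := θ) (by rw [hc, hθn]) hθ0
    have e3 : κ * excessDiag (design x n) S ≤ |κ| * D := by
      have d0 := excessDiag_nonneg (X := design x n) (S := S)
      calc κ * excessDiag (design x n) S ≤ |κ| * excessDiag (design x n) S :=
            mul_le_mul_of_nonneg_right (le_abs_self κ) d0
        _ ≤ |κ| * D := mul_le_mul_of_nonneg_left e1 (abs_nonneg _)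
    have e4 := mul_le_mul_of_nonneg_left e2 (by positivity : 0 ≤ 2 * s ^ 2)
    have e5 := mul_le_mul_of_nonneg_left ((le_abs_self _).trans (hexc S hSm))
      (by positivity : 0 ≤ 4 * s ^ 2)
    have e6 : θ * (K * devNorm (design x n) S) ≤ K * devNorm (design x n) S :=
      mul_le_of_le_one_left (mul_nonneg hK0 (devNorm_nonneg _ _)) hθ1
    have e7 := mul_le_mul_of_nonneg_left e6 (by positivity : 0 ≤ 4 * s ^ 2)
    linarith
  refine (add_le_add (Finset.expect_le_expect hpt) hvar).trans ?_
  rw [← Finset.mul_expect, Finset.expect_add_distrib, Finset.expect_add_distrib,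
    Finset.expect_const hne, ← Finset.mul_expect, ← Finset.mul_expect, ← mul_add,
    div_eq_mul_one_div _ ((n₂ : ℝ) ^ 2), mul_comm _ (1 / (n₂ : ℝ) ^ 2), one_div_pow]
  refine mul_le_mul_of_nonneg_left ?_ (by positivity)
  -- The coefficient `8` collects `4` from the excess and `4` from `excessSq` (using `θ ≤ 1`). The
  -- `3` below collects `2` from `excessSq` and `1` from the conditional mean.
  have f1 := mul_le_mul_of_nonneg_left hdev1 (by positivity : 0 ≤ 8 * s ^ 2 * K)
  have f2 := mul_le_mul_of_nonneg_left hdev2 (by positivity : 0 ≤ 2 * s ^ 2 * K ^ 2)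
  nlinarith

end RandomCV

/-! ### Optimality of the half split -/

section RandomCVOptimal

/-- The comparison of the leading terms of the variance for test sets of size `n₂ < m`. -/
lemma leading_terms_lt {v q b L L' n₁ n₂ N m : ℝ} (hv : 0 < v) (hq : 0 ≤ q) (hb : 0 ≤ b)
    (hn₂ : 1 ≤ n₂) (hlt : n₂ + 1 ≤ m) (hmN : m ≤ N) (hsum : n₁ + n₂ = N + m)
    (h1 : 16 * q * b ≤ v * m) (h2 : 8 * L ≤ v) (h3 : 4 * (L + L') ≤ v) :
    (v * m + L + 4 * q * (m / N * b) + 2 * q * ((m / N) ^ 2 * b) + L') / m ^ 2 <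
      (v * n₂ - L + 4 * q * (n₂ / n₁ * b) + 2 * q * ((n₂ / n₁) ^ 2 * b)) / n₂ ^ 2 := by
  have hm : 0 < m := by linarith
  have hN : 0 < N := by linarith
  have h20 : 0 < n₂ := by linarith
  have h10 : 0 < n₁ := by linarith
  have hqb : 0 ≤ q * b := mul_nonneg hq hb
  have eL : (v * m + L + 4 * q * (m / N * b) + 2 * q * ((m / N) ^ 2 * b) + L') / m ^ 2 =
      v / m + 4 * (q * b) / (N * m) + 2 * (q * b) / N ^ 2 + (L + L') / m ^ 2 := by
    field_simp
    ring
  have eR : (v * n₂ - L + 4 * q * (n₂ / n₁ * b) + 2 * q * ((n₂ / n₁) ^ 2 * b)) / n₂ ^ 2 =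
      v / n₂ + 4 * (q * b) / (n₁ * n₂) + 2 * (q * b) / n₁ ^ 2 - L / n₂ ^ 2 := by
    field_simp
    ring
  rw [eL, eR]
  -- The gain in the leading term is `v G` with `G = 1 / n₂ - 1 / m`. Each of the three adverse
  -- terms below costs at most a quarter of it.
  set G : ℝ := (m - n₂) / (m * n₂) with hG
  have hGpos : 0 < G := div_pos (by linarith) (by positivity)
  have g0 : v / n₂ - v / m = v * G := by
    rw [hG]
    field_simp
  -- At fixed sum the product of the two sizes is largest at the balanced split, so this term helps.
  have g1 : 4 * (q * b) / (N * m) ≤ 4 * (q * b) / (n₁ * n₂) := by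
    refine div_le_div_of_nonneg_left (by positivity) (by positivity) ?_
    have : n₁ = N + m - n₂ := by linarith
    rw [this]
    nlinarith [mul_nonneg (by linarith : 0 ≤ m - n₂) (by linarith : 0 ≤ N - n₂)]
  -- This term favours a larger training set, but its change is of order `G / m`.
  have g2 : 2 * (q * b) / N ^ 2 - 2 * (q * b) / n₁ ^ 2 ≤ v / 4 * G := by
    have i1 : 2 * (q * b) / N ^ 2 - 2 * (q * b) / n₁ ^ 2 =
        2 * (q * b) * ((m - n₂) * ((n₁ + N) / (N ^ 2 * n₁ ^ 2))) := by
      have : m - n₂ = n₁ - N := by linarith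
      rw [this]
      field_simp
      ring
    have i2 : (n₁ + N) / (N ^ 2 * n₁ ^ 2) ≤ 2 / (m ^ 2 * n₂) := by
      calc (n₁ + N) / (N ^ 2 * n₁ ^ 2) ≤ (2 * n₁) / (N ^ 2 * n₁ ^ 2) := by
            gcongr
            linarith
        _ = 2 / (N ^ 2 * n₁) := by field_simp
        _ ≤ 2 / (m ^ 2 * n₂) := by
            gcongr
            linarith
    rw [i1]
    calc 2 * (q * b) * ((m - n₂) * ((n₁ + N) / (N ^ 2 * n₁ ^ 2)))
        ≤ 2 * (q * b) * ((m - n₂) * (2 / (m ^ 2 * n₂))) := by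
          refine mul_le_mul_of_nonneg_left (mul_le_mul_of_nonneg_left i2 (by linarith))
            (by positivity)
      _ = (16 * q * b) / m / 4 * G := by
          rw [hG]
          field_simp
          ring
      _ ≤ v / 4 * G := by
          refine mul_le_mul_of_nonneg_right ?_ hGpos.le
          refine div_le_div_of_nonneg_right ?_ (by norm_num)
          rw [div_le_iff₀ hm]
          exact h1
  have g3 : L / n₂ ^ 2 ≤ v / 4 * G := by
    rw [hG, mul_div_assoc', div_le_div_iff₀ (by positivity) (by positivity)]
    -- With `1 ≤ n₂ ≤ m - 1` the product is at least `m - 1 ≥ m / 2`.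
    have j1 : m ≤ 2 * ((m - n₂) * n₂) := by
      nlinarith [mul_nonneg (by linarith : 0 ≤ m - n₂ - 1) (by linarith : 0 ≤ n₂ - 1)]
    have j2 : 8 * L * m ≤ v * (2 * ((m - n₂) * n₂)) :=
      (mul_le_mul_of_nonneg_right h2 hm.le).trans (mul_le_mul_of_nonneg_left j1 hv.le)
    have j3 := mul_le_mul_of_nonneg_right j2 h20.le
    nlinarith
  have g4 : (L + L') / m ^ 2 ≤ v / 4 * G := by
    calc (L + L') / m ^ 2 ≤ v / 4 / m ^ 2 := by
          gcongr
          linarith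
      _ = v / 4 * (1 / (m * m)) := by
          field_simp
      _ ≤ v / 4 * G := by
          refine mul_le_mul_of_nonneg_left ?_ (by positivity)
          rw [hG]
          refine div_le_div₀ (by linarith) (by linarith) (by positivity) ?_
          exact mul_le_mul_of_nonneg_left (by linarith) hm.le
  have hvG : 0 < v * G := mul_pos hv hGpos
  linarith

lemma argMin_eq_singleton {s : Set ℕ} {f : ℕ → ℝ} {a : ℕ} (ha : a ∈ s)
    (h : ∀ b ∈ s, b ≠ a → f a < f b) : argMin s f = {a} := by
  ext b
  simp only [argMin, Set.mem_ofPred_eq, Set.mem_singleton_iff]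
  constructor
  · rintro ⟨hb, hle⟩
    by_contra hne
    exact absurd (h b hb hne) (not_lt.2 (hle a ha))
  · intro hba
    rw [hba]
    refine ⟨ha, fun b hb => ?_⟩
    by_cases hne : b = a
    · rw [hne]
    · exact (h b hb hne).le

variable {Ω : Type*} [MeasurableSpace Ω] {P : Measure Ω} [IsProbabilityMeasure P] {ε : ℕ → Ω → ℝ}
  {p : ℕ} {x : ℕ → Fin p → ℝ} {V : Matrix (Fin p) (Fin p) ℝ}

theorem eventually_optTrainingSizes (hx : RegularDesign x V) (β : Fin p → ℝ)
    (hmeas : ∀ i, Measurable (ε i)) (hindep : iIndepFun ε P)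
    (hident : ∀ i, IdentDistrib (ε i) (ε 0) P P) (h0 : ∫ ω, ε 0 ω ∂P = 0)
    (h4 : Integrable (fun ω => ε 0 ω ^ 4) P)
    (hv : 0 < (∫ ω, ε 0 ω ^ 4 ∂P) - (∫ ω, ε 0 ω ^ 2 ∂P) ^ 2) :
    ∀ᶠ n : ℕ in atTop, optTrainingSizes P x β ε n = {⌈(n : ℝ) / 2⌉₊} := by
  obtain ⟨c, C, hc, hC, hb⟩ := exists_designBounds hx
  set s : ℝ := ∫ ω, ε 0 ω ^ 2 ∂P with hs
  set κ : ℝ := (∫ ω, ε 0 ω ^ 4 ∂P) - 3 * s ^ 2 with hκ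
  set v : ℝ := κ + 2 * s ^ 2 with hvdef
  have hvpos : 0 < v := by
    rw [hvdef, hκ]
    linarith
  -- Here `t = 2 d / c`, and `t ≤ 1` gives `8 L' ≤ (64 + 24) s² t = 88 s² t ≤ v`.
  set t : ℝ := min 1 (v / (88 * s ^ 2 + 1)) with ht
  have htpos : 0 < t := lt_min one_pos (by positivity)
  set d : ℝ := t / (2 / c) with hd
  have hdpos : 0 < d := by positivity
  set B : ℝ := (2 * C / c) * (2 / c) * (2 * C / c) with hB
  have hBpos : 0 < B := by positivity
  -- The first bound on the leverage scale `l` makes the sampling deviation at most `d`; the second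
  -- makes `8 L ≤ v`. The added ones avoid zero denominators.
  set l : ℝ := min (d ^ 2 / (2 * (p : ℝ) ^ 2 * C + 1)) (v / (8 * |κ| * B + 1)) with hl
  have hlpos : 0 < l := lt_min (by positivity) (by positivity)
  have hl1 : 2 * (p : ℝ) ^ 2 * l * C ≤ d ^ 2 := by
    have h1 : l ≤ d ^ 2 / (2 * (p : ℝ) ^ 2 * C + 1) := min_le_left _ _
    rw [le_div_iff₀ (by positivity)] at h1
    linarith
  set L : ℝ := |κ| * ((2 * C / c) * (2 * l / c) * (2 * C / c)) with hL
  have hL8 : 8 * L ≤ v := by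
    have h1 : l ≤ v / (8 * |κ| * B + 1) := min_le_right _ _
    rw [le_div_iff₀ (by positivity)] at h1
    have : 8 * L = l * (8 * |κ| * B) := by rw [hL, hB]; ring
    rw [this]
    linarith
  set L' : ℝ := 8 * s ^ 2 * (2 / c * d) + 3 * s ^ 2 * (2 / c * d) ^ 2 with hL'
  have hL'8 : 8 * L' ≤ v := by
    have e : 2 / c * d = t := by rw [hd]; field_simp
    have h1 : t ≤ v / (88 * s ^ 2 + 1) := min_le_right _ _
    have h2 : t ≤ 1 := min_le_left _ _
    rw [le_div_iff₀ (by positivity)] at h1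
    rw [hL', e]
    nlinarith [mul_nonneg (sq_nonneg s) (mul_nonneg htpos.le (sub_nonneg.2 h2))]
  have hlarge : ∀ᶠ n : ℕ in atTop, 16 * s ^ 2 * p ≤ v * ((n / 2 : ℕ) : ℝ) := by
    have h1 : Tendsto (fun n : ℕ => ((n / 2 : ℕ) : ℝ)) atTop atTop :=
      tendsto_natCast_atTop_atTop.comp (Nat.tendsto_div_const_atTop (by norm_num))
    exact (h1.const_mul_atTop hvpos).eventually_ge_atTop _
  filter_upwards [hb l hlpos, hlarge] with n hn hn16
  have hn2 := hn.two_le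
  set N := ⌈(n : ℝ) / 2⌉₊ with hN
  have hN1 : n ≤ 2 * N := by
    have : (n : ℝ) / 2 ≤ N := Nat.le_ceil _
    have : (n : ℝ) ≤ 2 * N := by linarith
    exact_mod_cast this
  have hN2 : 2 * N < n + 2 := by
    have : (N : ℝ) < (n : ℝ) / 2 + 1 := Nat.ceil_lt_add_one (by positivity)
    have : (2 : ℝ) * N < n + 2 := by linarith
    exact_mod_cast this
  refine argMin_eq_singleton ⟨Nat.le_ceil _, by omega⟩ ?_
  rintro n₁ ⟨hn₁, hn₁n⟩ hne
  have hNn₁ : N ≤ n₁ := Nat.ceil_le.2 hn₁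
  have hm : n - N = n / 2 := by omega
  have up := randomCVVariance_le hmeas hindep hident h0 h4 β (n₁ := N) (n₂ := n - N) (by omega)
    hn (by omega) (by omega) hκ hs hdpos hl1
  have lo := randomCVVariance_ge hmeas hindep hident h0 h4 β (n₁ := n₁) (n₂ := n - n₁) (by omega)
    hn (by omega) (by omega) hκ hs
  refine lt_of_le_of_lt up (lt_of_lt_of_le ?_ lo)
  refine leading_terms_lt hvpos (sq_nonneg s) (Nat.cast_nonneg p) ?_ ?_ ?_ ?_ ?_ hL8 (by linarith)
  · exact_mod_cast (by omega : 1 ≤ n - n₁)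
  · exact_mod_cast (by omega : n - n₁ + 1 ≤ n - N)
  · exact_mod_cast (by omega : n - N ≤ N)
  · exact_mod_cast (by omega : n₁ + (n - n₁) = N + (n - N))
  · rw [hm]
    exact hn16

end RandomCVOptimal

/-! ### Operator and Frobenius norms -/

section Frobenius

variable {n : ℕ}

/-- The Euclidean operator norm of `M` is at most `t`. -/
def OpBdd (M : Matrix (Fin n) (Fin n) ℝ) (t : ℝ) : Prop :=
  ∀ u, (M *ᵥ u) ⬝ᵥ (M *ᵥ u) ≤ t ^ 2 * (u ⬝ᵥ u)

/-- The squared Frobenius norm. -/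
def frobSq (M : Matrix (Fin n) (Fin n) ℝ) : ℝ := ∑ i, ∑ j, M i j ^ 2

lemma frobSq_nonneg (M : Matrix (Fin n) (Fin n) ℝ) : 0 ≤ frobSq M :=
  Finset.sum_nonneg fun _ _ => Finset.sum_nonneg fun _ _ => sq_nonneg _

lemma frobSq_eq_trace {M : Matrix (Fin n) (Fin n) ℝ} (hM : M.IsSymm) :
    frobSq M = (M * M).trace := by
  simp only [frobSq, Matrix.trace, Matrix.diag, Matrix.mul_apply]
  exact Finset.sum_congr rfl fun i _ => Finset.sum_congr rfl fun j _ => by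
    rw [hM.apply i j, sq]

lemma OpBdd.mul {M N : Matrix (Fin n) (Fin n) ℝ} {s t : ℝ} (hM : OpBdd M s) (hN : OpBdd N t) :
    OpBdd (M * N) (s * t) := by
  intro u
  rw [← Matrix.mulVec_mulVec]
  calc _ ≤ s ^ 2 * ((N *ᵥ u) ⬝ᵥ (N *ᵥ u)) := hM _
    _ ≤ s ^ 2 * (t ^ 2 * (u ⬝ᵥ u)) := mul_le_mul_of_nonneg_left (hN u) (sq_nonneg s)
    _ = _ := by ring

lemma OpBdd.frobSq_mul_le {M : Matrix (Fin n) (Fin n) ℝ} {t : ℝ} (hM : OpBdd M t)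
    (N : Matrix (Fin n) (Fin n) ℝ) : frobSq (M * N) ≤ t ^ 2 * frobSq N := by
  have h : ∀ j, ∑ i, (M * N) i j ^ 2 ≤ t ^ 2 * ∑ i, N i j ^ 2 := by
    intro j
    have := hM fun i => N i j
    simp only [dotProduct, ← sq] at this
    exact this
  rw [frobSq, frobSq, Finset.sum_comm, Finset.sum_comm (f := fun i j => N i j ^ 2), Finset.mul_sum]
  exact Finset.sum_le_sum fun j _ => h j

lemma OpBdd.abs_diag_le {M : Matrix (Fin n) (Fin n) ℝ} {t : ℝ} (hM : OpBdd M t) (ht : 0 ≤ t)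
    (i : Fin n) : |M i i| ≤ t := by
  have h := hM (Pi.single i 1)
  simp only [Matrix.mulVec_single_one, single_one_dotProduct, Pi.single_eq_same, mul_one] at h
  have h2 : M i i ^ 2 ≤ (M.col i) ⬝ᵥ (M.col i) := by
    rw [sq]
    exact Finset.single_le_sum (f := fun k => M.col i k * M.col i k)
      (fun k _ => mul_self_nonneg _) (Finset.mem_univ i)
  exact abs_le_of_sq_le_sq (h2.trans h) ht

lemma opBdd_diagonal {d : Fin n → ℝ} {t : ℝ} (hd : ∀ i, |d i| ≤ t) :
    OpBdd (Matrix.diagonal d) t := by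
  intro u
  simp only [dotProduct, Matrix.mulVec_diagonal, Finset.mul_sum]
  refine Finset.sum_le_sum fun i _ => ?_
  have h : d i ^ 2 ≤ t ^ 2 := by
    rw [← sq_abs]
    exact pow_le_pow_left₀ (abs_nonneg _) (hd i) 2
  nlinarith [mul_le_mul_of_nonneg_right h (mul_self_nonneg (u i))]

lemma abs_trace_mul_le {M N : Matrix (Fin n) (Fin n) ℝ} {a b : ℝ} (ha : 0 ≤ a) (hb : 0 ≤ b)
    {r : ℝ} (hr : 0 ≤ r) (hM : frobSq M ≤ a ^ 2 * r) (hN : frobSq N ≤ b ^ 2 * r) :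
    |(M * N).trace| ≤ a * b * r := by
  refine abs_le_of_sq_le_sq ?_ (by positivity)
  have e : (M * N).trace = ∑ q : Fin n × Fin n, M q.1 q.2 * N q.2 q.1 := by
    rw [Fintype.sum_prod_type]
    rfl
  have hM' : ∑ q : Fin n × Fin n, M q.1 q.2 ^ 2 = frobSq M := by
    rw [Fintype.sum_prod_type, frobSq]
  have hN' : ∑ q : Fin n × Fin n, N q.2 q.1 ^ 2 = frobSq N := by
    rw [Fintype.sum_prod_type, frobSq, Finset.sum_comm]
  rw [e]
  refine (Finset.sum_mul_sq_le_sq_mul_sq _ _ _).trans ?_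
  rw [hM', hN']
  calc frobSq M * frobSq N ≤ (a ^ 2 * r) * (b ^ 2 * r) :=
        mul_le_mul hM hN (frobSq_nonneg _) (by positivity)
    _ = (a * b * r) ^ 2 := by ring

/-- A symmetric matrix between `0` and `1` is bounded below by its square. -/
lemma mulVec_sq_le_of_le_one {Y : Matrix (Fin n) (Fin n) ℝ} (hY : Y.IsSymm)
    (h0 : ∀ u, 0 ≤ u ⬝ᵥ (Y *ᵥ u)) (h1 : ∀ u, u ⬝ᵥ (Y *ᵥ u) ≤ u ⬝ᵥ u) (w : Fin n → ℝ) :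
    (Y *ᵥ w) ⬝ᵥ (Y *ᵥ w) ≤ w ⬝ᵥ (Y *ᵥ w) := by
  -- Positivity here reads `w·Yw - 2 |Yw|² + Yw·Y(Yw) ≥ 0`, and the last term is at most `|Yw|²`.
  have h := h0 (w - Y *ᵥ w)
  have h2 := h1 (Y *ᵥ w)
  have e : w ⬝ᵥ (Y *ᵥ (Y *ᵥ w)) = (Y *ᵥ w) ⬝ᵥ (Y *ᵥ w) := by
    rw [Matrix.dotProduct_mulVec w, ← Matrix.mulVec_transpose, hY.eq]
  simp only [Matrix.mulVec_sub, sub_dotProduct, dotProduct_sub] at h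
  rw [e] at h
  linarith

end Frobenius

/-! ### Block diagonal parts of the hat matrix and their resolvents -/

section LeaveOneOut

variable {n k : ℕ} (Q : Matrix (Fin n) (Fin n) ℝ) (g : Fin n → Fin k)

/-- The block diagonal part of `Q` with respect to the folding `g`. -/
def foldBlock : Matrix (Fin n) (Fin n) ℝ := fun i l => if g i = g l then Q i l else 0

/-- The off-diagonal part of the block diagonal part of `Q`. -/
def foldOff : Matrix (Fin n) (Fin n) ℝ := foldBlock Q g - Matrix.diagonal Q.diag

/-- The matrix of the quadratic form given by the total `k`-fold error. -/
def foldErrorMatrix : Matrix (Fin n) (Fin n) ℝ :=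
  (1 - Q) * (1 - foldBlock Q g)⁻¹ * (1 - foldBlock Q g)⁻¹ * (1 - Q)

/-- The factors `1 / (1 - Qᵢᵢ)` that turn residuals into leave-one-out residuals. -/
def looScale : Matrix (Fin n) (Fin n) ℝ := Matrix.diagonal fun i => (1 - Q i i)⁻¹

/-- The matrix of the quadratic form given by the total leave-one-out error. -/
def looErrorMatrix : Matrix (Fin n) (Fin n) ℝ := (1 - Q) * looScale Q * looScale Q * (1 - Q)

/-- The deviation of the leave-one-out error matrix from the residual projection. -/
def looWeight : Matrix (Fin n) (Fin n) ℝ :=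
  (1 - Q) * (Matrix.diagonal fun i => ((1 - Q i i)⁻¹) ^ 2 - 1) * (1 - Q)

variable {Q g}

lemma foldBlock_isSymm (hQ : Q.IsSymm) : (foldBlock Q g).IsSymm := by
  ext i l
  simp only [Matrix.transpose_apply, foldBlock, hQ.apply i l, eq_comm]

lemma isSymm_one_sub (hQ : Q.IsSymm) : (1 - Q).IsSymm := by
  rw [Matrix.IsSymm, Matrix.transpose_sub, Matrix.transpose_one, hQ.eq]

/-- Bounds for `Q` on vectors supported in one fold thereby transfer to the block diagonal part. -/
lemma dotProduct_foldBlock_mulVec (u : Fin n → ℝ) :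
    u ⬝ᵥ (foldBlock Q g *ᵥ u) =
      ∑ j, (fun i => if g i = j then u i else 0) ⬝ᵥ (Q *ᵥ fun i => if g i = j then u i else 0) := by
  simp only [dotProduct, Matrix.mulVec, Finset.mul_sum]
  rw [Finset.sum_comm (s := (Finset.univ : Finset (Fin k)))]
  refine Finset.sum_congr rfl fun i _ => ?_
  rw [Finset.sum_comm (s := (Finset.univ : Finset (Fin k)))]
  refine Finset.sum_congr rfl fun l _ => ?_
  rw [Finset.sum_eq_single (g i)]
  · simp only [foldBlock, if_true, eq_comm (a := g i)]
    split_ifs <;> simp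
  · intro j _ hj
    simp [Ne.symm hj]
  · simp

lemma dotProduct_mulVec_self_of_idem (hQ : Q.IsSymm) (hQ2 : Q * Q = Q) (u : Fin n → ℝ) :
    u ⬝ᵥ (Q *ᵥ u) = (Q *ᵥ u) ⬝ᵥ (Q *ᵥ u) := by
  conv_lhs => rw [← hQ2, ← Matrix.mulVec_mulVec]
  rw [Matrix.dotProduct_mulVec u, ← Matrix.mulVec_transpose, hQ.eq]

lemma foldBlock_nonneg (hQ : Q.IsSymm) (hQ2 : Q * Q = Q) (u : Fin n → ℝ) :
    0 ≤ u ⬝ᵥ (foldBlock Q g *ᵥ u) := by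
  rw [dotProduct_foldBlock_mulVec]
  refine Finset.sum_nonneg fun j _ => ?_
  rw [dotProduct_mulVec_self_of_idem hQ hQ2]
  exact Finset.sum_nonneg fun _ _ => mul_self_nonneg _

lemma opBdd_one_sub (hQ : Q.IsSymm) (hQ2 : Q * Q = Q) : OpBdd (1 - Q) 1 := by
  intro u
  have h := dotProduct_mulVec_self_of_idem hQ hQ2 u
  have h0 : 0 ≤ (Q *ᵥ u) ⬝ᵥ (Q *ᵥ u) := Finset.sum_nonneg fun _ _ => mul_self_nonneg _
  simp only [Matrix.sub_mulVec, Matrix.one_mulVec, sub_dotProduct, dotProduct_sub,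
    dotProduct_comm (Q *ᵥ u) u]
  linarith

lemma one_sub_idem (hQ2 : Q * Q = Q) : (1 - Q) * (1 - Q) = 1 - Q := by
  rw [Matrix.mul_sub, Matrix.sub_mul, Matrix.sub_mul, hQ2]
  simp

section Inverse

variable {a : ℝ}

lemma dotProduct_one_sub_foldBlock (u : Fin n → ℝ) :
    u ⬝ᵥ ((1 - foldBlock Q g) *ᵥ u) = u ⬝ᵥ u - u ⬝ᵥ (foldBlock Q g *ᵥ u) := by
  rw [Matrix.sub_mulVec, Matrix.one_mulVec, dotProduct_sub]

lemma isUnit_one_sub_foldBlock (ha : 0 < a)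
    (hB : ∀ u, u ⬝ᵥ (foldBlock Q g *ᵥ u) ≤ (1 - a) * (u ⬝ᵥ u)) :
    IsUnit (1 - foldBlock Q g).det := by
  rw [isUnit_iff_ne_zero]
  intro h
  obtain ⟨v, hv, hv0⟩ := Matrix.exists_mulVec_eq_zero_iff.2 h
  have h1 := dotProduct_one_sub_foldBlock (Q := Q) (g := g) v
  rw [hv0, dotProduct_zero] at h1
  have hpos : 0 < v ⬝ᵥ v := by
    have h0 : 0 ≤ v ⬝ᵥ v := Finset.sum_nonneg fun i _ => mul_self_nonneg _
    exact lt_of_le_of_ne h0 fun h => hv (dotProduct_self_eq_zero.1 h.symm)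
  nlinarith [hB v]

lemma opBdd_inv_one_sub_foldBlock (ha : 0 < a)
    (hB : ∀ u, u ⬝ᵥ (foldBlock Q g *ᵥ u) ≤ (1 - a) * (u ⬝ᵥ u)) :
    OpBdd (1 - foldBlock Q g)⁻¹ (1 / a) := by
  intro u
  set w := (1 - foldBlock Q g)⁻¹ *ᵥ u with hw
  have hu : (1 - foldBlock Q g) *ᵥ w = u := by
    rw [hw, Matrix.mulVec_mulVec, Matrix.mul_nonsing_inv _ (isUnit_one_sub_foldBlock ha hB),
      Matrix.one_mulVec]
  have h1 := dotProduct_one_sub_foldBlock (Q := Q) (g := g) w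
  rw [hu] at h1
  have h2 := hB w
  have h3 : 0 ≤ (u - a • w) ⬝ᵥ (u - a • w) := Finset.sum_nonneg fun i _ => mul_self_nonneg _
  simp only [sub_dotProduct, dotProduct_sub, smul_dotProduct, dotProduct_smul, smul_eq_mul,
    dotProduct_comm w u] at h1 h3
  rw [div_pow, one_pow, div_mul_eq_mul_div, one_mul, le_div_iff₀ (by positivity)]
  nlinarith

/-- The matrix `Y = 1 - foldBlock Q g` lies between `0` and `1`, so `Y² ≤ Y`; evaluate at `Y⁻¹ u`.
-/
lemma le_inv_one_sub_foldBlock (hQ : Q.IsSymm) (hQ2 : Q * Q = Q) (ha : 0 < a)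
    (hB : ∀ u, u ⬝ᵥ (foldBlock Q g *ᵥ u) ≤ (1 - a) * (u ⬝ᵥ u)) (u : Fin n → ℝ) :
    u ⬝ᵥ u ≤ u ⬝ᵥ ((1 - foldBlock Q g)⁻¹ *ᵥ u) := by
  set w := (1 - foldBlock Q g)⁻¹ *ᵥ u with hw
  have hu : (1 - foldBlock Q g) *ᵥ w = u := by
    rw [hw, Matrix.mulVec_mulVec, Matrix.mul_nonsing_inv _ (isUnit_one_sub_foldBlock ha hB),
      Matrix.one_mulVec]
  have h := mulVec_sq_le_of_le_one (isSymm_one_sub (foldBlock_isSymm (g := g) hQ)) (fun v => ?_)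
    (fun v => ?_) w
  · rwa [hu, dotProduct_comm w u] at h
  · rw [dotProduct_one_sub_foldBlock]
    have h0 : 0 ≤ v ⬝ᵥ v := Finset.sum_nonneg fun i _ => mul_self_nonneg _
    nlinarith [hB v]
  · rw [dotProduct_one_sub_foldBlock]
    linarith [foldBlock_nonneg (g := g) hQ hQ2 v]

lemma inv_one_sub_foldBlock_isSymm (hQ : Q.IsSymm) : ((1 - foldBlock Q g)⁻¹).IsSymm := by
  rw [Matrix.IsSymm, Matrix.transpose_nonsing_inv, (isSymm_one_sub (foldBlock_isSymm hQ)).eq]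

lemma foldErrorMatrix_isSymm (hQ : Q.IsSymm) : (foldErrorMatrix Q g).IsSymm := by
  simp only [Matrix.IsSymm, foldErrorMatrix, Matrix.transpose_mul, (isSymm_one_sub hQ).eq,
    (inv_one_sub_foldBlock_isSymm (g := g) hQ).eq, Matrix.mul_assoc]

lemma looErrorMatrix_isSymm (hQ : Q.IsSymm) : (looErrorMatrix Q).IsSymm := by
  simp only [Matrix.IsSymm, looErrorMatrix, looScale, Matrix.transpose_mul, (isSymm_one_sub hQ).eq,
    Matrix.diagonal_transpose, Matrix.mul_assoc]

/-- The inverse of a block diagonal matrix is block diagonal. -/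
lemma inv_one_sub_foldBlock_mul_apply (hU : IsUnit (1 - foldBlock Q g).det) {i l : Fin n}
    (hil : g i ≠ g l) :
    ((1 - foldBlock Q g)⁻¹ * (1 - foldBlock Q g)⁻¹) i l = 0 := by
  set G := (1 - foldBlock Q g)⁻¹ with hG
  -- A matrix that commutes with the diagonal matrix of fold labels has no entries between different
  -- folds.
  set D : Matrix (Fin n) (Fin n) ℝ := Matrix.diagonal fun i => ((g i : ℕ) : ℝ) with hD
  have hBD : (1 - foldBlock Q g) * D = D * (1 - foldBlock Q g) := by
    rw [Matrix.sub_mul, Matrix.mul_sub, Matrix.one_mul, Matrix.mul_one]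
    congr 1
    ext i l
    rw [hD, Matrix.mul_diagonal, Matrix.diagonal_mul]
    simp only [foldBlock]
    split_ifs with h
    · rw [h, mul_comm]
    · simp
  have hGD : D * G = G * D := by
    calc D * G = G * (1 - foldBlock Q g) * D * G := by
          rw [Matrix.nonsing_inv_mul _ hU, Matrix.one_mul]
      _ = G * D * ((1 - foldBlock Q g) * G) := by
          rw [Matrix.mul_assoc G, hBD]
          simp only [Matrix.mul_assoc]
      _ = G * D := by rw [Matrix.mul_nonsing_inv _ hU, Matrix.mul_one]
  have h2 : D * (G * G) = G * G * D := by
    rw [← Matrix.mul_assoc, hGD, Matrix.mul_assoc, hGD, Matrix.mul_assoc]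
  have h3 := congrFun (congrFun h2 i) l
  rw [hD, Matrix.mul_diagonal, Matrix.diagonal_mul, mul_comm] at h3
  have h4 : (G * G) i l * (((g i : ℕ) : ℝ) - ((g l : ℕ) : ℝ)) = 0 := by linarith
  rcases mul_eq_zero.1 h4 with h | h
  · exact h
  · exfalso
    apply hil
    have : ((g i : ℕ) : ℝ) = ((g l : ℕ) : ℝ) := by linarith
    exact Fin.ext (by exact_mod_cast this)

/-- The squared inverse is block diagonal, so within the trace `Q` may be replaced by its block
diagonal part, which then cancels one inverse. -/
lemma trace_one_sub_mul_inv_sq (hU : IsUnit (1 - foldBlock Q g).det) :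
    ((1 - Q) * ((1 - foldBlock Q g)⁻¹ * (1 - foldBlock Q g)⁻¹)).trace =
      ((1 - foldBlock Q g)⁻¹).trace := by
  have h : ((1 - Q) * ((1 - foldBlock Q g)⁻¹ * (1 - foldBlock Q g)⁻¹)).trace =
      ((1 - foldBlock Q g) * ((1 - foldBlock Q g)⁻¹ * (1 - foldBlock Q g)⁻¹)).trace := by
    rw [Matrix.sub_mul, Matrix.sub_mul, Matrix.trace_sub, Matrix.trace_sub]
    congr 1
    simp only [Matrix.trace, Matrix.diag, Matrix.mul_apply (M := Q),
      Matrix.mul_apply (M := foldBlock Q g)]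
    refine Finset.sum_congr rfl fun i _ => Finset.sum_congr rfl fun l _ => ?_
    by_cases hil : g i = g l
    · simp [foldBlock, hil]
    · rw [inv_one_sub_foldBlock_mul_apply hU (Ne.symm hil), mul_zero, mul_zero]
  rw [h, ← Matrix.mul_assoc, Matrix.mul_nonsing_inv _ hU, Matrix.one_mul]

end Inverse

end LeaveOneOut

/-! ### Leave-one-out against larger folds -/

section LeaveOneOutComparison

variable {n k : ℕ} {Q : Matrix (Fin n) (Fin n) ℝ} {g : Fin n → Fin k} {a : ℝ}

lemma foldOff_apply (i l : Fin n) :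
    foldOff Q g i l = ((if g i = g l then 1 else 0) - if i = l then 1 else 0) * Q i l := by
  simp only [foldOff, Matrix.sub_apply, foldBlock, Matrix.diagonal_apply, Matrix.diag]
  by_cases h : i = l
  · subst h; simp
  · simp [h]

lemma foldOff_isSymm (hQ : Q.IsSymm) : (foldOff Q g).IsSymm := by
  rw [Matrix.IsSymm, foldOff, Matrix.transpose_sub, (foldBlock_isSymm hQ).eq,
    Matrix.diagonal_transpose]

lemma looScale_isSymm : (looScale Q).IsSymm := by
  rw [Matrix.IsSymm, looScale, Matrix.diagonal_transpose]

lemma looScale_mul_one_sub (hd : ∀ i, Q i i < 1) :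
    looScale Q * (1 - Matrix.diagonal Q.diag) = 1 := by
  rw [looScale, ← Matrix.diagonal_one, Matrix.diagonal_sub, Matrix.diagonal_mul_diagonal]
  congr 1
  funext i
  exact inv_mul_cancel₀ (by linarith [hd i] : 1 - Q i i ≠ 0)

/-- The resolvent expansion of the inverse of `1 - foldBlock Q g`. -/
lemma inv_one_sub_foldBlock_eq (hQ : Q.IsSymm) (hd : ∀ i, Q i i < 1)
    (hU : IsUnit (1 - foldBlock Q g).det) :
    (1 - foldBlock Q g)⁻¹ = looScale Q + looScale Q * foldOff Q g * looScale Q +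
      looScale Q * foldOff Q g * (1 - foldBlock Q g)⁻¹ * foldOff Q g * looScale Q := by
  set G := (1 - foldBlock Q g)⁻¹ with hG
  set E := looScale Q with hE
  set O := foldOff Q g with hO
  have hdec : 1 - foldBlock Q g = (1 - Matrix.diagonal Q.diag) - O := by
    rw [hO, foldOff]; abel
  have h1 : G = E + E * O * G := by
    have h := Matrix.mul_nonsing_inv _ hU
    rw [← hG] at h
    nth_rewrite 1 [hdec] at h
    rw [Matrix.sub_mul] at h
    have h2 := congrArg (fun M => E * M) h
    simp only [Matrix.mul_sub, ← Matrix.mul_assoc, Matrix.mul_one] at h2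
    have h3 := looScale_mul_one_sub hd
    rw [Matrix.mul_sub, Matrix.mul_one, ← hE] at h3
    rw [h3, Matrix.one_mul] at h2
    exact sub_eq_iff_eq_add.1 h2
  have hGs : Gᵀ = G := (inv_one_sub_foldBlock_isSymm hQ).eq
  -- The transposed equation, inserted into the first, gives a second-order expansion with `G` in
  -- the middle of the remainder.
  have h2 : G = E + G * O * E := by
    have := congrArg Matrix.transpose h1
    rw [Matrix.transpose_add, Matrix.transpose_mul, Matrix.transpose_mul, hGs, looScale_isSymm.eq,
      (foldOff_isSymm hQ).eq, ← Matrix.mul_assoc] at this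
    exact this
  calc G = E + E * O * G := h1
    _ = E + E * O * (E + G * O * E) := by rw [← h2]
    _ = _ := by
      rw [Matrix.mul_add, ← add_assoc]
      simp only [Matrix.mul_assoc]

lemma trace_mul_foldOff_mul_diagonal (d e : Fin n → ℝ) :
    (Matrix.diagonal d * foldOff Q g * Matrix.diagonal e).trace = 0 := by
  simp only [Matrix.trace, Matrix.diag, Matrix.mul_diagonal, Matrix.diagonal_mul, foldOff_apply]
  simp

/-- The trace of the inverse dominates the leave-one-out trace by the squared off-diagonal
entries within the folds. -/
lemma frobSq_foldOff_le_trace_sub (hQ : Q.IsSymm) (hQ2 : Q * Q = Q) (hd0 : ∀ i, 0 ≤ Q i i)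
    (hd : ∀ i, Q i i < 1) (ha : 0 < a)
    (hB : ∀ u, u ⬝ᵥ (foldBlock Q g *ᵥ u) ≤ (1 - a) * (u ⬝ᵥ u)) :
    frobSq (foldOff Q g) ≤ ((1 - foldBlock Q g)⁻¹).trace - (looScale Q).trace := by
  have hU := isUnit_one_sub_foldBlock ha hB
  rw [inv_one_sub_foldBlock_eq hQ hd hU, Matrix.trace_add, Matrix.trace_add]
  have h0 : (looScale Q * foldOff Q g * looScale Q).trace = 0 :=
    trace_mul_foldOff_mul_diagonal _ _
  rw [h0, add_zero, add_sub_cancel_left]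
  set G := (1 - foldBlock Q g)⁻¹ with hG
  set Y := foldOff Q g * looScale Q with hY
  -- The remainder has the form `Yᵀ G Y` with `G ≥ 1`, so its trace is at least the squared norm of
  -- `Y`, and the scale factors are at least `1`.
  have hYt : looScale Q * foldOff Q g = Yᵀ := by
    rw [hY, Matrix.transpose_mul, looScale_isSymm.eq, (foldOff_isSymm hQ).eq]
  rw [hYt, Matrix.mul_assoc, ← hY]
  have htr : (Yᵀ * G * Y).trace = ∑ j, (fun i => Y i j) ⬝ᵥ (G *ᵥ fun i => Y i j) := by
    simp only [Matrix.trace, Matrix.diag, Matrix.mul_assoc]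
    refine Finset.sum_congr rfl fun j _ => ?_
    rw [Matrix.mul_apply]
    rfl
  rw [htr, frobSq, Finset.sum_comm]
  refine Finset.sum_le_sum fun j _ => ?_
  refine le_trans ?_ (le_inv_one_sub_foldBlock hQ hQ2 ha hB _)
  refine Finset.sum_le_sum fun i _ => ?_
  change foldOff Q g i j ^ 2 ≤ Y i j * Y i j
  rw [hY, looScale, Matrix.mul_diagonal, ← sq, mul_pow]
  have h1 : 1 ≤ (1 - Q j j)⁻¹ := (one_le_inv₀ (by linarith [hd j])).2 (by linarith [hd0 j])
  exact le_mul_of_one_le_right (sq_nonneg _) (one_le_pow₀ h1)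

lemma one_sub_mul_looScale_sq (hQ2 : Q * Q = Q) :
    (1 - Q) * looScale Q * looScale Q * (1 - Q) = (1 - Q) + looWeight Q := by
  have h : looScale Q * looScale Q = 1 + Matrix.diagonal fun i => ((1 - Q i i)⁻¹) ^ 2 - 1 := by
    rw [looScale, Matrix.diagonal_mul_diagonal, ← Matrix.diagonal_one, Matrix.diagonal_add]
    congr 1
    funext i
    ring
  rw [Matrix.mul_assoc (1 - Q), h, looWeight, Matrix.mul_add, Matrix.add_mul, Matrix.mul_one,
    one_sub_idem hQ2]

lemma trace_one_sub_mul_looScale_sq (hd : ∀ i, Q i i < 1) :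
    ((1 - Q) * (looScale Q * looScale Q)).trace = (looScale Q).trace := by
  rw [looScale, Matrix.diagonal_mul_diagonal]
  simp only [Matrix.trace, Matrix.diag, Matrix.mul_diagonal, Matrix.sub_apply, Matrix.one_apply_eq,
    Matrix.diagonal_apply_eq]
  refine Finset.sum_congr rfl fun i _ => ?_
  have : 1 - Q i i ≠ 0 := by linarith [hd i]
  field_simp

lemma looWeight_isSymm (hQ : Q.IsSymm) : (looWeight Q).IsSymm := by
  simp only [Matrix.IsSymm, looWeight, Matrix.transpose_mul, (isSymm_one_sub hQ).eq,
    Matrix.diagonal_transpose, Matrix.mul_assoc]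

/-- The weight is `P F P` with `P = 1 - Q` and `F ≥ 0` diagonal, so the trace is a sum of the `Fᵢ`
times squared row norms of `P Z`. -/
lemma trace_looWeight_mul_sq_nonneg (hQ : Q.IsSymm) (hd0 : ∀ i, 0 ≤ Q i i)
    (hd : ∀ i, Q i i < 1) {Z : Matrix (Fin n) (Fin n) ℝ} (hZ : Z.IsSymm) :
    0 ≤ (looWeight Q * (Z * Z)).trace := by
  set F : Fin n → ℝ := fun i => ((1 - Q i i)⁻¹) ^ 2 - 1 with hF
  have hF0 : ∀ i, 0 ≤ F i := by
    intro i
    have h1 : 1 ≤ (1 - Q i i)⁻¹ := (one_le_inv₀ (by linarith [hd i])).2 (by linarith [hd0 i])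
    have := one_le_pow₀ (n := 2) h1
    simp only [hF]
    linarith
  set Y := (1 - Q) * Z with hY
  have hYt : Yᵀ = Z * (1 - Q) := by
    rw [hY, Matrix.transpose_mul, hZ.eq, (isSymm_one_sub hQ).eq]
  have e : (looWeight Q * (Z * Z)).trace = (Matrix.diagonal F * (Y * Yᵀ)).trace := by
    rw [hYt, hY, looWeight]
    have : (1 - Q) * Matrix.diagonal F * (1 - Q) * (Z * Z) =
        (1 - Q) * (Matrix.diagonal F * ((1 - Q) * (Z * Z))) := by simp only [Matrix.mul_assoc]
    rw [this, Matrix.trace_mul_comm]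
    congr 1
    simp only [Matrix.mul_assoc]
  rw [e]
  simp only [Matrix.trace, Matrix.diag, Matrix.diagonal_mul]
  simp only [Matrix.mul_apply, Matrix.transpose_apply]
  exact Finset.sum_nonneg fun i _ => mul_nonneg (hF0 i)
    (Finset.sum_nonneg fun j _ => mul_self_nonneg _)

/-- The weight of the off-diagonal entries in the expansion of the `k`-fold error matrix. -/
def offWeight (Q : Matrix (Fin n) (Fin n) ℝ) : Matrix (Fin n) (Fin n) ℝ :=
  looScale Q * looWeight Q * looScale Q * looScale Q

/-- The squared Frobenius norm of the `k`-fold error matrix, linearized at the leave-one-out error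
matrix. -/
lemma frobSq_foldErrorMatrix_ge (hQ : Q.IsSymm) (hQ2 : Q * Q = Q) (hd0 : ∀ i, 0 ≤ Q i i)
    (hd : ∀ i, Q i i < 1) (ha : 0 < a)
    (hB : ∀ u, u ⬝ᵥ (foldBlock Q g *ᵥ u) ≤ (1 - a) * (u ⬝ᵥ u)) :
    frobSq (looErrorMatrix Q) + 2 * (frobSq (foldOff Q g) +
      2 * (offWeight Q * foldOff Q g).trace +
      2 * (offWeight Q * foldOff Q g * ((1 - foldBlock Q g)⁻¹ * foldOff Q g)).trace) ≤
    frobSq (foldErrorMatrix Q g) := by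
  have hU := isUnit_one_sub_foldBlock ha hB
  set P := 1 - Q with hP
  have hP2 : P * P = P := one_sub_idem hQ2
  set G := (1 - foldBlock Q g)⁻¹ with hG
  set E := looScale Q with hE
  set O := foldOff Q g with hO
  set U := looWeight Q with hUw
  have hGs : G.IsSymm := inv_one_sub_foldBlock_isSymm hQ
  have hEs : E.IsSymm := looScale_isSymm
  have hUs : U.IsSymm := looWeight_isSymm hQ
  set N := foldErrorMatrix Q g with hN
  set M := looErrorMatrix Q with hM
  have hNs : N.IsSymm := foldErrorMatrix_isSymm hQ
  have hMs : M.IsSymm := looErrorMatrix_isSymm hQ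
  have hMU : M = P + U := one_sub_mul_looScale_sq hQ2
  have hMP : P * M = M := by
    rw [hM, looErrorMatrix, ← hP]
    simp only [← Matrix.mul_assoc, hP2]
  have hMP' : M * P = M := by
    rw [hM, looErrorMatrix, ← hP]
    simp only [Matrix.mul_assoc, hP2]
  have tr1 : ∀ Z : Matrix (Fin n) (Fin n) ℝ, (M * (P * Z * Z * P)).trace =
      (P * (Z * Z)).trace + (U * (Z * Z)).trace := by
    intro Z
    rw [Matrix.mul_assoc P, Matrix.mul_assoc P, ← Matrix.mul_assoc M, hMP', ← Matrix.mul_assoc,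
      Matrix.trace_mul_comm, ← Matrix.mul_assoc, hMP, hMU, Matrix.add_mul, Matrix.trace_add]
  have trMN : (M * N).trace = (P * (G * G)).trace + (U * (G * G)).trace := tr1 G
  have trMM : (M * M).trace = (P * (E * E)).trace + (U * (E * E)).trace := tr1 E
  -- Convexity of the squared norm: `‖N - M‖² ≥ 0`.
  have hlin : 2 * (M * N).trace - (M * M).trace ≤ (N * N).trace := by
    have h := frobSq_nonneg (N - M)
    have hs : (N - M).IsSymm := by rw [Matrix.IsSymm, Matrix.transpose_sub, hNs.eq, hMs.eq]
    rw [frobSq_eq_trace hs] at h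
    simp only [Matrix.sub_mul, Matrix.mul_sub, Matrix.trace_sub] at h
    rw [Matrix.trace_mul_comm N M] at h
    linarith
  -- For both resolvents the trace of `P` times the square equals the trace of the resolvent itself.
  have hPG : frobSq O ≤ (P * (G * G)).trace - (P * (E * E)).trace := by
    rw [trace_one_sub_mul_inv_sq hU, trace_one_sub_mul_looScale_sq hd]
    exact frobSq_foldOff_le_trace_sub hQ hQ2 hd0 hd ha hB
  -- The quadratic form `Z ↦ tr (U Z²)` is nonnegative on symmetric `Z`; it is linearized at `E`.
  have hUG : 2 * (U * (E * (G - E))).trace ≤ (U * (G * G)).trace - (U * (E * E)).trace := by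
    have hs : (G - E).IsSymm := by rw [Matrix.IsSymm, Matrix.transpose_sub, hGs.eq, hEs.eq]
    have h := trace_looWeight_mul_sq_nonneg hQ hd0 hd hs
    rw [← hUw] at h
    have hc : (U * (G * E)).trace = (U * (E * G)).trace := by
      rw [← Matrix.trace_transpose, Matrix.transpose_mul, Matrix.transpose_mul, hUs.eq, hEs.eq,
        hGs.eq, Matrix.trace_mul_comm]
    simp only [Matrix.sub_mul, Matrix.mul_sub, Matrix.trace_sub] at h ⊢
    rw [hc] at h
    linarith
  have hexp : (U * (E * (G - E))).trace =
      (offWeight Q * O).trace + (offWeight Q * O * (G * O)).trace := by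
    have hGE : G - E = E * O * E + E * O * G * O * E := by
      have h := inv_one_sub_foldBlock_eq hQ hd hU
      rw [← hG, ← hE, ← hO] at h
      rw [add_assoc] at h
      exact sub_eq_iff_eq_add'.2 h
    have t1 : (U * (E * (E * O * E))).trace = (E * U * E * E * O).trace := by
      rw [show U * (E * (E * O * E)) = U * E * E * O * E by simp only [Matrix.mul_assoc],
        Matrix.trace_mul_comm]
      simp only [Matrix.mul_assoc]
    have t2 : (U * (E * (E * O * G * O * E))).trace = (E * U * E * E * O * (G * O)).trace := by
      rw [show U * (E * (E * O * G * O * E)) = U * E * E * O * G * O * E by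
        simp only [Matrix.mul_assoc], Matrix.trace_mul_comm]
      simp only [Matrix.mul_assoc]
    rw [hGE, Matrix.mul_add, Matrix.mul_add, Matrix.trace_add, t1, t2]
    rfl
  rw [frobSq_eq_trace hNs, frobSq_eq_trace hMs]
  linarith

/-- The weight is small because `looWeight` contains `(1 - Qᵢᵢ)⁻² - 1`, at most `8 η`; the three
factors `looScale` have norm at most `2` and the projections norm at most `1`. -/
lemma opBdd_offWeight (hQ : Q.IsSymm) (hQ2 : Q * Q = Q) (hd0 : ∀ i, 0 ≤ Q i i) {η : ℝ}
    (hη : η ≤ 1 / 2) (hd : ∀ i, Q i i ≤ η) : OpBdd (offWeight Q) (64 * η) := by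
  have hE : ∀ i, 1 ≤ (1 - Q i i)⁻¹ ∧ (1 - Q i i)⁻¹ ≤ 1 + 2 * Q i i ∧ (1 - Q i i)⁻¹ ≤ 2 := by
    intro i
    have h1 := hd i
    have h0 := hd0 i
    have hpos : 0 < 1 - Q i i := by linarith
    refine ⟨(one_le_inv₀ hpos).2 (by linarith), ?_, ?_⟩
    · rw [inv_le_iff_one_le_mul₀ hpos]
      nlinarith
    · rw [inv_le_iff_one_le_mul₀ hpos]
      linarith
  have bE : OpBdd (looScale Q) 2 := opBdd_diagonal fun i => by
    rw [abs_of_nonneg (by linarith [(hE i).1])]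
    exact (hE i).2.2
  have bF : OpBdd (Matrix.diagonal fun i => ((1 - Q i i)⁻¹) ^ 2 - 1) (8 * η) :=
    opBdd_diagonal fun i => by
      obtain ⟨h1, h2, h3⟩ := hE i
      have := hd i
      have := hd0 i
      rw [abs_of_nonneg (by nlinarith)]
      nlinarith
  have bP := opBdd_one_sub hQ hQ2
  have h := ((bE.mul ((bP.mul bF).mul bP)).mul bE).mul bE
  have e : 2 * (1 * (8 * η) * 1) * 2 * 2 = 64 * η := by ring
  rw [e] at h
  exact h

lemma frobSq_of_idem (hQ : Q.IsSymm) (hQ2 : Q * Q = Q) : frobSq Q = Q.trace := by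
  rw [frobSq_eq_trace hQ, hQ2]

/-- Averaged over the foldings, the squared Frobenius norm of the error matrix exceeds that of
leave-one-out cross validation, unless each fold has one element. -/
lemma frobSq_looErrorMatrix_lt_expect (hQ : Q.IsSymm) (hQ2 : Q * Q = Q) (hd0 : ∀ i, 0 ≤ Q i i)
    {η : ℝ} (hη : η ≤ 1 / 2048) (hd : ∀ i, Q i i ≤ η) (hη0 : 0 ≤ η) (ha : 0 < a)
    (hηa : 512 * η ≤ a) (htr : 0 < Q.trace) (hn : 2 ≤ n) (hk : k ∣ n) (hkn : k ≠ n)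
    (hB : ∀ g ∈ foldingsFinset n k, ∀ u, u ⬝ᵥ (foldBlock Q g *ᵥ u) ≤ (1 - a) * (u ⬝ᵥ u)) :
    frobSq (looErrorMatrix Q) <
      (foldingsFinset n k).expect fun g => frobSq (foldErrorMatrix Q g) := by
  have hne := foldingsFinset_nonempty hk
  have hd1 : ∀ i, Q i i < 1 := fun i => by linarith [hd i]
  -- The probability that two distinct indices share a fold; it is positive because `k ≠ n` makes
  -- the folds larger than one.
  set δ : ℝ := (((n / k : ℕ) : ℝ) - 1) / (n - 1) with hδ
  have hδpos : 0 < δ := by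
    have hn1 : (1 : ℝ) < n := by exact_mod_cast hn
    refine div_pos ?_ (by linarith)
    obtain ⟨m, rfl⟩ := hk
    have hk0 : 0 < k := Nat.pos_of_ne_zero fun h => by simp [h] at hn
    rw [Nat.mul_div_cancel_left _ hk0]
    have hm : 1 < m := by
      rcases m with _ | _ | m
      · simp at hn
      · simp at hkn
      · omega
    have : (1 : ℝ) < m := by exact_mod_cast hm
    linarith
  set F := foldingsFinset n k with hF
  have hind : ∀ i l : Fin n, F.expect (fun g =>
      ((if g i = g l then (1 : ℝ) else 0) - if i = l then 1 else 0)) = if i = l then 0 else δ := by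
    intro i l
    rw [Finset.expect_sub_distrib, expect_same_fold hn hk, Finset.expect_const hne]
    split_ifs <;> simp [hδ]
  have havg : ∀ W : Fin n → Fin n → ℝ, F.expect (fun g => ∑ i, ∑ l,
      W i l * ((if g i = g l then (1 : ℝ) else 0) - if i = l then 1 else 0)) =
      δ * (∑ i, ∑ l, W i l - ∑ i, W i i) := by
    intro W
    simp only [Finset.expect_sum_comm, ← Finset.mul_expect, hind]
    have : ∀ i l, W i l * (if i = l then 0 else δ) = δ * W i l - if i = l then δ * W i l else 0 := by
      intro i l; split_ifs <;> ring
    simp only [this, Finset.sum_sub_distrib, Finset.sum_ite_eq, Finset.mem_univ, if_true,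
      ← Finset.mul_sum]
    ring
  have hO2 : F.expect (fun g => frobSq (foldOff Q g)) = δ * (Q.trace - ∑ i, Q i i ^ 2) := by
    have e : ∀ g : Fin n → Fin k, frobSq (foldOff Q g) = ∑ i, ∑ l, Q i l ^ 2 *
        ((if g i = g l then (1 : ℝ) else 0) - if i = l then 1 else 0) := by
      intro g
      refine Finset.sum_congr rfl fun i _ => Finset.sum_congr rfl fun l _ => ?_
      rw [foldOff_apply]
      by_cases h : i = l
      · subst h; simp
      · by_cases h' : g i = g l <;> simp [h, h']
    simp only [e, havg]
    rw [← frobSq_of_idem hQ hQ2]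
    rfl
  have hOlin : F.expect (fun g => (offWeight Q * foldOff Q g).trace) =
      δ * ((offWeight Q * Q).trace - ∑ i, offWeight Q i i * Q i i) := by
    have e : ∀ g : Fin n → Fin k, (offWeight Q * foldOff Q g).trace = ∑ i, ∑ l,
        (offWeight Q i l * Q l i) *
        ((if g i = g l then (1 : ℝ) else 0) - if i = l then 1 else 0) := by
      intro g
      simp only [Matrix.trace, Matrix.diag, Matrix.mul_apply]
      refine Finset.sum_congr rfl fun i _ => Finset.sum_congr rfl fun l _ => ?_
      rw [foldOff_apply]
      simp only [eq_comm (a := g l), eq_comm (a := l)]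
      ring
    simp only [e, havg]
    rfl
  have bW := opBdd_offWeight hQ hQ2 hd0 (by linarith) hd
  -- Writing `Q = Q Q` and applying Cauchy–Schwarz bounds this by the trace of `Q` instead of `n`.
  have b1 : |(offWeight Q * Q).trace| ≤ 64 * η * Q.trace := by
    have h := abs_trace_mul_le (M := offWeight Q * Q) (N := Q) (a := 64 * η) (b := 1)
      (by positivity) zero_le_one htr.le
      ((bW.frobSq_mul_le Q).trans (by rw [frobSq_of_idem hQ hQ2]))
      (by rw [frobSq_of_idem hQ hQ2]; simp)
    rwa [Matrix.mul_assoc, hQ2, mul_one] at h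
  have b2 : |∑ i, offWeight Q i i * Q i i| ≤ 64 * η * Q.trace := by
    refine (Finset.abs_sum_le_sum_abs _ _).trans ?_
    rw [Matrix.trace, Finset.mul_sum]
    refine Finset.sum_le_sum fun i _ => ?_
    rw [abs_mul, abs_of_nonneg (hd0 i)]
    exact mul_le_mul_of_nonneg_right (bW.abs_diag_le (by positivity) i) (hd0 i)
  have b3 : ∀ g ∈ F, -(1 / 8 * frobSq (foldOff Q g)) ≤
      (offWeight Q * foldOff Q g * ((1 - foldBlock Q g)⁻¹ * foldOff Q g)).trace := by
    intro g hg
    have h := abs_trace_mul_le (M := offWeight Q * foldOff Q g)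
      (N := (1 - foldBlock Q g)⁻¹ * foldOff Q g) (a := 64 * η) (b := 1 / a)
      (by positivity) (by positivity) (frobSq_nonneg _) (bW.frobSq_mul_le _)
      ((opBdd_inv_one_sub_foldBlock ha (hB g hg)).frobSq_mul_le _)
    -- Counted twice, the term quadratic in `foldOff` costs at most a quarter of its squared norm;
    -- this leaves the `3 / 4` below.
    have hc : 64 * η * (1 / a) ≤ 1 / 8 := by
      rw [mul_one_div, div_le_iff₀ ha]
      linarith
    have := mul_le_mul_of_nonneg_right hc (frobSq_nonneg (foldOff Q g))
    linarith [(abs_le.1 h).1]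
  have hsum : ∑ i, Q i i ^ 2 ≤ η * Q.trace := by
    rw [Matrix.trace, Finset.mul_sum]
    refine Finset.sum_le_sum fun i _ => ?_
    rw [sq]
    exact mul_le_mul_of_nonneg_right (hd i) (hd0 i)
  have hle := Finset.expect_le_expect (s := F)
    (f := fun g => frobSq (looErrorMatrix Q) + 2 * (3 / 4 * frobSq (foldOff Q g) +
      2 * (offWeight Q * foldOff Q g).trace)) (g := fun g => frobSq (foldErrorMatrix Q g))
    fun g hg => by
      have h1 := frobSq_foldErrorMatrix_ge hQ hQ2 hd0 hd1 ha (hB g hg)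
      have h2 := b3 g hg
      linarith
  refine lt_of_lt_of_le ?_ hle
  rw [Finset.expect_add_distrib, Finset.expect_const hne, ← Finset.mul_expect,
    Finset.expect_add_distrib, ← Finset.mul_expect, ← Finset.mul_expect, hO2, hOlin]
  have k1 := (abs_le.1 b1).1
  have k2 := (abs_le.1 b2).2
  -- The linear terms cost at most `2 (64 + 64) η ≤ 1 / 8` of the trace, and the squared diagonal at
  -- most a fraction `η`.
  have k3 : 0 < 3 / 4 * (Q.trace - ∑ i, Q i i ^ 2) +
      2 * ((offWeight Q * Q).trace - ∑ i, offWeight Q i i * Q i i) := by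
    have : η * Q.trace ≤ 1 / 2048 * Q.trace := mul_le_mul_of_nonneg_right hη htr.le
    linarith
  nlinarith [mul_pos hδpos k3]

end LeaveOneOutComparison

/-! ### The hat matrix of the full sample -/

section Hat

variable {n p : ℕ} {X : Matrix (Fin n) (Fin p) ℝ}

lemma kernel_univ_idem (hU : IsUnit (gram X Finset.univ).det) :
    kernel X Finset.univ * kernel X Finset.univ = kernel X Finset.univ := by
  ext t s
  rw [Matrix.mul_apply]
  exact sum_kernel_mul_kernel_mem hU t s

lemma trace_kernel_univ (hU : IsUnit (gram X Finset.univ).det) :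
    (kernel X Finset.univ).trace = p := sum_kernel_diag hU

/-- The columns of the kernel of `S` lie in the column space of `X`, which the hat matrix fixes. -/
lemma kernel_univ_mul_kernel (hU : IsUnit (gram X Finset.univ).det) (S : Finset (Fin n))
    (t s : Fin n) : ∑ i, kernel X Finset.univ t i * kernel X S i s = kernel X S t s := by
  rw [← (kernel_isSymm X S).apply t s, ← sum_kernel_mul_kernel_mem hU s t]
  refine Finset.sum_congr rfl fun i _ => ?_
  rw [(kernel_isSymm X S).apply s i, (kernel_isSymm X Finset.univ).apply i t, mul_comm]

end Hat

/-! ### The `k`-fold estimator and optimality of leave-one-out -/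

section KFold

variable {p n k : ℕ} {x : ℕ → Fin p → ℝ} {c C l : ℝ}

/-- The training set of the fold `j`. -/
def trainOf (g : Fin n → Fin k) (j : Fin k) : Finset (Fin n) := Finset.univ.filter fun i => g i ≠ j

lemma compl_trainOf (g : Fin n → Fin k) (j : Fin k) :
    (trainOf g j)ᶜ = Finset.univ.filter fun i => g i = j := by
  ext i
  simp [trainOf]

lemma le_two_mul_card_trainOf {g : Fin n → Fin k} (hg : g ∈ foldingsFinset n k) (hk : 2 ≤ k)
    (j : Fin k) : n ≤ 2 * (trainOf g j).card := by
  have h1 := mem_foldingsFinset.1 hg j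
  have h2 := Finset.card_add_card_compl (trainOf g j)
  rw [compl_trainOf, h1, Fintype.card_fin] at h2
  have h3 : n / k ≤ n / 2 := Nat.div_le_div_left hk (by norm_num)
  omega

/-- On vectors that vanish on a large set the hat matrix is bounded away from the identity. -/
lemma DesignBounds.kernel_univ_le (h : DesignBounds x n c C l) {S : Finset (Fin n)}
    (hS : n ≤ 2 * S.card) {a : ℝ} (ha1 : a ≤ 1) (haC : 2 * C * a ≤ c)
    {v : Fin n → ℝ} (hv : ∀ i ∈ S, v i = 0) :
    v ⬝ᵥ (kernel (design x n) Finset.univ *ᵥ v) ≤ (1 - a) * (v ⬝ᵥ v) := by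
  have hU : IsUnit (gram (design x n) Finset.univ).det := h.isUnit (by simp; omega)
  set X := design x n with hX
  set w := (gram X Finset.univ)⁻¹ *ᵥ (Xᵀ *ᵥ v) with hw
  set z := kernel X Finset.univ *ᵥ v with hz
  have hzi : ∀ i, z i = X i ⬝ᵥ w := by
    intro i
    rw [hz, kernel, ← Matrix.mulVec_mulVec, ← Matrix.mulVec_mulVec]
    rfl
  set q := v ⬝ᵥ z with hq
  have hqz : q = ∑ i, z i ^ 2 := by
    rw [hq, hz, dotProduct_mulVec_self_of_idem (kernel_isSymm X Finset.univ)
      (kernel_univ_idem hU)]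
    simp only [dotProduct, ← sq]
  have hq0 : 0 ≤ q := by
    rw [hqz]
    exact Finset.sum_nonneg fun _ _ => sq_nonneg _
  have hvv : v ⬝ᵥ v = ∑ i ∈ Sᶜ, v i ^ 2 := by
    rw [dotProduct, ← Finset.sum_add_sum_compl S,
      Finset.sum_eq_zero fun i hi => by rw [hv i hi, zero_mul], zero_add]
    exact Finset.sum_congr rfl fun i _ => (sq _).symm
  have hqS : q = ∑ i ∈ Sᶜ, v i * z i := by
    rw [hq, dotProduct, ← Finset.sum_add_sum_compl S,
      Finset.sum_eq_zero fun i hi => by rw [hv i hi, zero_mul], zero_add]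
  have hcs : q ^ 2 ≤ (v ⬝ᵥ v) * ∑ i ∈ Sᶜ, z i ^ 2 := by
    rw [hqS, hvv]
    exact Finset.sum_mul_sq_le_sq_mul_sq _ _ _
  have hww : 0 ≤ w ⬝ᵥ w := Finset.sum_nonneg fun _ _ => mul_self_nonneg _
  have hqw : q ≤ C * n * (w ⬝ᵥ w) := by
    rw [hqz]
    refine le_trans ?_ (mul_le_mul_of_nonneg_right h.sum_le hww)
    rw [Finset.sum_mul]
    refine Finset.sum_le_sum fun i _ => ?_
    rw [hzi]
    have := Finset.sum_mul_sq_le_sq_mul_sq Finset.univ (X i) w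
    simpa only [dotProduct, ← sq] using this
  -- The projection `z = X w` has total squared length at most `C n |w|²`, while its part on `S` has
  -- at least `c |S| |w|² ≥ c n |w|² / 2`.
  have hSz : a * q ≤ ∑ i ∈ S, z i ^ 2 := by
    have h1 := h.gram_ge S hS w
    rw [dotProduct_gram_mulVec] at h1
    simp only [hzi]
    refine le_trans ?_ h1
    have hSc : (n : ℝ) ≤ 2 * S.card := by exact_mod_cast hS
    rcases le_or_gt a 0 with ha | ha
    · exact (mul_nonpos_of_nonpos_of_nonneg ha hq0).trans
        (mul_nonneg (h.card_pos hS).le hww)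
    · calc a * q ≤ a * (C * n * (w ⬝ᵥ w)) := mul_le_mul_of_nonneg_left hqw ha.le
        _ = (2 * C * a) * (n / 2 * (w ⬝ᵥ w)) := by ring
        _ ≤ c * (n / 2 * (w ⬝ᵥ w)) := by gcongr
        _ ≤ c * (S.card * (w ⬝ᵥ w)) := by
            have := h.c_pos
            gcongr
            linarith
        _ = _ := by ring
  have hsplit := Finset.sum_add_sum_compl S fun i => z i ^ 2
  rw [← hqz] at hsplit
  have hvv0 : 0 ≤ v ⬝ᵥ v := Finset.sum_nonneg fun _ _ => mul_self_nonneg _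
  have hcs2 : q * q ≤ ((1 - a) * (v ⬝ᵥ v)) * q := by
    rw [sq] at hcs
    refine hcs.trans ?_
    calc (v ⬝ᵥ v) * ∑ i ∈ Sᶜ, z i ^ 2 ≤ (v ⬝ᵥ v) * ((1 - a) * q) := by
          refine mul_le_mul_of_nonneg_left ?_ hvv0
          linarith
      _ = _ := by ring
  -- The factor `q` can be cancelled only when it is positive.
  rcases hq0.eq_or_lt with h0 | h0
  · rw [← h0]
    exact mul_nonneg (by linarith) hvv0
  · exact le_of_mul_le_mul_right hcs2 h0

lemma DesignBounds.foldBlock_le (h : DesignBounds x n c C l) (hk : 2 ≤ k)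
    {g : Fin n → Fin k} (hg : g ∈ foldingsFinset n k) {a : ℝ} (ha1 : a ≤ 1) (haC : 2 * C * a ≤ c)
    (u : Fin n → ℝ) :
    u ⬝ᵥ (foldBlock (kernel (design x n) Finset.univ) g *ᵥ u) ≤ (1 - a) * (u ⬝ᵥ u) := by
  rw [dotProduct_foldBlock_mulVec]
  have huu : u ⬝ᵥ u = ∑ j, (fun i => if g i = j then u i else 0) ⬝ᵥ
      (fun i => if g i = j then u i else 0) := by
    simp only [dotProduct]
    rw [Finset.sum_comm]
    refine Finset.sum_congr rfl fun i _ => ?_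
    simp
  rw [huu, Finset.mul_sum]
  refine Finset.sum_le_sum fun j _ => ?_
  refine h.kernel_univ_le (le_two_mul_card_trainOf hg hk j) ha1 haC fun i hi => ?_
  have : g i ≠ j := by simpa [trainOf] using hi
  simp [this]

/-- The residuals outside the folds solve a linear system with the full-sample residuals as
right-hand side. -/
lemma one_sub_foldBlock_mulVec_residual {X : Matrix (Fin n) (Fin p) ℝ} {g : Fin n → Fin k}
    (hU : IsUnit (gram X Finset.univ).det) (hS : ∀ j, IsUnit (gram X (trainOf g j)).det)
    (e : Fin n → ℝ) :
    (1 - foldBlock (kernel X Finset.univ) g) *ᵥ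
      (fun i => e i - ∑ m ∈ trainOf g (g i), kernel X (trainOf g (g i)) i m * e m) =
    (1 - kernel X Finset.univ) *ᵥ e := by
  funext i
  rw [Matrix.sub_mulVec, Matrix.sub_mulVec, Matrix.one_mulVec, Matrix.one_mulVec]
  simp only [Pi.sub_apply]
  set S := trainOf g (g i) with hSdef
  set Q := kernel X Finset.univ with hQ
  set K := kernel X S with hK
  have hB : (foldBlock Q g *ᵥ
      (fun i => e i - ∑ m ∈ trainOf g (g i), kernel X (trainOf g (g i)) i m * e m)) i =
      ∑ t ∈ Sᶜ, Q i t * (e t - ∑ m ∈ S, K t m * e m) := by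
    rw [hSdef, compl_trainOf, Finset.sum_filter]
    simp only [Matrix.mulVec, dotProduct]
    refine Finset.sum_congr rfl fun t _ => ?_
    by_cases h : g t = g i
    · simp [foldBlock, h, hK, hSdef]
    · simp [foldBlock, h, Ne.symm h]
  have hQe : (Q *ᵥ e) i = ∑ t ∈ S, Q i t * e t + ∑ t ∈ Sᶜ, Q i t * e t :=
    (Finset.sum_add_sum_compl S fun t => Q i t * e t).symm
  -- The hat matrix reproduces the kernel over the whole sample, and the kernel reproduces the hat
  -- matrix over `S`; the difference is the sum over the fold.
  have hcross : ∑ t ∈ Sᶜ, Q i t * ∑ m ∈ S, K t m * e m =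
      ∑ m ∈ S, K i m * e m - ∑ m ∈ S, Q i m * e m := by
    simp only [Finset.mul_sum]
    rw [Finset.sum_comm, ← Finset.sum_sub_distrib]
    refine Finset.sum_congr rfl fun m _ => ?_
    have h1 := kernel_univ_mul_kernel hU S i m
    rw [← Finset.sum_add_sum_compl S] at h1
    have h2 := sum_kernel_mul_kernel_mem (R := Finset.univ) (hS (g i)) i m
    rw [← hSdef] at h2
    rw [h2] at h1
    have h3 : ∑ t ∈ Sᶜ, Q i t * K t m = K i m - Q i m := by
      rw [hQ, hK]
      linarith
    rw [← sub_mul, ← h3, Finset.sum_mul]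
    exact Finset.sum_congr rfl fun t _ => by ring
  rw [hB, hQe]
  simp only [mul_sub, Finset.sum_sub_distrib]
  rw [hcross]
  ring

lemma quadForm_eq_dotProduct (M : Matrix (Fin n) (Fin n) ℝ) (e : ℕ → ℝ) :
    quadForm M e = (fun i : Fin n => e i) ⬝ᵥ (M *ᵥ fun i : Fin n => e i) := by
  simp only [quadForm, dotProduct, Matrix.mulVec, Finset.mul_sum]
  exact Finset.sum_congr rfl fun i _ => Finset.sum_congr rfl fun j _ => by ring

/-- Folds of equal size turn the average of fold averages into `1 / n` times the sum of all squared
held-out residuals, which are obtained by inverting `1 - foldBlock`. -/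
lemma kFoldEstimator_eq_quadForm (hn : 0 < n) (hk : k ∣ n) {g : Fin n → Fin k}
    (hg : g ∈ foldingsFinset n k)
    (hU : IsUnit (gram (design x n) Finset.univ).det)
    (hS : ∀ j, IsUnit (gram (design x n) (trainOf g j)).det)
    (hB : IsUnit (1 - foldBlock (kernel (design x n) Finset.univ) g).det)
    (β : Fin p → ℝ) (e : ℕ → ℝ) :
    kFoldEstimator (design x n) (response x β n e) g =
      1 / (n : ℝ) * quadForm (foldErrorMatrix (kernel (design x n) Finset.univ) g) e := by
  set X := design x n with hX
  set Q := kernel X Finset.univ with hQ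
  have hQs : Q.IsSymm := kernel_isSymm X Finset.univ
  set r : Fin n → ℝ :=
    fun i => e i - ∑ m ∈ trainOf g (g i), kernel X (trainOf g (g i)) i m * e m with hr
  have htest : ∀ j, testSetError X (response x β n e) (Finset.univ.filter fun i => g i ≠ j) =
      1 / ((n / k : ℕ) : ℝ) * ∑ i, if g i = j then r i ^ 2 else 0 := by
    intro j
    change testSetError X (response x β n e) (trainOf g j) = _
    rw [testSetError, compl_trainOf, mem_foldingsFinset.1 hg j, ← Finset.sum_filter]
    congr 1
    refine Finset.sum_congr rfl fun i hi => ?_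
    have hij : g i = j := (Finset.mem_filter.1 hi).2
    rw [residual_eq (hS j), hr]
    simp only [hij]
    ring
  have hsum : kFoldEstimator X (response x β n e) g = 1 / (n : ℝ) * ∑ i, r i ^ 2 := by
    rw [kFoldEstimator]
    simp only [htest]
    rw [← Finset.mul_sum, ← mul_assoc, Finset.sum_comm]
    congr 1
    · obtain ⟨m, rfl⟩ := hk
      have hk0 : 0 < k := Nat.pos_of_ne_zero fun h => by simp [h] at hn
      rw [Nat.mul_div_cancel_left _ hk0]
      push_cast
      field_simp
    · exact Finset.sum_congr rfl fun i _ => by simp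
  rw [hsum, quadForm_eq_dotProduct]
  congr 1
  have hsys := one_sub_foldBlock_mulVec_residual hU hS (fun i : Fin n => e i)
  rw [← hQ] at hsys
  set G := (1 - foldBlock Q g)⁻¹ with hG
  have hrG : r = G *ᵥ ((1 - Q) *ᵥ fun i : Fin n => e i) := by
    rw [← hsys, Matrix.mulVec_mulVec, Matrix.nonsing_inv_mul _ hB, Matrix.one_mulVec]
  have hGs : Gᵀ = G := (inv_one_sub_foldBlock_isSymm hQs).eq
  have hPs : (1 - Q)ᵀ = 1 - Q := (isSymm_one_sub hQs).eq
  have h1 : ∑ i, r i ^ 2 = r ⬝ᵥ r := Finset.sum_congr rfl fun i _ => sq _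
  rw [h1, foldErrorMatrix, ← hG, ← Matrix.mulVec_mulVec, ← Matrix.mulVec_mulVec,
    ← Matrix.mulVec_mulVec, ← hrG, Matrix.dotProduct_mulVec, ← Matrix.mulVec_transpose, hPs,
    Matrix.dotProduct_mulVec, ← Matrix.mulVec_transpose, hGs, ← hrG]

/-- For folds of size one the error matrix is that of leave-one-out cross validation. -/
lemma foldErrorMatrix_eq_looErrorMatrix {Q : Matrix (Fin n) (Fin n) ℝ} {g : Fin n → Fin n}
    (hg : g ∈ foldingsFinset n n) (hd : ∀ i, Q i i < 1) :
    foldErrorMatrix Q g = looErrorMatrix Q := by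
  have hinj : Function.Injective g := by
    intro i l hil
    have hn : 0 < n := i.pos
    have h := mem_foldingsFinset.1 hg (g l)
    rw [Nat.div_self hn, Finset.card_eq_one] at h
    obtain ⟨b, hb⟩ := h
    have hi : i ∈ Finset.univ.filter fun m => g m = g l := by simp [hil]
    have hl : l ∈ Finset.univ.filter fun m => g m = g l := by simp
    rw [hb, Finset.mem_singleton] at hi hl
    rw [hi, hl]
  have hblock : foldBlock Q g = Matrix.diagonal Q.diag := by
    ext i m
    simp only [foldBlock, Matrix.diagonal_apply, Matrix.diag, hinj.eq_iff]
    by_cases h : i = m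
    · subst h; simp
    · simp [h]
  have hinv : (1 - foldBlock Q g)⁻¹ = looScale Q := by
    rw [hblock]
    exact Matrix.inv_eq_left_inv (looScale_mul_one_sub hd)
  rw [foldErrorMatrix, hinv, looErrorMatrix]

variable {Ω : Type*} [MeasurableSpace Ω] {P : Measure Ω} [IsProbabilityMeasure P] {ε : ℕ → Ω → ℝ}

/-- The fourth moment of the normal law removes the diagonal term from the variance of the quadratic
form. -/
lemma kFoldVariance_eq (hmeas : ∀ i, Measurable (ε i)) (hindep : iIndepFun ε P)
    (hident : ∀ i, IdentDistrib (ε i) (ε 0) P P) (h0 : ∫ ω, ε 0 ω ∂P = 0)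
    (h4 : Integrable (fun ω => ε 0 ω ^ 4) P) {s : ℝ} (hs : s = ∫ ω, ε 0 ω ^ 2 ∂P)
    (hκ : ∫ ω, ε 0 ω ^ 4 ∂P = 3 * s ^ 2) (β : Fin p → ℝ) (h : DesignBounds x n c C l)
    (hk2 : 2 ≤ k) (hk : k ∣ n) {a : ℝ} (ha : 0 < a) (ha1 : a ≤ 1) (haC : 2 * C * a ≤ c) :
    kFoldVariance P x β ε n k =
      (1 / (n : ℝ)) ^ 2 * (2 * s ^ 2 * (foldingsFinset n k).expect fun g =>
        frobSq (foldErrorMatrix (kernel (design x n) Finset.univ) g)) +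
      ((foldingsFinset n k).expect (fun g =>
        (1 / (n : ℝ) * (s * (foldErrorMatrix (kernel (design x n) Finset.univ) g).trace)) ^ 2) -
      ((foldingsFinset n k).expect fun g =>
        1 / (n : ℝ) * (s * (foldErrorMatrix (kernel (design x n) Finset.univ) g).trace)) ^ 2) := by
  have hn := h.two_le
  have hU : IsUnit (gram (design x n) Finset.univ).det := h.isUnit (by simp; omega)
  have hQs := kernel_isSymm (design x n) Finset.univ
  have hform : ∀ g ∈ foldingsFinset n k,
      (fun ω => kFoldEstimator (design x n) (response x β n fun i => ε i ω) g) =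
      fun ω => 1 / (n : ℝ) * quadForm (foldErrorMatrix (kernel (design x n) Finset.univ) g)
        (fun i => ε i ω) := by
    intro g hg
    funext ω
    exact kFoldEstimator_eq_quadForm (by omega) hk hg hU
      (fun j => h.isUnit (le_two_mul_card_trainOf hg hk2 j))
      (isUnit_one_sub_foldBlock ha (h.foldBlock_le hk2 hg ha1 haC)) β _
  unfold kFoldVariance
  rw [← coe_foldingsFinset, variance_prod_uniformOn _ (foldingsFinset_nonempty hk)]
  · congr 1
    · rw [Finset.mul_expect, Finset.mul_expect]
      refine Finset.expect_congr rfl fun g hg => ?_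
      simp only [hform g hg]
      rw [variance_const_mul, variance_quadForm hmeas hindep hident h0 h4 _
        (foldErrorMatrix_isSymm hQs), ← hs, hκ, sub_self, zero_mul, zero_add, frobSq]
    · have hmean : ∀ g ∈ foldingsFinset n k,
          ∫ ω, kFoldEstimator (design x n) (response x β n fun i => ε i ω) g ∂P =
          1 / (n : ℝ) * (s * (foldErrorMatrix (kernel (design x n) Finset.univ) g).trace) := by
        intro g hg
        simp only [congrFun (hform g hg)]
        rw [integral_const_mul, integral_quadForm hmeas hindep hident h0 h4, ← hs]
      congr 1
      · exact Finset.expect_congr rfl fun g hg => by rw [← hmean g hg]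
      · congr 1
        exact Finset.expect_congr rfl fun g hg => by rw [← hmean g hg]
  · intro g hg
    simp only [hform g hg]
    exact (memLp_quadForm hmeas hident h4 _).const_mul _
  · intro g hg
    simp only [hform g hg]
    exact (measurable_quadForm hmeas _).const_mul _

theorem eventually_optFoldNumbers {V : Matrix (Fin p) (Fin p) ℝ} (hp : 1 ≤ p)
    (hx : RegularDesign x V) (β : Fin p → ℝ)
    (hmeas : ∀ i, Measurable (ε i)) (hindep : iIndepFun ε P)
    (hident : ∀ i, IdentDistrib (ε i) (ε 0) P P) (h0 : ∫ ω, ε 0 ω ∂P = 0)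
    (h4 : Integrable (fun ω => ε 0 ω ^ 4) P) {s : ℝ} (hs : s = ∫ ω, ε 0 ω ^ 2 ∂P)
    (hκ : ∫ ω, ε 0 ω ^ 4 ∂P = 3 * s ^ 2) (hs0 : s ≠ 0) :
    ∀ᶠ n : ℕ in atTop, optFoldNumbers P x β ε n = {n} := by
  obtain ⟨c, C, hc, hC, hb⟩ := exists_designBounds hx
  -- This `a` keeps every block of the hat matrix at distance `a` below the identity. The choice of
  -- `l` below gives `η = a / 2048`, so both `η ≤ 1 / 2048` and `512 η ≤ a` hold.
  set a : ℝ := min (c / (2 * C)) 1 with ha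
  have ha0 : 0 < a := lt_min (by positivity) one_pos
  have ha1 : a ≤ 1 := min_le_right _ _
  have haC : 2 * C * a ≤ c := by
    have h1 : a ≤ c / (2 * C) := min_le_left _ _
    rw [le_div_iff₀ (by positivity)] at h1
    linarith
  set l : ℝ := a * c / 4096 with hl
  have hl0 : 0 < l := by positivity
  filter_upwards [hb l hl0] with n h
  have hn := h.two_le
  have hU : IsUnit (gram (design x n) Finset.univ).det := h.isUnit (by simp; omega)
  set Q := kernel (design x n) Finset.univ with hQ
  have hQs : Q.IsSymm := kernel_isSymm _ _
  have hQ2 : Q * Q = Q := kernel_univ_idem hU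
  have hd0 : ∀ i, 0 ≤ Q i i := kernel_diag_nonneg hU
  set η : ℝ := 2 * l / c with hη
  have hηa : η = a / 2048 := by
    rw [hη, hl]
    field_simp
    ring
  have hd : ∀ i, Q i i ≤ η := h.kernel_le (by simp; omega)
  have hd1 : ∀ i, Q i i < 1 := fun i => by linarith [hd i]
  have htr : Q.trace = p := trace_kernel_univ hU
  have hnpos : (0 : ℝ) < n := by positivity
  refine argMin_eq_singleton ⟨hn, dvd_rfl⟩ ?_
  rintro k ⟨hk2, hk⟩ hkn
  have hlt := frobSq_looErrorMatrix_lt_expect (a := a) (η := η) (k := k) hQs hQ2 hd0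
    (by linarith) hd (by linarith) ha0 (by linarith)
    (by rw [htr]; exact_mod_cast hp) hn hk hkn
    (fun g hg => h.foldBlock_le hk2 hg ha1 haC)
  rw [kFoldVariance_eq hmeas hindep hident h0 h4 hs hκ β h hn dvd_rfl ha0 ha1 haC,
    kFoldVariance_eq hmeas hindep hident h0 h4 hs hκ β h hk2 hk ha0 ha1 haC]
  have hne := foldingsFinset_nonempty (dvd_refl n)
  -- With folds of size one the error matrix is the same for every folding, so the conditional mean
  -- contributes no variance; for other `k` that contribution is nonnegative and is dropped.
  have c1 : ∀ f : Matrix (Fin n) (Fin n) ℝ → ℝ,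
      (foldingsFinset n n).expect (fun g => f (foldErrorMatrix Q g)) = f (looErrorMatrix Q) := by
    intro f
    refine (Finset.expect_congr rfl fun g hg => ?_).trans (Finset.expect_const hne _)
    rw [foldErrorMatrix_eq_looErrorMatrix hg hd1]
  rw [← hQ, c1 frobSq, c1 fun M => (1 / (n : ℝ) * (s * M.trace)) ^ 2,
    c1 fun M => 1 / (n : ℝ) * (s * M.trace), sub_self, add_zero]
  refine lt_add_of_lt_of_nonneg ?_ (expect_sq_sub_sq_nonneg _ (foldingsFinset_nonempty hk) _)
  have hs2 : 0 < s ^ 2 := by positivity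
  gcongr

end KFold

/-! ### Moments under the hypotheses of the theorem -/

section Main

variable {Ω : Type*} [MeasurableSpace Ω] {P : Measure Ω}

lemma integral_pow_of_map_gaussian {f : Ω → ℝ} (hf : Measurable f) {v : ℝ≥0}
    (h : P.map f = gaussianReal 0 v) (m : ℕ) :
    ∫ ω, f ω ^ m ∂P = ∫ y, y ^ m ∂gaussianReal 0 v := by
  rw [← h, integral_map hf.aemeasurable (by fun_prop)]

lemma integrable_pow_four_of_map_gaussian {f : Ω → ℝ} (hf : Measurable f) {v : ℝ≥0}
    (h : P.map f = gaussianReal 0 v) : Integrable (fun ω => f ω ^ 4) P := by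
  have h1 : Integrable (fun y : ℝ => y ^ 4) (gaussianReal 0 v) := by
    have := (memLp_id_gaussianReal (μ := 0) (v := v) 4).integrable_norm_pow (by norm_num)
    simpa [Even.pow_abs (by decide : Even 4)] using this
  rw [← h] at h1
  exact h1.comp_measurable hf

lemma integrable_pow_four_of_rpow [IsProbabilityMeasure P] {f : Ω → ℝ} (hf : Measurable f) {δ : ℝ}
    (hδ : 0 < δ) (h : Integrable (fun ω => |f ω| ^ (4 + δ)) P) :
    Integrable (fun ω => f ω ^ 4) P := by
  refine (h.add (integrable_const (1 : ℝ))).mono' (by fun_prop) (Eventually.of_forall fun ω => ?_)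
  simp only [Pi.add_apply, Real.norm_eq_abs, abs_pow]
  have hpos : 0 ≤ |f ω| ^ (4 + δ) := by positivity
  rcases le_total (|f ω|) 1 with h1 | h1
  · have := pow_le_one₀ (n := 4) (abs_nonneg (f ω)) h1
    linarith
  · have h2 : |f ω| ^ (4 : ℕ) ≤ |f ω| ^ (4 + δ) := by
      rw [← Real.rpow_natCast]
      exact Real.rpow_le_rpow_of_exponent_le h1 (by push_cast; linarith)
    linarith

end Main

end RegressionCV

end

theorem mainTheorem3 {Ω : Type*} [MeasurableSpace Ω] (P : Measure Ω) [IsProbabilityMeasure P]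
    {p : ℕ} (hp : 1 ≤ p) (x : ℕ → Fin p → ℝ) (V : Matrix (Fin p) (Fin p) ℝ)
    (hx : RegressionCV.RegularDesign x V) (β : Fin p → ℝ) (ε : ℕ → Ω → ℝ)
    (hmeas : ∀ i, Measurable (ε i)) (hindep : iIndepFun ε P)
    (hident : ∀ i, IdentDistrib (ε i) (ε 0) P P) :
    ((∃ σsq : ℝ≥0, σsq ≠ 0 ∧ P.map (ε 0) = gaussianReal 0 σsq) →
      (∀ᶠ n : ℕ in atTop,
        RegressionCV.optTrainingSizes P x β ε n = {⌈(n : ℝ) / 2⌉₊}) ∧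
      (∀ᶠ n : ℕ in atTop, RegressionCV.optFoldNumbers P x β ε n = {n})) ∧
    (((∫ ω, ε 0 ω ∂P) = 0 ∧
        (∃ δ : ℝ, 0 < δ ∧ Integrable (fun ω => |ε 0 ω| ^ (4 + δ)) P) ∧
        0 < variance (fun ω => ε 0 ω ^ 2) P) →
      ∀ᶠ n : ℕ in atTop,
        RegressionCV.optTrainingSizes P x β ε n = {⌈(n : ℝ) / 2⌉₊}) := by
  constructor
  · rintro ⟨v, hv, hlaw⟩
    have h0 : ∫ ω, ε 0 ω ∂P = 0 := by
      have := RegressionCV.integral_pow_of_map_gaussian (hmeas 0) hlaw 1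
      simpa [integral_id_gaussianReal] using this
    have h2 : ∫ ω, ε 0 ω ^ 2 ∂P = v := by
      rw [RegressionCV.integral_pow_of_map_gaussian (hmeas 0) hlaw 2, RegressionCV.integral_sq_gaussianReal]
    have h4 : ∫ ω, ε 0 ω ^ 4 ∂P = 3 * (v : ℝ) ^ 2 := by
      rw [RegressionCV.integral_pow_of_map_gaussian (hmeas 0) hlaw 4, RegressionCV.integral_pow_four_gaussianReal]
    have hi := RegressionCV.integrable_pow_four_of_map_gaussian (hmeas 0) hlaw
    have hv0 : (v : ℝ) ≠ 0 := by exact_mod_cast hv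
    refine ⟨RegressionCV.eventually_optTrainingSizes hx β hmeas hindep hident h0 hi ?_,
      RegressionCV.eventually_optFoldNumbers hp hx β hmeas hindep hident h0 hi h2.symm h4 hv0⟩
    -- For normal errors the variance of the squared error is `3 v² - v² = 2 v²`.
    rw [h2, h4]
    have : 0 < (v : ℝ) ^ 2 := by positivity
    linarith
  · rintro ⟨h0, ⟨δ, hδ, hint⟩, hvar⟩
    have hi := RegressionCV.integrable_pow_four_of_rpow (hmeas 0) hδ hint
    refine RegressionCV.eventually_optTrainingSizes hx β hmeas hindep hident h0 hi ?_
    have hm := hmeas 0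
    have hL : MemLp (fun ω => ε 0 ω ^ 2) 2 P := by
      rw [memLp_two_iff_integrable_sq (by fun_prop)]
      simpa [← pow_mul] using hi
    rw [variance_eq_sub hL] at hvar
    simpa [← pow_mul] using hvar
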